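/- Let $\Bbbk$ be an algebraically closed field of characteristic $0$. A symmetric quiver $(Q,\sigma)$ is a finite quiver $Q$ (tails $ta$, heads $ha$) with an involution $\sigma$ of its vertices and of its arrows such that $t\sigma(a)=\sigma(ha)$, $h\sigma(a)=\sigma(ta)$, and $\sigma(a)=a$ whenever $\sigma(ta)=ha$. Let $(Q,\sigma)$ be a symmetric quiver of tame type, i.e. $Q$ has no oriented cycles and its underlying graph is an extended Dynkin diagram $\widetilde A$ or $\widetilde D$. For a (finite dimensional) representation $V$ of $Q$ let $\nabla V$ be the representation with $\nabla V(x)=V(\sigma(x))^*$ and $\nabla V(a)=-V(\sigma(a))^*$. An orthogonal (resp. symplectic) representation is a representation $W$ with a nondegenerate symmetric (resp. skew-symmetric) bilinear form $\langle\cdot,\cdot\rangle$ on $\bigoplus_x W(x)$ such that $W(x)\perp W(y)$ for $y\ne\sigma(x)$ and $\langle W(a)v,w\rangle+\langle v,W(\sigma(a))w\rangle=0$ for all arrows $a$ and all $v\in W(ta)$, $w\in W(t\sigma(a))$. Write $ORep(Q,\beta)$ (resp. $SpRep(Q,\beta)$) for those of dimension vector $\beta$. Let $C^-$ be the Coxeter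 functor (the composition of the reflection functors $C_x^-$, each vertex $x$ being taken once, when it is a source). A representation $V$ satisfies (Op) if $V\cong C^-\nabla V$ and there is an almost split sequence $0\to\nabla V\to Z\to V\to 0$ whose middle term $Z$ admits the structure of an orthogonal representation; it satisfies (Spp) if the same holds with "symplectic" in place of "orthogonal". Let $0\to P_1\xrightarrow{d}P_0\to V\to 0$ be the minimal projective resolution of $V$. We say that $\mathrm{Hom}_Q(d^V_{min},\cdot)$ is skew-symmetric on $SpRep(Q,\beta)$ if one can choose decompositions $P_0=\bigoplus_{i=1}^nP_{y_i}$ and $P_1=\bigoplus_{i=1}^nP_{\sigma(y_i)}$, where $P_x$ is the indecomposable projective at $x$, such that for every $W\in SpRep(Q,\beta)$ the linear map $$\mathrm{Hom}_Q(d,W):\ \bigoplus_iW(y_i)=\mathrm{Hom}_Q(P_0,W)\longrightarrow \mathrm{Hom}_Q(P_1,W)=\bigoplus_iW(\sigma(y_i))\cong\Big(\bigoplus_iW(y_i)\Big)^*$$ is skew-symmetric, the last isomorphism being given by the form of $W$. Skew-symmetry on $ORep(Q,\beta)$ is defined in the same way. Let $V$ be an indecomposable representation of $Q$ and let $\beta$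 be a symmetric dimension vector ($\beta(\sigma(x))=\beta(x)$ for all $x$) such that $\langle\underline{\dim}\,V,\beta\rangle=0$, where $\langle\alpha,\beta\rangle=\sum_x\alpha(x)\beta(x)-\sum_a\alpha(ta)\beta(ha)$ is the Euler form. Then: (1) If $V$ satisfies (Op), then $\mathrm{Hom}_Q(d^V_{min},\cdot)$ is skew-symmetric on $SpRep(Q,\beta)$. Conversely, if $\beta(x)\ge2$ for all vertices $x$, $SpRep(Q,\beta)\neq\emptyset$, and $\mathrm{Hom}_Q(d^V_{min},\cdot)$ is skew-symmetric on $SpRep(Q,\beta)$, then $V$ satisfies (Op). (2) If $V$ satisfies (Spp), then $\mathrm{Hom}_Q(d^V_{min},\cdot)$ is skew-symmetric on $ORep(Q,\beta)$. Conversely, if $\beta(x)\ge2$ for all vertices $x$ and $\mathrm{Hom}_Q(d^V_{min},\cdot)$ is skew-symmetric on $ORep(Q,\beta)$, then $V$ satisfies (Spp). -/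

import Mathlib

universe u

/-- A quiver with vertex set `I` and arrow set `A`, given by the tail and head of each arrow. -/
@[ext] structure Quiv (I A : Type) where
  src : A → I
  tgt : A → I

namespace Quiv

variable {I A : Type}

/-- The associated Mathlib quiver; it is only used to speak of paths. -/
@[reducible] def toQuiver (Q : Quiv I A) : Quiver I := ⟨fun x y => {a : A // Q.src a = x ∧ Q.tgt a = y}⟩

/-- Paths of length `≥ 0` from `x` to `y`. -/
abbrev Path (Q : Quiv I A) (x y : I) : Type := @Quiver.Path I Q.toQuiver x y

/-- The path `p` followed by the arrow `a`. -/
def Path.snoc {Q : Quiv I A} {x : I} (a : A) (p : Q.Path x (Q.src a)) : Q.Path x (Q.tgt a) :=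
  @Quiver.Path.cons I Q.toQuiver x (Q.src a) (Q.tgt a) p ⟨a, rfl, rfl⟩

/-- There are no oriented cycles. -/
def Acyclic (Q : Quiv I A) : Prop :=
  ∀ x, ¬ Relation.TransGen (fun y z => ∃ a, Q.src a = y ∧ Q.tgt a = z) x x

/-- `x` is a source: no arrow ends at `x`. -/
def IsSource (Q : Quiv I A) (x : I) : Prop := ∀ a, Q.tgt a ≠ x

/-- The quiver obtained by reversing all arrows incident to `x`. -/
def reflect [DecidableEq I] (Q : Quiv I A) (x : I) : Quiv I A where
  src a := if Q.src a = x ∨ Q.tgt a = x then Q.tgt a else Q.src a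
  tgt a := if Q.src a = x ∨ Q.tgt a = x then Q.src a else Q.tgt a

/-- The underlying graph is a cycle with `n ≥ 2` vertices (for `n = 2`: a double edge). -/
def IsATilde (Q : Quiv I A) : Prop :=
  ∃ n : ℕ, 2 ≤ n ∧ ∃ (e : I ≃ ZMod n) (f : A ≃ ZMod n),
    ∀ a, s(e (Q.src a), e (Q.tgt a)) = s(f a, f a + 1)

/-- The `j`-th edge (`0 ≤ j < n`) of the extended Dynkin diagram of type `D` with vertices
`0, …, n`: the path `1 - 2 - ⋯ - (n - 1)` together with the edges `0 - 2` and `(n - 2) - n`. -/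
def dTildeEdge (n j : ℕ) : Sym2 ℕ :=
  if j = 0 then s(0, 2) else if j = n - 1 then s(n - 2, n) else s(j, j + 1)

/-- The underlying graph is the extended Dynkin diagram of type `D` with `n + 1 ≥ 5` vertices. -/
def IsDTilde (Q : Quiv I A) : Prop :=
  ∃ n : ℕ, 4 ≤ n ∧ ∃ (e : I ≃ Fin (n + 1)) (f : A ≃ Fin n),
    ∀ a, s((e (Q.src a)).val, (e (Q.tgt a)).val) = dTildeEdge n (f a).val

/-- The Euler form. -/
def euler [Fintype I] [Fintype A] (Q : Quiv I A) (α β : I → ℕ) : ℤ :=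
  ∑ x, (α x : ℤ) * β x - ∑ a, (α (Q.src a) : ℤ) * β (Q.tgt a)

end Quiv

/-- A representation of `Q` over `k`; finite dimensionality is the separate predicate
`QRep.IsFinDim`. -/
structure QRep (k : Type u) [Field k] {I A : Type} (Q : Quiv I A) where
  obj : I → Type u
  [grp : ∀ x, AddCommGroup (obj x)]
  [mod : ∀ x, Module k (obj x)]
  map : ∀ a, obj (Q.src a) →ₗ[k] obj (Q.tgt a)

attribute [instance] QRep.grp QRep.mod

namespace QRep

variable {k : Type u} [Field k] {I A : Type} {Q : Quiv I A}

/-- The linear map of the arrow `a`, seen as a map `V(y) → V(z)` when `a` goes from `y` to `z`. -/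
def hom (V : QRep k Q) (a : A) {y z : I} (hy : Q.src a = y) (hz : Q.tgt a = z) :
    V.obj y →ₗ[k] V.obj z :=
  match y, z, hy, hz with
  | _, _, rfl, rfl => V.map a

def IsFinDim (V : QRep k Q) : Prop := ∀ x, FiniteDimensional k (V.obj x)

/-- The dimension vector (used for finite dimensional representations). -/
noncomputable def dim (V : QRep k Q) : I → ℕ := fun x => Module.finrank k (V.obj x)

def IsZero (V : QRep k Q) : Prop := ∀ x, Subsingleton (V.obj x)

/-- The direct sum of two representations. -/
def prod (V W : QRep k Q) : QRep k Q where
  obj x := V.obj x × W.obj x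
  map a := (V.map a).prodMap (W.map a)

/-- Morphisms of representations. -/
structure Hom (V W : QRep k Q) where
  app : ∀ x, V.obj x →ₗ[k] W.obj x
  comm : ∀ a, app (Q.tgt a) ∘ₗ V.map a = W.map a ∘ₗ app (Q.src a)

namespace Hom

variable {U V W : QRep k Q}

def id (V : QRep k Q) : Hom V V where
  app _ := LinearMap.id
  comm _ := rfl

/-- The composition `g ∘ f`. -/
def comp (g : Hom V W) (f : Hom U V) : Hom U W where
  app x := g.app x ∘ₗ f.app x
  comm a := by
    rw [LinearMap.comp_assoc, f.comm, ← LinearMap.comp_assoc, g.comm, LinearMap.comp_assoc]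

def Injective (f : Hom V W) : Prop := ∀ x, Function.Injective (f.app x)

def Surjective (f : Hom V W) : Prop := ∀ x, Function.Surjective (f.app x)

/-- `0 → U → V → W → 0` is exact. -/
def IsShortExact (f : Hom U V) (g : Hom V W) : Prop :=
  f.Injective ∧ g.Surjective ∧ ∀ x, LinearMap.range (f.app x) = LinearMap.ker (g.app x)

/-- `f` is a split monomorphism. -/
def IsSection (f : Hom V W) : Prop := ∃ r : Hom W V, r.comp f = Hom.id V

/-- `g` is a split epimorphism. -/
def IsRetraction (g : Hom V W) : Prop := ∃ s : Hom W V, g.comp s = Hom.id W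

/-- `0 → U → Z → V → 0` is an almost split sequence in the category of finite dimensional
representations: it is exact, `f` is left almost split and `g` is right almost split. -/
structure IsAlmostSplit {Z : QRep k Q} (f : Hom U Z) (g : Hom Z V) : Prop where
  exact : IsShortExact f g
  not_section : ¬ f.IsSection
  not_retraction : ¬ g.IsRetraction
  left : ∀ (Y : QRep k Q), Y.IsFinDim → ∀ h : Hom U Y, ¬ h.IsSection →
    ∃ h' : Hom Z Y, h'.comp f = h
  right : ∀ (X : QRep k Q), X.IsFinDim → ∀ h : Hom X V, ¬ h.IsRetraction →
    ∃ h' : Hom X Z, g.comp h' = h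

/-- `p` is an essential epimorphism: it is onto, and `X → V` is onto whenever the composition
`X → V → W` is. For projective `V` this says that `p` is a projective cover of `W`. -/
def IsEssential (p : Hom V W) : Prop :=
  p.Surjective ∧ ∀ (X : QRep k Q) (h : Hom X V), (p.comp h).Surjective → h.Surjective

end Hom

/-- `V` and `W` are isomorphic. -/
def Isom (V W : QRep k Q) : Prop := ∃ f : Hom V W, f.Injective ∧ f.Surjective

def Indecomposable (V : QRep k Q) : Prop :=
  ¬ V.IsZero ∧ ∀ X Y : QRep k Q, V.Isom (X.prod Y) → X.IsZero ∨ Y.IsZero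

/-! ### Projective representations -/

section Projective

variable (k Q)

/-- The projective representation `⨁ i, P_{y i}`, where `P_x(z)` is the vector space with basis the
paths from `x` to `z` and an arrow acts by extending paths. -/
noncomputable def proj {ι : Type} (y : ι → I) : QRep k Q where
  obj z := (Σ i, Q.Path (y i) z) →₀ k
  map a := Finsupp.lmapDomain k k (fun p => ⟨p.1, Quiv.Path.snoc a p.2⟩)

/-- The generator of the `i`-th summand of `⨁ i, P_{y i}`: the trivial path at `y i`. A morphism `f`
from `⨁ i, P_{y i}` to `W` corresponds to the family of the `f (gen i) ∈ W(y i)`. -/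
noncomputable def gen {ι : Type} (y : ι → I) (i : ι) : (proj k Q y).obj (y i) :=
  Finsupp.single ⟨i, @Quiver.Path.nil I Q.toQuiver (y i)⟩ 1

end Projective

/-- `0 → P₁ → P₀ → V → 0` (with maps `d` and `p`) is a minimal projective resolution of `V`, where
`P₀ = ⨁ i, P_{y i}` and `P₁ = ⨁ j, P_{x j}`. -/
def IsMinimalResolution {ι κ : Type} {y : ι → I} {x : κ → I} {V : QRep k Q}
    (d : Hom (proj k Q x) (proj k Q y)) (p : Hom (proj k Q y) V) : Prop :=
  Hom.IsShortExact d p ∧ p.IsEssential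

/-! ### Reflection functors and the Coxeter functor -/

section Reflection

variable [DecidableEq I] [DecidableEq A]

/-- For a source `x` of `Q`: the representation `W` of the reflected quiver is (isomorphic to) the
image `C_x⁻ V` of `V` under the reflection functor. That is, `W(y) = V(y)` for `y ≠ x`, with the same
maps for the arrows that do not touch `x`; `W(x)` is the cokernel of the map
`V(x) → ⨁ V(ha)`, the sum being over the arrows `a` with tail `x`; and the map `V(ha) → W(x)` of the
reversed arrow `a` is the inclusion of the summand followed by the projection. -/
def IsReflMinus (x : I) (V : QRep k Q) (W : QRep k (Q.reflect x)) : Prop :=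
  ∃ (e : ∀ y, y ≠ x → (V.obj y ≃ₗ[k] W.obj y))
    (π : (∀ a : {a // Q.src a = x}, V.obj (Q.tgt a)) →ₗ[k] W.obj x),
    Function.Surjective π ∧
    LinearMap.ker π = LinearMap.range (LinearMap.pi fun a : {a // Q.src a = x} =>
      V.hom a.1 a.2 rfl) ∧
    (∀ (a : A) (hs : Q.src a ≠ x) (ht : Q.tgt a ≠ x)
      (hs' : (Q.reflect x).src a = Q.src a) (ht' : (Q.reflect x).tgt a = Q.tgt a)
      (v : V.obj (Q.src a)),
      W.hom a hs' ht' (e _ hs v) = e _ ht (V.map a v)) ∧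
    (∀ (a : A) (hs : Q.src a = x) (ht : Q.tgt a ≠ x)
      (hs' : (Q.reflect x).src a = Q.tgt a) (ht' : (Q.reflect x).tgt a = x)
      (v : V.obj (Q.tgt a)),
      W.hom a hs' ht' (e _ ht v) = π (Pi.single ⟨a, hs⟩ v))

/-- `W` is obtained from `V` by applying the functors `C_x⁻` for the successive members `x` of the
list, each of which is a source of the quiver at hand; `Q'` is the quiver reached at the end. -/
inductive IsReflSeq : (Q Q' : Quiv I A) → List I → QRep k Q → QRep k Q' → Prop
  | nil {Q : Quiv I A} {V W : QRep k Q} : V.Isom W → IsReflSeq Q Q [] V W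
  | cons {Q Q' : Quiv I A} {x : I} {l : List I} {V : QRep k Q} {U : QRep k (Q.reflect x)}
      {W : QRep k Q'} : Q.IsSource x → IsReflMinus x V U →
      IsReflSeq (Q.reflect x) Q' l U W → IsReflSeq Q Q' (x :: l) V W

/-- `W` is isomorphic to `C⁻ V`, where `C⁻` is the Coxeter functor: the composition of the functors
`C_x⁻`, each vertex being taken once, when it is a source. -/
def IsCoxeterMinus (V W : QRep k Q) : Prop :=
  ∃ l : List I, l.Nodup ∧ (∀ x, x ∈ l) ∧ IsReflSeq Q Q l V W

end Reflection

end QRep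

/-- A symmetric quiver `(Q, σ)`; the involution is `σ` on vertices and `σ₁` on arrows. -/
structure SymQuiver (I A : Type) extends Quiv I A where
  σ : I → I
  σ₁ : A → A
  σ_invol : ∀ x, σ (σ x) = x
  σ₁_invol : ∀ a, σ₁ (σ₁ a) = a
  src_σ₁ : ∀ a, src (σ₁ a) = σ (tgt a)
  tgt_σ₁ : ∀ a, tgt (σ₁ a) = σ (src a)
  σ₁_fix : ∀ a, σ (src a) = tgt a → σ₁ a = a

namespace SymQuiver

variable {I A : Type} (S : SymQuiver I A)

/-- Connected symmetric quivers of tame type: there are no oriented cycles and the underlying graph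
is an extended Dynkin diagram of type `A` or `D` (those of type `E` carry no such involution). -/
def IsTame : Prop := S.toQuiv.Acyclic ∧ (S.toQuiv.IsATilde ∨ S.toQuiv.IsDTilde)

/-- A symmetric dimension vector. -/
def IsSymmDim (β : I → ℕ) : Prop := ∀ x, β (S.σ x) = β x

variable {k : Type u} [Field k]

/-- The dual `∇V` of a representation: `∇V(x) = V(σ x)^*` and `∇V(a) = -V(σ a)^*`. -/
def dual (V : QRep k S.toQuiv) : QRep k S.toQuiv where
  obj x := Module.Dual k (V.obj (S.σ x))
  map a := -(V.hom (S.σ₁ a) (S.src_σ₁ a) (S.tgt_σ₁ a)).dualMap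

variable [Fintype I] [DecidableEq I]

/-- `B` is a nondegenerate bilinear form on `⨁ x, V(x)` with `B v w = ε B w v` that makes `V` an
orthogonal (`ε = 1`) or symplectic (`ε = -1`) representation. -/
structure IsForm (ε : k) (V : QRep k S.toQuiv) (B : LinearMap.BilinForm k (∀ x, V.obj x)) : Prop where
  nondegenerate : B.Nondegenerate
  symm : ∀ v w, B v w = ε * B w v
  orth : ∀ x y, y ≠ S.σ x → ∀ (v : V.obj x) (w : V.obj y), B (Pi.single x v) (Pi.single y w) = 0
  skew : ∀ a (v : V.obj (S.src a)) (w : V.obj (S.src (S.σ₁ a))),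
    B (Pi.single _ (V.map a v)) (Pi.single _ w) +
      B (Pi.single _ v) (Pi.single _ (V.map (S.σ₁ a) w)) = 0

/-- `B` makes `V` an orthogonal representation. -/
abbrev IsOrthogonalForm (V : QRep k S.toQuiv) (B : LinearMap.BilinForm k (∀ x, V.obj x)) : Prop :=
  S.IsForm 1 V B

/-- `B` makes `V` a symplectic representation. -/
abbrev IsSymplecticForm (V : QRep k S.toQuiv) (B : LinearMap.BilinForm k (∀ x, V.obj x)) : Prop :=
  S.IsForm (-1) V B

/-- `β` is the dimension vector of a symplectic representation over `k`. -/
def IsSymplecticDim (k : Type u) [Field k] (β : I → ℕ) : Prop :=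
  ∃ (W : QRep k S.toQuiv) (B : LinearMap.BilinForm k (∀ x, W.obj x)),
    W.IsFinDim ∧ W.dim = β ∧ S.IsSymplecticForm W B

section Properties

variable [DecidableEq A]

/-- Property (Op): `V = C⁻∇V`, and the middle term of the almost split sequence
`0 → ∇V → Z → V → 0` is an orthogonal representation. -/
def PropOp (V : QRep k S.toQuiv) : Prop :=
  QRep.IsCoxeterMinus (S.dual V) V ∧
  ∃ (Z : QRep k S.toQuiv) (f : QRep.Hom (S.dual V) Z) (g : QRep.Hom Z V),
    QRep.Hom.IsAlmostSplit f g ∧ ∃ B, S.IsOrthogonalForm Z B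

/-- Property (Spp): `V = C⁻∇V`, and the middle term of the almost split sequence
`0 → ∇V → Z → V → 0` is a symplectic representation. -/
def PropSpp (V : QRep k S.toQuiv) : Prop :=
  QRep.IsCoxeterMinus (S.dual V) V ∧
  ∃ (Z : QRep k S.toQuiv) (f : QRep.Hom (S.dual V) Z) (g : QRep.Hom Z V),
    QRep.Hom.IsAlmostSplit f g ∧ ∃ B, S.IsSymplecticForm Z B

end Properties

/-- The bilinear form on `Hom_Q(P₀, W)` that corresponds to the linear map
`Hom_Q(d, W) : Hom_Q(P₀, W) → Hom_Q(P₁, W)`, `f ↦ f ∘ d`, where `P₀ = ⨁ i, P_{y i}` and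
`P₁ = ⨁ i, P_{σ (y i)}`. Here `Hom_Q(P₀, W) = ⨁ W(y i)` and `Hom_Q(P₁, W) = ⨁ W(σ (y i))`, which the
form `B` of `W` identifies with the dual space of `⨁ W(y i)`. -/
noncomputable def homForm {n : ℕ} {y : Fin n → I}
    (d : QRep.Hom (QRep.proj k S.toQuiv (fun i => S.σ (y i))) (QRep.proj k S.toQuiv y))
    {W : QRep k S.toQuiv} (B : LinearMap.BilinForm k (∀ x, W.obj x))
    (f g : QRep.Hom (QRep.proj k S.toQuiv y) W) : k :=
  ∑ i, B (Pi.single (S.σ (y i)) ((f.comp d).app _ (QRep.gen k S.toQuiv (fun j => S.σ (y j)) i)))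
    (Pi.single (y i) (g.app _ (QRep.gen k S.toQuiv y i)))

/-- `Hom_Q(d_min^V, ·)` is skew-symmetric on the space of symplectic (`ε = -1`) or orthogonal
(`ε = 1`) representations of dimension `β`: for a suitable choice of the direct sum decompositions
`P₀ = ⨁ i, P_{y i}` and `P₁ = ⨁ i, P_{σ (y i)}` of the terms of the minimal projective resolution
`0 → P₁ → P₀ → V → 0`, with first map `d`, the map `Hom_Q(d, W)` is skew-symmetric for all these
representations `W`. -/
def IsSkewOn (ε : k) (V : QRep k S.toQuiv) (β : I → ℕ) : Prop :=
  ∃ (n : ℕ) (y : Fin n → I)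
    (d : QRep.Hom (QRep.proj k S.toQuiv (fun i => S.σ (y i))) (QRep.proj k S.toQuiv y))
    (p : QRep.Hom (QRep.proj k S.toQuiv y) V),
    QRep.IsMinimalResolution d p ∧
    ∀ (W : QRep k S.toQuiv) (B : LinearMap.BilinForm k (∀ x, W.obj x)),
      W.IsFinDim → W.dim = β → S.IsForm ε W B →
      ∀ f g : QRep.Hom (QRep.proj k S.toQuiv y) W,
        S.homForm d B f g = -S.homForm d B g f

/-- `Hom_Q(d_min^V, ·)` is skew-symmetric on `SpRep(Q, β)`. -/
abbrev IsSkewOnSpRep (V : QRep k S.toQuiv) (β : I → ℕ) : Prop := S.IsSkewOn (-1) V β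

/-- `Hom_Q(d_min^V, ·)` is skew-symmetric on `ORep(Q, β)`. -/
abbrev IsSkewOnORep (V : QRep k S.toQuiv) (β : I → ℕ) : Prop := S.IsSkewOn 1 V β

end SymQuiver

/-!
Representations are handled through their total spaces: a representation of `Q` is a vector space
with the projections `E x` to the components and one operator `arr a` for each arrow (`QAct`), and a
morphism is a linear map that commutes with all of them. The dual `∇M` becomes a structure on the
dual space, and an invariant form is a pairing of `M` with itself (`IsPairing`). A morphism `d`
between sums of indecomposable projectives has an adjoint `d'` (`IsAdj`), and `Hom(d, W)` is
skew-symmetric for all `W` with a `(-ε)`-symmetric form as soon as `d' = ε d`. The theorem therefore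
compares two properties of an indecomposable `V`: it has a minimal resolution with `d' = ε d`, and it
has an almost split sequence `0 → ∇V → Z → V → 0` with an `ε`-symmetric form on `Z` together with
`V ≅ C⁻∇V`.

*From the almost split sequence to the resolution.* Since `f : ∇V → Z` is left almost split, the
transpose of `g : Z → V` extends along `f` to an invariant pairing `b` on `Z`, which inherits a
symmetry up to a scalar `s` and a nilpotent endomorphism, `End V` being local. If `s ≠ ε`, then the
`(-ε)`-symmetrization of `b` is nondegenerate, so that `Z` carries forms of both types. Comparing the two
gives a skew-adjoint automorphism of `Z`; choosing one eigenvalue from each pair `±μ` splits off a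
summand of `Z` of half the dimension, which is impossible (`IsAS.not_both`). So `s = ε`. Evaluating
the adjunction for `b` in two ways yields a morphism from the adjoint of a minimal resolution of `V`
to the resolution itself which is symmetric up to the sign `ε` and does not annihilate the almost
split class (`IsAS.exists_comparison`). It is therefore an isomorphism
(`IsAS.bijective_comparison`), and composing `d` with it gives the resolution that is wanted.

*From the resolution to the almost split sequence.* If `β x ≥ 2` everywhere, there are isotropic
vectors in all degrees of a space of dimension `β` with a form, and sending them to each other along
the arrows of a path gives representations with a form on which exactly that path is detected. Hence
skew-symmetry in dimension `β` forces `d' = η d` with the appropriate sign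
(`SymQuiver.isAdj_of_skew`). The trace on `End V` defines a morphism from the first term of the
resolution to `∇V`; its pushout is an extension of `V` by `∇V`, which is almost split because an
endomorphism with nonzero trace is not nilpotent. The same trace computes the sign `s = η` of the
pairing `b` on the middle term (`QAct.exists_isAS`).

*The Coxeter functor.* Evaluating the trivialization of a cochain `(c_a : V → ∇V)` on the relations
of the symmetric resolution defines a functional, which vanishes on coboundaries. It is given by
traces with maps `N_a : ∇V → V`, and these fit with the arrows into an exact sequence
`0 → ∇V → ⨁_a (∇V)(ha) ⊕ V(ta) → V → 0` (`QAct.exists_isMesh`). Up to a sign, its components are the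
exact sequences that define the reflection functors: after the reflections at the vertices of a set
`J` closed under predecessors, the representation consists of `V` on `J` and of `∇V` elsewhere, and
the arrows that leave `J` are replaced by the `N_a` (`QAct.IsStage`). The sign is corrected by an
automorphism of the graded space `V` that anticommutes with the arrows. It exists trivially when the
quiver is bipartite, that is, except on an odd cycle. On an odd cycle either the arrows form a
coboundary `[b, ·]`, and the sign alternates along the eigenvalues of `b`, or all arrows act
bijectively. The latter is excluded: the mesh gives a nonzero map `∇V → V`, which turns the
monodromy of the cycle into its negative (`QAct.IsMesh.not_bijective`).
-/

set_option linter.unusedSectionVars false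
set_option linter.unusedVariables false



/-! ### Modules over the path algebra as vector spaces with operators -/

/-- A module over the path algebra of `Q`, encoded by the action of the idempotents `E x` and of
the arrows. The total space `∏ x, V(x)` of a representation carries such an action. -/
structure QAct (k : Type u) [Field k] {I A : Type} [Fintype I] (Q : Quiv I A)
    (M : Type u) [AddCommGroup M] [Module k M] where
  E : I → M →ₗ[k] M
  arr : A → M →ₗ[k] M
  E_same : ∀ x m, E x (E x m) = E x m
  E_ne : ∀ x y m, x ≠ y → E x (E y m) = 0
  sum_E : ∀ m, ∑ x, E x m = m
  E_arr : ∀ a m, E (Q.tgt a) (arr a m) = arr a m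
  arr_E : ∀ a m, arr a (E (Q.src a) m) = arr a m

namespace QAct

variable {k : Type u} [Field k] {I A : Type} [Fintype I] {Q : Quiv I A}
variable {M N L : Type u} [AddCommGroup M] [Module k M] [AddCommGroup N] [Module k N]
  [AddCommGroup L] [Module k L]

theorem E_arr_ne (o : QAct k Q M) {a : A} {x : I} (h : x ≠ Q.tgt a) (m : M) :
    o.E x (o.arr a m) = 0 := by
  rw [← o.E_arr a m, o.E_ne _ _ _ h]

theorem arr_E_ne (o : QAct k Q M) {a : A} {x : I} (h : Q.src a ≠ x) (m : M) :
    o.arr a (o.E x m) = 0 := by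
  rw [← o.arr_E a, o.E_ne _ _ _ h, map_zero]

/-- Linear maps that commute with the action of the path algebra. -/
structure IsMor (o : QAct k Q M) (o' : QAct k Q N) (f : M →ₗ[k] N) : Prop where
  E : ∀ x m, f (o.E x m) = o'.E x (f m)
  arr : ∀ a m, f (o.arr a m) = o'.arr a (f m)

variable {o : QAct k Q M} {o' : QAct k Q N} {o'' : QAct k Q L}

namespace IsMor

theorem id (o : QAct k Q M) : IsMor o o LinearMap.id := ⟨fun _ _ => rfl, fun _ _ => rfl⟩

theorem one (o : QAct k Q M) : IsMor o o (1 : M →ₗ[k] M) := ⟨fun _ _ => rfl, fun _ _ => rfl⟩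

theorem comp {g : N →ₗ[k] L} {f : M →ₗ[k] N} (hg : IsMor o' o'' g) (hf : IsMor o o' f) :
    IsMor o o'' (g ∘ₗ f) :=
  ⟨fun x m => by simp [hf.E, hg.E], fun a m => by simp [hf.arr, hg.arr]⟩

theorem add {f g : M →ₗ[k] N} (hf : IsMor o o' f) (hg : IsMor o o' g) : IsMor o o' (f + g) :=
  ⟨fun x m => by simp [hf.E, hg.E], fun a m => by simp [hf.arr, hg.arr]⟩

theorem sub {f g : M →ₗ[k] N} (hf : IsMor o o' f) (hg : IsMor o o' g) : IsMor o o' (f - g) :=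
  ⟨fun x m => by simp [hf.E, hg.E], fun a m => by simp [hf.arr, hg.arr]⟩

theorem smul {f : M →ₗ[k] N} (c : k) (hf : IsMor o o' f) : IsMor o o' (c • f) :=
  ⟨fun x m => by simp [hf.E], fun a m => by simp [hf.arr]⟩

theorem zero : IsMor o o' (0 : M →ₗ[k] N) :=
  ⟨fun x m => by simp, fun a m => by simp⟩

theorem pow {f : M →ₗ[k] M} (hf : IsMor o o f) (n : ℕ) : IsMor o o (f ^ n) := by
  induction n with
  | zero => exact one o
  | succ n ih => rw [pow_succ]; exact ih.comp hf

theorem symm {f : M ≃ₗ[k] N} (hf : IsMor o o' f.toLinearMap) : IsMor o' o f.symm.toLinearMap :=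
  ⟨fun x m => by
    apply f.injective
    have := hf.E x (f.symm m)
    simp only [LinearEquiv.coe_coe] at this
    simp [this], fun a m => by
    apply f.injective
    have := hf.arr a (f.symm m)
    simp only [LinearEquiv.coe_coe] at this
    simp [this]⟩

theorem ofBijective {f : M →ₗ[k] N} (hf : IsMor o o' f) (h : Function.Bijective f) :
    ∃ g : N →ₗ[k] M, IsMor o' o g ∧ g ∘ₗ f = LinearMap.id ∧ f ∘ₗ g = LinearMap.id := by
  refine ⟨(LinearEquiv.ofBijective f h).symm.toLinearMap, symm (f := LinearEquiv.ofBijective f h) hf,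
    ?_, ?_⟩
  · ext m
    exact (LinearEquiv.ofBijective f h).symm_apply_apply m
  · ext m
    exact (LinearEquiv.ofBijective f h).apply_symm_apply m

/-- Factorization through a surjective morphism. -/
theorem exists_factor {g : M →ₗ[k] N} (hg : IsMor o o' g) (hs : Function.Surjective g)
    {h : M →ₗ[k] L} (hh : IsMor o o'' h) (hk : ∀ m, g m = 0 → h m = 0) :
    ∃ φ : N →ₗ[k] L, IsMor o' o'' φ ∧ φ ∘ₗ g = h := by
  obtain ⟨s, hs'⟩ := g.exists_rightInverse_of_surjective (LinearMap.range_eq_top.2 hs)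
  have hs'' : ∀ n, g (s n) = n := fun n => by simpa using LinearMap.congr_fun hs' n
  have key : ∀ m, h (s (g m)) = h m := fun m => by
    have := hk (s (g m) - m) (by simp [hs''])
    simpa [sub_eq_zero] using this
  refine ⟨h ∘ₗ s, ⟨fun x n => ?_, fun a n => ?_⟩, by ext m; simpa using key m⟩
  · obtain ⟨m, rfl⟩ := hs n
    simp only [LinearMap.comp_apply, ← hg.E, key, hh.E]
  · obtain ⟨m, rfl⟩ := hs n
    simp only [LinearMap.comp_apply, ← hg.arr, key, hh.arr]

/-- Factorization through an injective morphism. -/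
theorem exists_lift {f : M →ₗ[k] N} (hf : IsMor o o' f) (hi : Function.Injective f)
    {h : L →ₗ[k] N} (hh : IsMor o'' o' h) (hk : ∀ l, h l ∈ LinearMap.range f) :
    ∃ t : L →ₗ[k] M, IsMor o'' o t ∧ f ∘ₗ t = h := by
  obtain ⟨s, hs'⟩ := f.exists_leftInverse_of_injective (LinearMap.ker_eq_bot.2 hi)
  have hs'' : ∀ n, s (f n) = n := fun n => by simpa using LinearMap.congr_fun hs' n
  have key : ∀ l, f (s (h l)) = h l := fun l => by
    obtain ⟨m, hm⟩ := hk l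
    rw [← hm, hs'']
  refine ⟨s ∘ₗ h, ⟨fun x n => hi ?_, fun a n => hi ?_⟩, by ext m; simpa using key m⟩
  · rw [LinearMap.comp_apply, key, hf.E, LinearMap.comp_apply, key, hh.E]
  · rw [LinearMap.comp_apply, key, hf.arr, LinearMap.comp_apply, key, hh.arr]

end IsMor

/-- The action on an invariant subspace. -/
def sub (o : QAct k Q M) (U : Submodule k M) (hE : ∀ x, ∀ m ∈ U, o.E x m ∈ U)
    (ha : ∀ a, ∀ m ∈ U, o.arr a m ∈ U) : QAct k Q U where
  E x := (o.E x).restrict (hE x)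
  arr a := (o.arr a).restrict (ha a)
  E_same x m := Subtype.ext (o.E_same x m)
  E_ne x y m h := Subtype.ext (o.E_ne x y m h)
  sum_E m := Subtype.ext (by
    rw [AddSubmonoidClass.coe_finsetSum]; exact o.sum_E m)
  E_arr a m := Subtype.ext (o.E_arr a m)
  arr_E a m := Subtype.ext (o.arr_E a m)

theorem isMor_subtype (o : QAct k Q M) (U : Submodule k M) (hE : ∀ x, ∀ m ∈ U, o.E x m ∈ U)
    (ha : ∀ a, ∀ m ∈ U, o.arr a m ∈ U) : IsMor (o.sub U hE ha) o U.subtype :=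
  ⟨fun _ _ => rfl, fun _ _ => rfl⟩

/-- The action on the quotient by an invariant subspace. -/
def quot (o : QAct k Q M) (U : Submodule k M) (hE : ∀ x, ∀ m ∈ U, o.E x m ∈ U)
    (ha : ∀ a, ∀ m ∈ U, o.arr a m ∈ U) : QAct k Q (M ⧸ U) where
  E x := U.mapQ U (o.E x) (hE x)
  arr a := U.mapQ U (o.arr a) (ha a)
  E_same x m := by
    induction m using Submodule.Quotient.induction_on with | _ m => simp [o.E_same]
  E_ne x y m h := by
    induction m using Submodule.Quotient.induction_on with | _ m => simp [o.E_ne x y m h]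
  sum_E m := by
    induction m using Submodule.Quotient.induction_on with
    | _ m =>
      simp only [Submodule.mapQ_apply]
      conv_rhs => rw [← o.sum_E m]
      exact (map_sum U.mkQ _ _).symm
  E_arr a m := by
    induction m using Submodule.Quotient.induction_on with | _ m => simp [o.E_arr]
  arr_E a m := by
    induction m using Submodule.Quotient.induction_on with | _ m => simp [o.arr_E]

theorem isMor_mkQ (o : QAct k Q M) (U : Submodule k M) (hE : ∀ x, ∀ m ∈ U, o.E x m ∈ U)
    (ha : ∀ a, ∀ m ∈ U, o.arr a m ∈ U) : IsMor o (o.quot U hE ha) U.mkQ :=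
  ⟨fun _ _ => rfl, fun _ _ => rfl⟩

/-- The action on a direct sum. -/
def prod (o : QAct k Q M) (o' : QAct k Q N) : QAct k Q (M × N) where
  E x := (o.E x).prodMap (o'.E x)
  arr a := (o.arr a).prodMap (o'.arr a)
  E_same x m := by simp [o.E_same, o'.E_same]
  E_ne x y m h := by simp [o.E_ne x y _ h, o'.E_ne x y _ h]
  sum_E m := by
    ext
    · simpa [Prod.fst_sum] using o.sum_E m.1
    · simpa [Prod.snd_sum] using o'.sum_E m.2
  E_arr a m := by simp [o.E_arr, o'.E_arr]
  arr_E a m := by simp [o.arr_E, o'.arr_E]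

/-- The dual action with respect to the involution: `E x` acts by the transpose of `E (σ x)` and
the arrow `a` by minus the transpose of `σ a`. -/
def dual (S : SymQuiver I A) (o : QAct k S.toQuiv M) : QAct k S.toQuiv (Module.Dual k M) where
  E x := (o.E (S.σ x)).dualMap
  arr a := -(o.arr (S.σ₁ a)).dualMap
  E_same x m := by ext v; simp [o.E_same]
  E_ne x y m h := by
    ext v
    have : S.σ y ≠ S.σ x := fun h' => h (by rw [← S.σ_invol x, ← h', S.σ_invol])
    simp [o.E_ne _ _ _ this]
  sum_E m := by
    ext v
    simp only [LinearMap.sum_apply, LinearMap.dualMap_apply]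
    rw [← map_sum]
    congr 1
    conv_rhs => rw [← o.sum_E v]
    exact Equiv.sum_comp ⟨S.σ, S.σ, S.σ_invol, S.σ_invol⟩ (fun x => o.E x v)
  E_arr a m := by
    ext v
    have := o.arr_E (S.σ₁ a) v
    rw [S.src_σ₁] at this
    simp [this]
  arr_E a m := by
    ext v
    have := o.E_arr (S.σ₁ a) v
    rw [S.tgt_σ₁] at this
    simp [this]

section Pairing

variable {S : SymQuiver I A} {p : QAct k S.toQuiv M} {q : QAct k S.toQuiv N}
  {r : QAct k S.toQuiv L}

/-- Invariant pairings, corresponding to the morphisms from `M` to the dual `∇N`. -/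
structure IsPairing (S : SymQuiver I A) (p : QAct k S.toQuiv M) (q : QAct k S.toQuiv N)
    (b : M →ₗ[k] N →ₗ[k] k) : Prop where
  E : ∀ x m n, b (p.E x m) n = b m (q.E (S.σ x) n)
  arr : ∀ a m n, b (p.arr a m) n = -b m (q.arr (S.σ₁ a) n)

namespace IsPairing

theorem flip {b : M →ₗ[k] N →ₗ[k] k} (hb : IsPairing S p q b) : IsPairing S q p b.flip :=
  ⟨fun x n m => by simp [hb.E, S.σ_invol], fun a n m => by simp [hb.arr, S.σ₁_invol]⟩

theorem E' {b : M →ₗ[k] N →ₗ[k] k} (hb : IsPairing S p q b) (x : I) (m : M) (n : N) :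
    b m (q.E x n) = b (p.E (S.σ x) m) n := by rw [hb.E, S.σ_invol]

theorem comp {b : M →ₗ[k] N →ₗ[k] k} (hb : IsPairing S p q b) {f : L →ₗ[k] M}
    (hf : IsMor r p f) : IsPairing S r q (b ∘ₗ f) :=
  ⟨fun x n m => by simp [hf.E, hb.E], fun a n m => by simp [hf.arr, hb.arr]⟩

theorem comp₂ {b : M →ₗ[k] N →ₗ[k] k} (hb : IsPairing S p q b) {f : L →ₗ[k] N}
    (hf : IsMor r q f) : IsPairing S p r (b.compl₂ f) :=
  ⟨fun x n m => by simp [hf.E, hb.E], fun a n m => by simp [hf.arr, hb.arr]⟩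

theorem add {b c : M →ₗ[k] N →ₗ[k] k} (hb : IsPairing S p q b) (hc : IsPairing S p q c) :
    IsPairing S p q (b + c) :=
  ⟨fun x n m => by simp [hb.E, hc.E], fun a n m => by simp [hb.arr, hc.arr]; ring⟩

theorem smul {b : M →ₗ[k] N →ₗ[k] k} (c : k) (hb : IsPairing S p q b) :
    IsPairing S p q (c • b) :=
  ⟨fun x n m => by simp [hb.E], fun a n m => by simp [hb.arr]⟩

end IsPairing

/-- The evaluation pairing between `∇M` and `M`. -/
theorem isPairing_id (p : QAct k S.toQuiv M) :
    IsPairing S (p.dual S) p (LinearMap.id : Module.Dual k M →ₗ[k] M →ₗ[k] k) :=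
  ⟨fun _ _ _ => rfl, fun _ _ _ => rfl⟩

theorem IsPairing.isMor_dual {b : M →ₗ[k] N →ₗ[k] k} (hb : IsPairing S p q b) :
    IsMor p (q.dual S) (b : M →ₗ[k] Module.Dual k N) :=
  ⟨fun x m => by ext n; exact hb.E x m n, fun a m => by ext n; exact hb.arr a m n⟩

theorem IsMor.isPairing {b : M →ₗ[k] Module.Dual k N} (hb : IsMor p (q.dual S) b) :
    IsPairing S p q b :=
  ⟨fun x m n => LinearMap.congr_fun (hb.E x m) n, fun a m n => LinearMap.congr_fun (hb.arr a m) n⟩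

/-- A nondegenerate pairing of finite dimensional spaces represents all functionals. -/
theorem exists_eq_of_nondegenerate [FiniteDimensional k M] [FiniteDimensional k N]
    {b : M →ₗ[k] N →ₗ[k] k} (hn : b.Nondegenerate) (ξ : Module.Dual k N) : ∃ m, b m = ξ := by
  have hi : Function.Injective b := by
    rw [injective_iff_map_eq_zero]
    intro m hm
    exact hn.1 m fun n => by simp [hm]
  have hi' : Function.Injective b.flip := by
    rw [injective_iff_map_eq_zero]
    intro m hm
    exact hn.2 m fun n => LinearMap.congr_fun hm n
  have h1 : Module.finrank k M ≤ Module.finrank k N := by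
    simpa [Subspace.dual_finrank_eq] using LinearMap.finrank_le_finrank_of_injective
      (f := (b : M →ₗ[k] Module.Dual k N)) hi
  have h2 : Module.finrank k N ≤ Module.finrank k M := by
    simpa [Subspace.dual_finrank_eq] using LinearMap.finrank_le_finrank_of_injective
      (f := (b.flip : N →ₗ[k] Module.Dual k M)) hi'
  exact (LinearMap.injective_iff_surjective_of_finrank_eq_finrank
    (f := (b : M →ₗ[k] Module.Dual k N)) (by rw [Subspace.dual_finrank_eq]; omega)).1 hi ξ

/-- A perfect invariant pairing between `M` and `N` represents all pairings of other modules
with `N`. -/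
theorem IsPairing.exists_repr [FiniteDimensional k M] [FiniteDimensional k N]
    {b : M →ₗ[k] N →ₗ[k] k} (hb : IsPairing S p q b) (hn : b.Nondegenerate)
    {c : L →ₗ[k] N →ₗ[k] k} (hc : IsPairing S r q c) :
    ∃ h : L →ₗ[k] M, IsMor r p h ∧ ∀ l n, b (h l) n = c l n := by
  have hi : Function.Injective b := by
    rw [injective_iff_map_eq_zero]
    intro m hm
    exact hn.1 m fun n => by simp [hm]
  obtain ⟨t, ht, hbt⟩ := hb.isMor_dual.exists_lift hi hc.isMor_dual
    fun l => exists_eq_of_nondegenerate hn _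
  exact ⟨t, ht, fun l n => LinearMap.congr_fun (LinearMap.congr_fun hbt l) n⟩

theorem nondegenerate_id : (LinearMap.id : Module.Dual k M →ₗ[k] M →ₗ[k] k).Nondegenerate :=
  ⟨fun f hf => LinearMap.ext hf, fun m hm => (Module.forall_dual_apply_eq_zero_iff k m).1 hm⟩

theorem nondegenerate_flip {b : M →ₗ[k] N →ₗ[k] k} (h : b.Nondegenerate) :
    b.flip.Nondegenerate := ⟨h.2, h.1⟩

/-- Every invariant pairing of `L` with the dual `∇M` comes from a morphism `L → M`. -/
theorem IsPairing.exists_eval [FiniteDimensional k M] {c : L →ₗ[k] Module.Dual k M →ₗ[k] k}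
    (hc : IsPairing S r (p.dual S) c) :
    ∃ h : L →ₗ[k] M, IsMor r p h ∧ ∀ l ξ, ξ (h l) = c l ξ := by
  obtain ⟨h, hm, hh⟩ := (isPairing_id p).flip.exists_repr (nondegenerate_flip nondegenerate_id) hc
  exact ⟨h, hm, hh⟩

end Pairing

end QAct


/-! ### Representations and their total spaces -/

namespace QRep

open QAct

variable {k : Type u} [Field k] {I A : Type} [Fintype I] [DecidableEq I] {Q : Quiv I A}

/-- The action of the path algebra on the total space `∏ x, V(x)`. -/
def act (V : QRep k Q) : QAct k Q (∀ x, V.obj x) where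
  E x := LinearMap.single k V.obj x ∘ₗ LinearMap.proj x
  arr a := LinearMap.single k V.obj (Q.tgt a) ∘ₗ V.map a ∘ₗ LinearMap.proj (Q.src a)
  E_same x m := by simp
  E_ne x y m h := by simp [Pi.single_eq_of_ne h]
  sum_E m := by simp [Finset.univ_sum_single]
  E_arr a m := by simp
  arr_E a m := by simp

theorem act_E (V : QRep k Q) (x : I) (v : ∀ x, V.obj x) : V.act.E x v = Pi.single x (v x) := rfl

theorem act_arr (V : QRep k Q) (a : A) (v : ∀ x, V.obj x) :
    V.act.arr a v = Pi.single (Q.tgt a) (V.map a (v (Q.src a))) := rfl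

theorem act_arr_single (V : QRep k Q) (a : A) (v : V.obj (Q.src a)) :
    V.act.arr a (Pi.single (Q.src a) v) = Pi.single (Q.tgt a) (V.map a v) := by
  simp [act_arr]

theorem act_E_single (V : QRep k Q) (x : I) (v : V.obj x) :
    V.act.E x (Pi.single x v) = Pi.single x v := by
  simp [act_E]

variable {U V W : QRep k Q}

/-- The map induced by a morphism on the total spaces. -/
def Hom.tot (f : Hom V W) : (∀ x, V.obj x) →ₗ[k] (∀ x, W.obj x) :=
  LinearMap.pi fun x => f.app x ∘ₗ LinearMap.proj x

theorem Hom.tot_apply (f : Hom V W) (v : ∀ x, V.obj x) (x : I) : f.tot v x = f.app x (v x) := rfl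

theorem Hom.tot_single (f : Hom V W) (x : I) (v : V.obj x) :
    f.tot (Pi.single x v) = Pi.single x (f.app x v) := by
  ext y
  rw [tot_apply]
  by_cases h : y = x
  · subst h; simp
  · simp [Pi.single_eq_of_ne h]

theorem Hom.isMor_tot (f : Hom V W) : IsMor V.act W.act f.tot :=
  ⟨fun x v => by simp [act_E, tot_single, tot_apply], fun a v => by
    simp only [act_arr, tot_single, tot_apply]
    congr 1
    exact LinearMap.congr_fun (f.comm a) _⟩

@[ext] theorem Hom.ext {f g : Hom V W} (h : ∀ x v, f.app x v = g.app x v) : f = g := by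
  cases f; cases g
  congr
  funext x
  exact LinearMap.ext (h x)

theorem Hom.tot_injective {f g : Hom V W} (h : f.tot = g.tot) : f = g := by
  ext x v
  have := congrFun (LinearMap.congr_fun h (Pi.single x v)) x
  simpa [tot_apply] using this

theorem Hom.tot_id : (Hom.id V).tot = LinearMap.id := rfl

theorem Hom.tot_comp (g : Hom V W) (f : Hom U V) : (g.comp f).tot = g.tot ∘ₗ f.tot := rfl

/-- The morphism of representations given by a morphism between the total spaces. -/
def Hom.ofMor (f : (∀ x, V.obj x) →ₗ[k] (∀ x, W.obj x)) (hf : IsMor V.act W.act f) : Hom V W where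
  app x := LinearMap.proj x ∘ₗ f ∘ₗ LinearMap.single k V.obj x
  comm a := by
    ext v
    have := hf.arr a (Pi.single (Q.src a) v)
    rw [act_arr_single] at this
    simp [this, act_arr]

theorem Hom.tot_ofMor (f : (∀ x, V.obj x) →ₗ[k] (∀ x, W.obj x)) (hf : IsMor V.act W.act f) :
    (Hom.ofMor f hf).tot = f := by
  refine LinearMap.ext fun v => funext fun x => ?_
  have := congrFun (hf.E x v) x
  simpa [act_E, tot_apply, ofMor] using this

theorem Hom.injective_iff {f : Hom V W} : f.Injective ↔ Function.Injective f.tot := by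
  constructor
  · intro h v w hvw
    funext x
    exact h x (congrFun hvw x)
  · intro h x v w hvw
    have := h (a₁ := Pi.single x v) (a₂ := Pi.single x w) (by rw [tot_single, tot_single, hvw])
    simpa using congrFun this x

theorem Hom.surjective_iff {f : Hom V W} : f.Surjective ↔ Function.Surjective f.tot := by
  constructor
  · intro h w
    choose v hv using fun x => h x (w x)
    exact ⟨v, funext hv⟩
  · intro h x w
    obtain ⟨v, hv⟩ := h (Pi.single x w)
    exact ⟨v x, by simpa [tot_apply] using congrFun hv x⟩

theorem Hom.range_eq_ker_iff {f : Hom U V} {g : Hom V W} :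
    (∀ x, LinearMap.range (f.app x) = LinearMap.ker (g.app x)) ↔
      LinearMap.range f.tot = LinearMap.ker g.tot := by
  constructor
  · intro h
    ext v
    constructor
    · rintro ⟨u, rfl⟩
      refine funext fun x => ?_
      have : f.app x (u x) ∈ LinearMap.ker (g.app x) := h x ▸ ⟨u x, rfl⟩
      exact this
    · intro hv
      have : ∀ x, v x ∈ LinearMap.range (f.app x) := fun x => by
        rw [h x]; exact congrFun hv x
      choose u hu using this
      exact ⟨u, funext hu⟩
  · intro h x
    ext v
    constructor
    · rintro ⟨u, rfl⟩
      have : f.tot (Pi.single x u) ∈ LinearMap.ker g.tot := h ▸ ⟨_, rfl⟩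
      have := congrFun (LinearMap.mem_ker.1 this) x
      simpa [tot_single, tot_apply] using this
    · intro hv
      have : Pi.single x v ∈ LinearMap.ker g.tot := by
        rw [LinearMap.mem_ker, tot_single, LinearMap.mem_ker.1 hv, Pi.single_zero]
      rw [← h] at this
      obtain ⟨u, hu⟩ := this
      exact ⟨u x, by simpa [tot_apply] using congrFun hu x⟩

theorem Hom.isSection_iff {f : Hom V W} : f.IsSection ↔
    ∃ r : (∀ x, W.obj x) →ₗ[k] (∀ x, V.obj x), IsMor W.act V.act r ∧ r ∘ₗ f.tot = LinearMap.id := by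
  constructor
  · rintro ⟨r, hr⟩
    exact ⟨r.tot, r.isMor_tot, by rw [← tot_comp, hr, tot_id]⟩
  · rintro ⟨r, hr, h⟩
    exact ⟨Hom.ofMor r hr, tot_injective (by rw [tot_comp, tot_ofMor, h, tot_id])⟩

theorem Hom.isRetraction_iff {f : Hom V W} : f.IsRetraction ↔
    ∃ r : (∀ x, W.obj x) →ₗ[k] (∀ x, V.obj x), IsMor W.act V.act r ∧ f.tot ∘ₗ r = LinearMap.id := by
  constructor
  · rintro ⟨r, hr⟩
    exact ⟨r.tot, r.isMor_tot, by rw [← tot_comp, hr, tot_id]⟩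
  · rintro ⟨r, hr, h⟩
    exact ⟨Hom.ofMor r hr, tot_injective (by rw [tot_comp, tot_ofMor, h, tot_id])⟩

theorem isFinDim_iff : V.IsFinDim ↔ FiniteDimensional k (∀ x, V.obj x) := by
  constructor
  · intro h
    have : ∀ x, FiniteDimensional k (V.obj x) := h
    infer_instance
  · intro h x
    exact FiniteDimensional.of_injective (LinearMap.single k V.obj x)
      (Pi.single_injective x)

theorem isZero_iff : V.IsZero ↔ Subsingleton (∀ x, V.obj x) := by
  constructor
  · intro h
    have : ∀ x, Subsingleton (V.obj x) := h
    infer_instance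
  · intro h x
    exact (Pi.single_injective x).subsingleton

end QRep

namespace QAct

variable {k : Type u} [Field k] {I A : Type} [Fintype I] [DecidableEq I] {Q : Quiv I A}
  {M : Type u} [AddCommGroup M] [Module k M]

/-- The representation attached to a module over the path algebra. -/
def toRep (o : QAct k Q M) : QRep k Q where
  obj x := LinearMap.range (o.E x)
  map a := (o.arr a ∘ₗ Submodule.subtype _).codRestrict _ fun m => ⟨o.arr a m, o.E_arr a _⟩

/-- The inclusion of a component of `o.toRep` into the module. -/
def toRepIncl (o : QAct k Q M) (x : I) : o.toRep.obj x →ₗ[k] M :=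
  (LinearMap.range (o.E x)).subtype

/-- The projection of the module to a component of `o.toRep`. -/
def toRepProj (o : QAct k Q M) (x : I) : M →ₗ[k] o.toRep.obj x := (o.E x).rangeRestrict

theorem toRepIncl_injective (o : QAct k Q M) (x : I) : Function.Injective (o.toRepIncl x) :=
  Subtype.val_injective

theorem toRepIncl_proj (o : QAct k Q M) (x : I) (m : M) :
    o.toRepIncl x (o.toRepProj x m) = o.E x m := rfl

theorem E_toRepIncl (o : QAct k Q M) (x y : I) (v : o.toRep.obj y) :
    o.E x (o.toRepIncl y v) = if y = x then o.toRepIncl y v else 0 := by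
  obtain ⟨m, hm⟩ : ∃ m, o.toRepProj y m = v :=
    ⟨o.toRepIncl y v, o.toRepIncl_injective y (by
      obtain ⟨m, hm⟩ := (show LinearMap.range (o.E y) from v).2
      rw [toRepIncl_proj]
      change o.E y (show LinearMap.range (o.E y) from v).1 = (show LinearMap.range (o.E y) from v).1
      rw [← hm, o.E_same])⟩
  rw [← hm, toRepIncl_proj]
  split_ifs with h
  · subst h; exact o.E_same _ _
  · exact o.E_ne _ _ _ (Ne.symm h)

/-- The total space of `o.toRep` is the module. -/
def toRepEquiv (o : QAct k Q M) : (∀ x, o.toRep.obj x) ≃ₗ[k] M :=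
  LinearEquiv.ofLinearMap
    (∑ x, o.toRepIncl x ∘ₗ LinearMap.proj x)
    (LinearMap.pi fun x => o.toRepProj x)
    (by
      refine LinearMap.ext fun m => ?_
      rw [LinearMap.comp_apply, LinearMap.sum_apply]
      exact o.sum_E m)
    (by
      refine LinearMap.ext fun v => funext fun x => o.toRepIncl_injective x ?_
      rw [LinearMap.comp_apply, LinearMap.sum_apply, LinearMap.pi_apply, toRepIncl_proj, map_sum,
        Finset.sum_eq_single x]
      · exact (o.E_toRepIncl x x (v x)).trans (by simp)
      · intro y _ hy
        exact (o.E_toRepIncl x y (v y)).trans (by simp [hy])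
      · simp)

theorem toRepEquiv_apply (o : QAct k Q M) (v : ∀ x, o.toRep.obj x) :
    o.toRepEquiv v = ∑ x, o.toRepIncl x (v x) := by
  change (∑ x, o.toRepIncl x ∘ₗ LinearMap.proj x) v = _
  rw [LinearMap.sum_apply]
  rfl

theorem toRepEquiv_single (o : QAct k Q M) (x : I) (v : o.toRep.obj x) :
    o.toRepEquiv (Pi.single x v) = o.toRepIncl x v := by
  rw [toRepEquiv_apply, Finset.sum_eq_single x]
  · simp
  · intro y _ hy
    rw [Pi.single_eq_of_ne hy, map_zero]
  · simp

theorem isMor_toRepEquiv (o : QAct k Q M) : IsMor o.toRep.act o o.toRepEquiv.toLinearMap := by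
  constructor
  · intro x v
    obtain ⟨m, rfl⟩ := o.toRepEquiv.symm.surjective v
    simp only [QRep.act_E, LinearEquiv.coe_coe, toRepEquiv_single, LinearEquiv.apply_symm_apply]
    rfl
  · intro a v
    obtain ⟨m, rfl⟩ := o.toRepEquiv.symm.surjective v
    simp only [QRep.act_arr, LinearEquiv.coe_coe, toRepEquiv_single, LinearEquiv.apply_symm_apply]
    exact o.arr_E a m

end QAct

namespace SymQuiver

open QAct

variable {k : Type u} [Field k] {I A : Type} [Fintype I] [DecidableEq I] (S : SymQuiver I A)

theorem hom_single {Q : Quiv I A} (V : QRep k Q) (a : A) {y z : I} (hy : Q.src a = y)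
    (hz : Q.tgt a = z) (v : V.obj y) :
    Pi.single z (V.hom a hy hz v) = V.act.arr a (Pi.single y v) := by
  subst hy hz
  exact (V.act_arr_single a v).symm

/-- The components of `∇V` are the dual spaces of those of `V`. -/
def dualComp (V : QRep k S.toQuiv) (x : I) : (S.dual V).obj x →ₗ[k] Module.Dual k (V.obj (S.σ x)) :=
  LinearMap.id

theorem dualComp_injective (V : QRep k S.toQuiv) (x : I) : Function.Injective (S.dualComp V x) :=
  Function.injective_id

theorem σ_injective : Function.Injective S.σ := Function.LeftInverse.injective S.σ_invol

/-- The map from the total space of `∇V` to the dual of the total space of `V`. -/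
def dualMap (V : QRep k S.toQuiv) :
    (∀ x, (S.dual V).obj x) →ₗ[k] Module.Dual k (∀ x, V.obj x) :=
  ∑ x, (LinearMap.proj (S.σ x) : (∀ x, V.obj x) →ₗ[k] V.obj (S.σ x)).dualMap ∘ₗ
    S.dualComp V x ∘ₗ LinearMap.proj x

theorem dualMap_apply (V : QRep k S.toQuiv) (α : ∀ x, (S.dual V).obj x) (v : ∀ x, V.obj x) :
    S.dualMap V α v = ∑ x, S.dualComp V x (α x) (v (S.σ x)) := by
  rw [dualMap, LinearMap.sum_apply, LinearMap.sum_apply]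
  rfl

theorem dualMap_single (V : QRep k S.toQuiv) (x : I) (α : (S.dual V).obj x)
    (v : ∀ x, V.obj x) : S.dualMap V (Pi.single x α) v = S.dualComp V x α (v (S.σ x)) := by
  rw [dualMap_apply, Finset.sum_eq_single x]
  · simp
  · intro y _ hy
    rw [Pi.single_eq_of_ne hy, map_zero, LinearMap.zero_apply]
  · simp

theorem dualMap_apply_single (V : QRep k S.toQuiv) (x : I) (α : ∀ x, (S.dual V).obj x)
    (v : V.obj (S.σ x)) : S.dualMap V α (Pi.single (S.σ x) v) = S.dualComp V x (α x) v := by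
  rw [dualMap_apply, Finset.sum_eq_single x]
  · simp
  · intro y _ hy
    rw [Pi.single_eq_of_ne (S.σ_injective.ne hy), map_zero]
  · simp

/-- The total space of `∇V` is the dual space of the total space of `V`. -/
noncomputable def dualEquiv (V : QRep k S.toQuiv) :
    (∀ x, (S.dual V).obj x) ≃ₗ[k] Module.Dual k (∀ x, V.obj x) :=
  LinearEquiv.ofBijective (S.dualMap V) (by
    constructor
    · intro α β h
      funext x
      refine S.dualComp_injective V x (LinearMap.ext fun v => ?_)
      have := LinearMap.congr_fun h (Pi.single (S.σ x) v)
      rwa [dualMap_apply_single, dualMap_apply_single] at this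
    · intro ξ
      refine ⟨fun x => (ξ ∘ₗ LinearMap.single k V.obj (S.σ x) : Module.Dual k (V.obj (S.σ x))), ?_⟩
      refine LinearMap.pi_ext fun x v => ?_
      obtain ⟨y, rfl⟩ : ∃ y, x = S.σ y := ⟨S.σ x, (S.σ_invol x).symm⟩
      exact S.dualMap_apply_single V y
        (fun x => (ξ ∘ₗ LinearMap.single k V.obj (S.σ x) : Module.Dual k (V.obj (S.σ x)))) v)

theorem isMor_dualEquiv (V : QRep k S.toQuiv) :
    IsMor (S.dual V).act (V.act.dual S) (S.dualEquiv V).toLinearMap := by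
  constructor
  · intro x α
    refine LinearMap.ext fun v => ?_
    change S.dualMap V (Pi.single x (α x)) v = S.dualMap V α (Pi.single (S.σ x) (v (S.σ x)))
    rw [dualMap_single, dualMap_apply_single]
  · intro a α
    refine LinearMap.ext fun v => ?_
    change S.dualMap V (Pi.single (S.tgt a) ((S.dual V).map a (α (S.src a)))) v =
      -S.dualMap V α (V.act.arr (S.σ₁ a) v)
    rw [dualMap_single]
    have h1 : V.act.arr (S.σ₁ a) v
        = Pi.single (S.σ (S.src a)) (V.hom (S.σ₁ a) (S.src_σ₁ a) (S.tgt_σ₁ a) (v (S.σ (S.tgt a)))) := by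
      rw [hom_single, ← V.act_E, ← S.src_σ₁ a, V.act.arr_E]
    rw [h1, dualMap_apply_single]
    rfl

theorem isForm_iff {ε : k} {V : QRep k S.toQuiv} {B : LinearMap.BilinForm k (∀ x, V.obj x)} :
    S.IsForm ε V B ↔ IsPairing S V.act V.act B ∧ LinearMap.Nondegenerate B ∧
      ∀ v w, B v w = ε * B w v := by
  constructor
  · intro h
    refine ⟨⟨fun x v w => ?_, fun a v w => ?_⟩, h.nondegenerate, h.symm⟩
    · rw [QRep.act_E, QRep.act_E]
      conv_lhs => rw [← Finset.univ_sum_single w]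
      conv_rhs => rw [← Finset.univ_sum_single v]
      simp only [map_sum, LinearMap.sum_apply]
      rw [Finset.sum_eq_single (S.σ x), Finset.sum_eq_single x]
      · intro y _ hy
        exact h.orth _ _ (fun h' => hy (by rw [← S.σ_invol y, ← h', S.σ_invol])) _ _
      · simp
      · intro y _ hy
        exact h.orth _ _ hy _ _
      · simp
    · have h1 : ∀ u w : ∀ x, V.obj x, B u w = ∑ x, B (Pi.single x (u x)) (Pi.single (S.σ x) (w (S.σ x))) := by
        intro u w
        conv_lhs => rw [← Finset.univ_sum_single u, ← Finset.univ_sum_single w]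
        simp only [map_sum, LinearMap.sum_apply]
        rw [Finset.sum_comm]
        refine Finset.sum_congr rfl fun x _ => ?_
        rw [Finset.sum_eq_single (S.σ x)]
        · intro y _ hy
          exact h.orth _ _ hy _ _
        · simp
      have h2 : ∀ x y, y = S.σ x → ∀ (u : V.obj x) (w : ∀ x, V.obj x),
          B (Pi.single x u) w = B (Pi.single x u) (Pi.single y (w y)) := by
        rintro x y rfl u w
        rw [h1, Finset.sum_eq_single x]
        · simp
        · intro y _ hy
          simp [Pi.single_eq_of_ne hy]
        · simp
      have h3 : ∀ x y, y = S.σ x → ∀ (u : V.obj y) (w : ∀ x, V.obj x),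
          B w (Pi.single y u) = B (Pi.single x (w x)) (Pi.single y u) := by
        rintro x y rfl u w
        rw [h1, Finset.sum_eq_single x]
        · simp
        · intro y _ hy
          have : S.σ y ≠ S.σ x := fun h => hy (by rw [← S.σ_invol y, h, S.σ_invol])
          simp [Pi.single_eq_of_ne this]
        · simp
      rw [QRep.act_arr, QRep.act_arr, h2 _ _ (S.src_σ₁ a), h3 _ _ (S.tgt_σ₁ a),
        eq_neg_iff_add_eq_zero]
      exact h.skew a _ _
  · rintro ⟨hp, hn, hs⟩
    refine ⟨hn, hs, fun x y hxy v w => ?_, fun a v w => ?_⟩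
    · rw [← V.act_E_single x v, hp.E, V.act_E, Pi.single_eq_of_ne (Ne.symm hxy), Pi.single_zero,
        map_zero]
    · rw [← V.act_arr_single, hp.arr, V.act_arr_single, neg_add_cancel]

end SymQuiver


/-! ### Projective modules -/

theorem Quiv.Acyclic.wf {I A : Type} [Finite I] {Q : Quiv I A} (hQ : Q.Acyclic) :
    WellFounded (Relation.TransGen (fun y z => ∃ a, Q.src a = y ∧ Q.tgt a = z)) := by
  have : Std.Irrefl (Relation.TransGen (fun y z => ∃ a, Q.src a = y ∧ Q.tgt a = z)) := ⟨hQ⟩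
  exact Finite.wellFounded_of_trans_of_irrefl _

namespace QAct

variable {k : Type u} [Field k] {I A : Type} [Fintype I] [DecidableEq I] {Q : Quiv I A}
  {M N : Type u} [AddCommGroup M] [Module k M] [AddCommGroup N] [Module k N] {ι κ : Type}

/-- The total space of `⨁ i, P_{y i}`. -/
abbrev ProjTot (k : Type u) [Field k] (Q : Quiv I A) (y : ι → I) : Type u :=
  ∀ z, (QRep.proj k Q y).obj z

/-- The generators of `⨁ i, P_{y i}` in the total space. -/
noncomputable def pgen (k : Type u) [Field k] (Q : Quiv I A) (y : ι → I) (i : ι) :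
    ProjTot k Q y := Pi.single (y i) (QRep.gen k Q y i)

/-- The action of the path algebra on `⨁ i, P_{y i}`. -/
noncomputable abbrev pact (k : Type u) [Field k] (Q : Quiv I A) (y : ι → I) :
    QAct k Q (ProjTot k Q y) := (QRep.proj k Q y).act

theorem E_pgen (y : ι → I) (i : ι) : (pact k Q y).E (y i) (pgen k Q y i) = pgen k Q y i :=
  QRep.act_E_single _ _ _

/-- The components of `⨁ i, P_{y i}` are spaces of linear combinations of paths. -/
noncomputable def projComp (k : Type u) [Field k] (Q : Quiv I A) (y : ι → I) (z : I) :
    (QRep.proj k Q y).obj z ≃ₗ[k] ((Σ i, Q.Path (y i) z) →₀ k) := LinearEquiv.refl k _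

/-- The basis vector of a path. -/
noncomputable def pathVec (k : Type u) [Field k] {Q : Quiv I A} (y : ι → I) {i : ι} {z : I}
    (q : Q.Path (y i) z) : ProjTot k Q y :=
  Pi.single z ((projComp k Q y z).symm (Finsupp.single ⟨i, q⟩ 1))

theorem pathVec_cons (y : ι → I) {i : ι} (a : A) (q : Q.Path (y i) (Q.src a)) :
    pathVec k y (Quiv.Path.snoc a q) = (pact k Q y).arr a (pathVec k y q) := by
  rw [pathVec, pathVec, QRep.act_arr_single]
  congr 1
  exact (Finsupp.mapDomain_single (b := (1 : k)) (a := (⟨i, q⟩ : Σ i, Q.Path (y i) (Q.src a)))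
    (f := fun p : Σ i, Q.Path (y i) (Q.src a) =>
      (⟨p.1, Quiv.Path.snoc a p.2⟩ : Σ i, Q.Path (y i) (Q.tgt a)))).symm

theorem path_induction {x : I} {P : ∀ {z : I}, Q.Path x z → Prop}
    (nil : P (@Quiver.Path.nil I Q.toQuiver x))
    (snoc : ∀ (a : A) (q : Q.Path x (Q.src a)), P q → P (Quiv.Path.snoc a q)) :
    ∀ {z : I} (q : Q.Path x z), P q := by
  intro z q
  refine @Quiver.Path.rec I Q.toQuiver x (fun z q => P q) nil ?_ z q
  rintro b c q ⟨a, rfl, rfl⟩ ih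
  exact snoc a q ih

theorem pathVec_span (y : ι → I) {U : Submodule k (ProjTot k Q y)}
    (h : ∀ (i : ι) (z : I) (q : Q.Path (y i) z), pathVec k y q ∈ U) : U = ⊤ := by
  rw [eq_top_iff]
  rintro v -
  rw [← Finset.univ_sum_single v]
  refine Submodule.sum_mem _ fun z _ => ?_
  have : ∀ w : (Σ i, Q.Path (y i) z) →₀ k,
      (Pi.single z ((projComp k Q y z).symm w) : ProjTot k Q y) ∈ U := by
    intro w
    induction w using Finsupp.induction_linear with
    | zero =>
      rw [map_zero, Pi.single_zero]
      exact U.zero_mem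
    | add f g hf hg =>
      rw [map_add, Pi.single_add]
      exact U.add_mem hf hg
    | single s c =>
      have := U.smul_mem c (h s.1 z s.2)
      rwa [pathVec, ← Pi.single_smul, ← map_smul, Finsupp.smul_single_one] at this
  simpa using this (projComp k Q y z (v z))

/-- A subspace of `⨁ i, P_{y i}` that contains the generators and is stable under the arrows is
everything. -/
theorem pgen_span (y : ι → I) {U : Submodule k (ProjTot k Q y)} (hg : ∀ i, pgen k Q y i ∈ U)
    (ha : ∀ a, ∀ v ∈ U, (pact k Q y).arr a v ∈ U) : U = ⊤ := by
  refine pathVec_span y fun i z q => ?_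
  refine path_induction (P := fun {z} q => pathVec k y q ∈ U) (hg i) (fun a q hq => ?_) q
  rw [pathVec_cons]
  exact ha a _ hq

/-- The value on a path of the map determined by a derivation rule with inhomogeneous term `c` and
by values `w` on the generators. -/
noncomputable def extPath (o : QAct k Q M) {y : ι → I} (c : A → ProjTot k Q y →ₗ[k] M)
    (w : ι → M) {i : ι} : ∀ {z : I}, Q.Path (y i) z → M :=
  fun {z} q => @Quiver.Path.rec I Q.toQuiver (y i) (fun _ _ => M) (o.E (y i) (w i))
    (fun {b _} q a m => o.arr a.1 m + o.E (Q.tgt a.1) (c a.1 (pathVec k y (z := b) q))) z q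

/-- The linear map `L` on `⨁ i, P_{y i}` with `L (a v) = a (L v) + c a v` and prescribed values on
the generators; for `c = 0` it is a morphism, in general it trivializes a `1`-cocycle. -/
noncomputable def ext (o : QAct k Q M) {y : ι → I} (c : A → ProjTot k Q y →ₗ[k] M)
    (w : ι → M) : ProjTot k Q y →ₗ[k] M :=
  ∑ z, (Finsupp.linearCombination k (fun s : Σ i, Q.Path (y i) z => o.extPath c w s.2) :
      ((Σ i, Q.Path (y i) z) →₀ k) →ₗ[k] M) ∘ₗ (projComp k Q y z).toLinearMap ∘ₗ
    (LinearMap.proj z : ProjTot k Q y →ₗ[k] (QRep.proj k Q y).obj z)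

theorem ext_pathVec (o : QAct k Q M) {y : ι → I} (c : A → ProjTot k Q y →ₗ[k] M) (w : ι → M)
    {i : ι} {z : I} (q : Q.Path (y i) z) : o.ext c w (pathVec k y q) = o.extPath c w q := by
  rw [ext, LinearMap.sum_apply, Finset.sum_eq_single z]
  · rw [LinearMap.comp_apply, LinearMap.comp_apply, pathVec, LinearMap.proj_apply,
      Pi.single_eq_same, LinearEquiv.coe_coe, LinearEquiv.apply_symm_apply,
      Finsupp.linearCombination_single, one_smul]
  · intro b _ hb
    rw [LinearMap.comp_apply, LinearMap.comp_apply, pathVec, LinearMap.proj_apply,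
      Pi.single_eq_of_ne hb, map_zero, map_zero]
  · simp

theorem ext_pgen (o : QAct k Q M) {y : ι → I} (c : A → ProjTot k Q y →ₗ[k] M) (w : ι → M)
    (i : ι) : o.ext c w (pgen k Q y i) = o.E (y i) (w i) :=
  o.ext_pathVec c w (@Quiver.Path.nil I Q.toQuiver (y i))

theorem E_pathVec (y : ι → I) {i : ι} {z : I} (q : Q.Path (y i) z) :
    (pact k Q y).E z (pathVec k y q) = pathVec k y q := QRep.act_E_single _ _ _

theorem ext_E (o : QAct k Q M) {y : ι → I} (c : A → ProjTot k Q y →ₗ[k] M) (w : ι → M)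
    (x : I) (v : ProjTot k Q y) : o.ext c w ((pact k Q y).E x v) = o.E x (o.ext c w v) := by
  have key : ∀ {i : ι} {z : I} (q : Q.Path (y i) z), o.E z (o.extPath c w q) = o.extPath c w q := by
    intro i z q
    refine path_induction (P := fun {z} q => o.E z (o.extPath c w q) = o.extPath c w q)
      (o.E_same _ _) (fun a q hq => ?_) q
    change o.E _ (o.arr a _ + o.E _ _) = o.arr a _ + o.E _ _
    rw [map_add, o.E_arr, o.E_same]
  have : LinearMap.eqLocus (o.ext c w ∘ₗ (pact k Q y).E x) (o.E x ∘ₗ o.ext c w) = ⊤ := by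
    refine pathVec_span y fun i z q => ?_
    rw [LinearMap.mem_eqLocus, LinearMap.comp_apply, LinearMap.comp_apply, ext_pathVec]
    by_cases h : x = z
    · subst h
      rw [E_pathVec, ext_pathVec, key]
    · rw [← E_pathVec, (pact k Q y).E_ne _ _ _ h, ← key, o.E_ne _ _ _ h, map_zero]
  have h : v ∈ LinearMap.eqLocus (o.ext c w ∘ₗ (pact k Q y).E x) (o.E x ∘ₗ o.ext c w) :=
    this ▸ Submodule.mem_top
  exact h

theorem ext_arr (o : QAct k Q M) {y : ι → I} (c : A → ProjTot k Q y →ₗ[k] M) (w : ι → M)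
    (a : A) (v : ProjTot k Q y) : o.ext c w ((pact k Q y).arr a v) =
      o.arr a (o.ext c w v) + o.E (Q.tgt a) (c a ((pact k Q y).E (Q.src a) v)) := by
  have : LinearMap.eqLocus (o.ext c w ∘ₗ (pact k Q y).arr a)
      (o.arr a ∘ₗ o.ext c w + o.E (Q.tgt a) ∘ₗ c a ∘ₗ (pact k Q y).E (Q.src a)) = ⊤ := by
    refine pathVec_span y fun i z q => ?_
    simp only [LinearMap.mem_eqLocus, LinearMap.comp_apply, LinearMap.add_apply]
    by_cases h : Q.src a = z
    · subst h
      rw [E_pathVec, ← pathVec_cons, ext_pathVec, ext_pathVec]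
      rfl
    · rw [← E_pathVec, (pact k Q y).E_ne _ _ _ h, (pact k Q y).arr_E_ne h, ext_E, o.arr_E_ne h]
      simp
  have h : v ∈ LinearMap.eqLocus _ _ := this ▸ Submodule.mem_top
  exact h

/-- The morphism from `⨁ i, P_{y i}` that maps the `i`-th generator to `e_{y i} w_i`. -/
noncomputable def lift (o : QAct k Q M) (y : ι → I) (w : ι → M) : ProjTot k Q y →ₗ[k] M :=
  o.ext (fun _ => 0) w

theorem isMor_lift (o : QAct k Q M) (y : ι → I) (w : ι → M) :
    IsMor (pact k Q y) o (o.lift y w) :=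
  ⟨fun x v => o.ext_E _ _ x v, fun a v => by simp [lift, ext_arr]⟩

theorem lift_pgen (o : QAct k Q M) (y : ι → I) (w : ι → M) (i : ι) :
    o.lift y w (pgen k Q y i) = o.E (y i) (w i) := o.ext_pgen _ _ _

theorem lift_pgen' (o : QAct k Q M) (y : ι → I) (w : ι → M) (i : ι)
    (h : o.E (y i) (w i) = w i) : o.lift y w (pgen k Q y i) = w i := by
  rw [lift_pgen, h]

theorem IsMor.E_pgen {o : QAct k Q M} {y : ι → I} {f : ProjTot k Q y →ₗ[k] M}
    (hf : IsMor (pact k Q y) o f) (i : ι) : o.E (y i) (f (pgen k Q y i)) = f (pgen k Q y i) := by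
  rw [← hf.E, QAct.E_pgen]

/-- Two maps with the same derivation rule that agree on the generators are equal. -/
theorem proj_hom_ext (o : QAct k Q M) {y : ι → I} {f g : ProjTot k Q y →ₗ[k] M}
    (hg : ∀ i, f (pgen k Q y i) = g (pgen k Q y i))
    (ha : ∀ a v, f v = g v → f ((pact k Q y).arr a v) = g ((pact k Q y).arr a v)) : f = g := by
  have : LinearMap.eqLocus f g = ⊤ := pgen_span y hg fun a v hv => ha a v hv
  exact LinearMap.ext fun v => (this ▸ Submodule.mem_top : v ∈ LinearMap.eqLocus f g)

theorem IsMor.proj_ext {o : QAct k Q M} {y : ι → I} {f g : ProjTot k Q y →ₗ[k] M}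
    (hf : IsMor (pact k Q y) o f) (hg : IsMor (pact k Q y) o g)
    (h : ∀ i, f (pgen k Q y i) = g (pgen k Q y i)) : f = g :=
  proj_hom_ext o h fun a v hv => by rw [hf.arr, hg.arr, hv]

/-- The lifting property of `⨁ i, P_{y i}`. -/
theorem exists_lift_proj {o : QAct k Q M} {o' : QAct k Q N} {y : ι → I} {g : M →ₗ[k] N}
    (hg : IsMor o o' g) {h : ProjTot k Q y →ₗ[k] N} (hh : IsMor (pact k Q y) o' h)
    (hr : ∀ i, h (pgen k Q y i) ∈ LinearMap.range g) :
    ∃ t : ProjTot k Q y →ₗ[k] M, IsMor (pact k Q y) o t ∧ g ∘ₗ t = h := by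
  choose w hw using hr
  refine ⟨o.lift y w, o.isMor_lift y w, IsMor.proj_ext (hg.comp (o.isMor_lift y w)) hh fun i => ?_⟩
  rw [LinearMap.comp_apply, lift_pgen, hg.E, hw, hh.E_pgen]

/-- The semisimple module with one basis vector at `y i` for each `i`, the top of
`⨁ i, P_{y i}`. -/
noncomputable def topAct (k : Type u) [Field k] (Q : Quiv I A) (y : ι → I) : QAct k Q (ι → k) where
  E x := LinearMap.pi fun i => if y i = x then LinearMap.proj i else 0
  arr _ := 0
  E_same x m := by ext i; by_cases h : y i = x <;> simp [h]
  E_ne x z m hxz := by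
    ext i
    rw [LinearMap.pi_apply]
    by_cases h : y i = x
    · have : y i ≠ z := fun h' => hxz (h.symm.trans h')
      rw [if_pos h, LinearMap.proj_apply, LinearMap.pi_apply, if_neg this]
      rfl
    · rw [if_neg h]
      rfl
  sum_E m := by
    ext i
    rw [Finset.sum_apply, Finset.sum_eq_single (y i)]
    · simp
    · intro z _ hz
      simp [Ne.symm hz]
    · simp
  E_arr a m := by simp
  arr_E a m := by simp

/-- The coordinates with respect to the generators of an element of `⨁ i, P_{y i}`. -/
noncomputable def topCoord [DecidableEq ι] (k : Type u) [Field k] (Q : Quiv I A) (y : ι → I) :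
    ProjTot k Q y →ₗ[k] (ι → k) :=
  (topAct k Q y).lift y fun i => Pi.single i 1

theorem topCoord_pgen [DecidableEq ι] (y : ι → I) (i : ι) :
    topCoord k Q y (pgen k Q y i) = Pi.single i 1 := by
  refine lift_pgen' _ _ _ _ ?_
  ext j
  by_cases h : y j = y i
  · simp [topAct, h]
  · have : j ≠ i := fun h' => h (by rw [h'])
    simp [topAct, h, this]

theorem topCoord_arr [DecidableEq ι] (y : ι → I) (a : A) (v : ProjTot k Q y) :
    topCoord k Q y ((pact k Q y).arr a v) = 0 :=
  ((topAct k Q y).isMor_lift y _).arr a v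

/-- Every element is a combination of generators plus an element of the radical. -/
theorem exists_decomp [Fintype A] [Fintype ι] [DecidableEq ι] (y : ι → I) (v : ProjTot k Q y) :
    ∃ q : A → ProjTot k Q y, v = ∑ i, topCoord k Q y v i • pgen k Q y i +
      ∑ a, (pact k Q y).arr a (q a) := by
  classical
  let U : Submodule k (ProjTot k Q y) :=
    LinearMap.range ((∑ i, (LinearMap.toSpanSingleton k _ (pgen k Q y i)) ∘ₗ LinearMap.proj i) ∘ₗ
      (LinearMap.fst k (ι → k) (A → ProjTot k Q y)) +
      (∑ a, (pact k Q y).arr a ∘ₗ LinearMap.proj a) ∘ₗ LinearMap.snd k (ι → k) (A → ProjTot k Q y))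
  have hU : U = ⊤ := by
    refine pgen_span y (fun i => ⟨(Pi.single i 1, 0), ?_⟩) (fun a v _ => ⟨(0, Pi.single a v), ?_⟩)
    · simp [Pi.single_apply]
    · simp only [LinearMap.add_apply, LinearMap.comp_apply, LinearMap.fst_apply,
        LinearMap.snd_apply, map_zero, zero_add, LinearMap.sum_apply, LinearMap.proj_apply]
      rw [Finset.sum_eq_single a]
      · simp
      · intro b _ hb
        simp [Pi.single_eq_of_ne hb]
      · simp
  obtain ⟨⟨c, q⟩, h⟩ : v ∈ U := hU ▸ Submodule.mem_top
  simp only [LinearMap.add_apply, LinearMap.comp_apply, LinearMap.fst_apply, LinearMap.snd_apply,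
    LinearMap.sum_apply, LinearMap.proj_apply, LinearMap.toSpanSingleton_apply] at h
  refine ⟨q, ?_⟩
  have hc : topCoord k Q y v = c := by
    rw [← h, map_add, map_sum, map_sum]
    simp only [map_smul, topCoord_pgen, topCoord_arr, Finset.sum_const_zero, add_zero]
    ext j
    simp [Pi.single_apply]
  rw [hc]
  exact h.symm

/-- The vector space `M` as a module concentrated at the vertex `x`. -/
def concAct (Q : Quiv I A) (x : I) : QAct k Q M where
  E z := if z = x then LinearMap.id else 0
  arr _ := 0
  E_same z m := by split_ifs <;> simp
  E_ne z z' m h := by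
    by_cases h1 : z = x
    · have : z' ≠ x := fun h' => h (h1.trans h'.symm)
      simp [this]
    · simp [h1]
  sum_E m := by
    rw [Finset.sum_eq_single x]
    · simp
    · intro z _ hz
      simp [hz]
    · simp
  E_arr a m := by simp
  arr_E a m := by simp

/-- The map that recovers `v` from `a v`. -/
noncomputable def arrCoord [DecidableEq A] (k : Type u) [Field k] {Q : Quiv I A} (y : ι → I)
    (a : A) : ProjTot k Q y →ₗ[k] ProjTot k Q y :=
  (concAct Q (Q.tgt a)).ext (fun b => if b = a then LinearMap.id else 0) 0

theorem arrCoord_pgen [DecidableEq A] (y : ι → I) (a : A) (i : ι) :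
    arrCoord k (Q := Q) y a (pgen k Q y i) = 0 := by
  rw [arrCoord, ext_pgen]; simp

theorem arrCoord_arr [DecidableEq A] (y : ι → I) (a b : A) (v : ProjTot k Q y) :
    arrCoord k y a ((pact k Q y).arr b v) = if b = a then (pact k Q y).E (Q.src a) v else 0 := by
  rw [arrCoord, ext_arr]
  by_cases h : b = a
  · subst h
    simp [concAct]
  · simp [concAct, h]

/-- An invariant subspace that generates modulo the radical is everything, when there are no
oriented cycles. -/
theorem nakayama [Fintype A] (hQ : Q.Acyclic) (o : QAct k Q M) {U : Submodule k M}
    (hE : ∀ x, ∀ m ∈ U, o.E x m ∈ U) (ha : ∀ a, ∀ m ∈ U, o.arr a m ∈ U)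
    (h : ∀ m, ∃ u ∈ U, ∃ q : A → M, m = u + ∑ a, o.arr a (q a)) : U = ⊤ := by
  have key : ∀ x m, o.E x m ∈ U := by
    intro x
    induction x using hQ.wf.induction with
    | _ x ih =>
      intro m
      obtain ⟨u, hu, q, hq⟩ := h m
      rw [hq, map_add, map_sum]
      refine U.add_mem (hE x u hu) (U.sum_mem fun a _ => ?_)
      by_cases hx : x = Q.tgt a
      · subst hx
        rw [o.E_arr, ← o.arr_E]
        exact ha a _ (ih _ (Relation.TransGen.single ⟨a, rfl, rfl⟩) _)
      · rw [o.E_arr_ne hx]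
        exact U.zero_mem
  rw [eq_top_iff]
  rintro m -
  rw [← o.sum_E m]
  exact U.sum_mem fun x _ => key x m

theorem path_cases {x z : I} (p : Q.Path x z) :
    (∃ h : x = z, p = h ▸ (@Quiver.Path.nil I Q.toQuiver x)) ∨
      ∃ (a : {a // Q.tgt a = z}) (q : Q.Path x (Q.src a.1)),
        p = @Quiver.Path.cons I Q.toQuiver x (Q.src a.1) z q ⟨a.1, rfl, a.2⟩ := by
  refine path_induction (P := fun {z} p => (∃ h : x = z, p = h ▸ (@Quiver.Path.nil I Q.toQuiver x)) ∨
      ∃ (a : {a // Q.tgt a = z}) (q : Q.Path x (Q.src a.1)),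
        p = @Quiver.Path.cons I Q.toQuiver x (Q.src a.1) z q ⟨a.1, rfl, a.2⟩) ?_ ?_ p
  · exact Or.inl ⟨rfl, rfl⟩
  · exact fun a q _ => Or.inr ⟨⟨a, rfl⟩, q, rfl⟩

theorem finite_path [Fintype A] (hQ : Q.Acyclic) (x z : I) : Finite (Q.Path x z) := by
  induction z using hQ.wf.induction with
  | _ z ih =>
    have : ∀ a : {a // Q.tgt a = z}, Finite (Q.Path x (Q.src a.1)) := fun a =>
      ih _ (Relation.TransGen.single ⟨a.1, rfl, a.2⟩)
    have hfin : ({p : Q.Path x z | ∃ h : x = z, p = h ▸ (@Quiver.Path.nil I Q.toQuiver x)} ∪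
        Set.range fun s : Σ a : {a // Q.tgt a = z}, Q.Path x (Q.src a.1) =>
          @Quiver.Path.cons I Q.toQuiver x (Q.src s.1.1) z s.2 ⟨s.1.1, rfl, s.1.2⟩).Finite := by
      refine Set.Finite.union (Set.Subsingleton.finite ?_) (Set.finite_range _)
      rintro p ⟨h, rfl⟩ q ⟨h', rfl⟩
      rfl
    refine Set.finite_univ_iff.1 (hfin.subset fun p _ => ?_)
    rcases path_cases p with h | ⟨a, q, h⟩
    · exact Or.inl h
    · exact Or.inr ⟨⟨a, q⟩, h.symm⟩

theorem finiteDimensional_proj [Fintype A] [Finite ι] (hQ : Q.Acyclic) (y : ι → I) :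
    FiniteDimensional k (ProjTot k Q y) := by
  have : ∀ x z, Finite (Q.Path x z) := finite_path hQ
  have : ∀ z, FiniteDimensional k ((QRep.proj k Q y).obj z) := fun z =>
    Module.Finite.equiv (projComp k Q y z).symm
  infer_instance

end QAct


/-! ### Indecomposable modules -/

namespace QAct

variable {k : Type u} [Field k] {I A : Type} [Fintype I] {Q : Quiv I A}
  {M N : Type u} [AddCommGroup M] [Module k M] [AddCommGroup N] [Module k N]

theorem isMor_projectionOnto (o : QAct k Q M) {U W : Submodule k M} (h : IsCompl U W)
    (hE : ∀ x, ∀ m ∈ U, o.E x m ∈ U) (ha : ∀ a, ∀ m ∈ U, o.arr a m ∈ U)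
    (hE' : ∀ x, ∀ m ∈ W, o.E x m ∈ W) (ha' : ∀ a, ∀ m ∈ W, o.arr a m ∈ W) :
    IsMor o (o.sub U hE ha) (U.projectionOnto W h) := by
  have key : ∀ (f : M →ₗ[k] M) (hU : ∀ m ∈ U, f m ∈ U) (hW : ∀ m ∈ W, f m ∈ W) (m : M),
      U.projectionOnto W h (f m) = ⟨f (U.projectionOnto W h m), hU _ (Subtype.mem _)⟩ := by
    intro f hU hW m
    have hm : m - U.projectionOnto W h m ∈ W := by
      rw [← Submodule.projectionOnto_apply_eq_zero_iff h, map_sub,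
        Submodule.projectionOnto_apply_left, sub_self]
    have := (Submodule.projectionOnto_apply_eq_zero_iff h).2 (hW _ hm)
    rw [map_sub, map_sub, sub_eq_zero] at this
    rw [this]
    exact Submodule.projectionOnto_apply_left h ⟨_, _⟩
  exact ⟨fun x m => key _ (hE x) (hE' x) m, fun a m => key _ (ha a) (ha' a) m⟩

/-- The module is nonzero and its endomorphism ring is local: every endomorphism is bijective or
nilpotent. -/
structure EndLocal (o : QAct k Q M) : Prop where
  nontrivial : Nontrivial M
  bijective_or_nilpotent : ∀ φ : M →ₗ[k] M, IsMor o o φ → Function.Bijective φ ∨ ∃ n, φ ^ n = 0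

theorem EndLocal.not_both (o : QAct k Q M) [Nontrivial M] {φ : M →ₗ[k] M}
    (h : Function.Injective φ) (n : ℕ) : φ ^ n ≠ 0 := by
  intro h0
  obtain ⟨m, hm⟩ := exists_ne (0 : M)
  have : Function.Injective (φ ^ n) := by
    rw [Module.End.coe_pow]
    exact h.iterate n
  exact hm (this (by rw [h0]; simp))

/-- Every endomorphism of an indecomposable module over an algebraically closed field is a scalar
plus a nilpotent endomorphism. -/
theorem EndLocal.exists_scalar [IsAlgClosed k] [FiniteDimensional k M] {o : QAct k Q M}
    (ho : o.EndLocal) {φ : M →ₗ[k] M} (hφ : IsMor o o φ) :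
    ∃ s : k, ∃ n, (φ - s • LinearMap.id) ^ n = 0 := by
  have := ho.nontrivial
  obtain ⟨s, hs⟩ := Module.End.exists_eigenvalue φ
  refine ⟨s, ((ho.bijective_or_nilpotent _ (hφ.sub ((IsMor.id o).smul s))).resolve_left ?_)⟩
  intro hb
  obtain ⟨v, hv⟩ := hs.exists_hasEigenvector
  refine hv.2 (hb.1 ?_)
  have := hv.apply_eq_smul
  simp [this]

theorem bijective_of_nilpotent {ν : M →ₗ[k] M} {n : ℕ} (hν : ν ^ n = 0) {c : k} (hc : c ≠ 0) :
    Function.Bijective (c • LinearMap.id + ν : M →ₗ[k] M) := by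
  have h1 : IsNilpotent ν := ⟨n, hν⟩
  have h2 : IsUnit (algebraMap k (Module.End k M) c) := (IsUnit.mk0 c hc).map _
  have h3 : IsUnit (algebraMap k (Module.End k M) c + ν) :=
    h1.isUnit_add_left_of_commute h2 ((Algebra.commutes c ν).symm)
  have h4 : algebraMap k (Module.End k M) c = c • LinearMap.id := by
    ext; simp [Module.algebraMap_end_apply]
  rw [h4] at h3
  exact (Module.End.isUnit_iff _).1 h3

end QAct

namespace QRep

open QAct

variable {k : Type u} [Field k] {I A : Type} [Fintype I] [DecidableEq I] {Q : Quiv I A}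

theorem isom_prod_of_isCompl (V : QRep k Q) {U W : Submodule k (∀ x, V.obj x)} (h : IsCompl U W)
    (hE : ∀ x, ∀ m ∈ U, V.act.E x m ∈ U) (ha : ∀ a, ∀ m ∈ U, V.act.arr a m ∈ U)
    (hE' : ∀ x, ∀ m ∈ W, V.act.E x m ∈ W) (ha' : ∀ a, ∀ m ∈ W, V.act.arr a m ∈ W) :
    V.Isom ((V.act.sub U hE ha).toRep.prod (V.act.sub W hE' ha').toRep) := by
  let o₁ := V.act.sub U hE ha
  let o₂ := V.act.sub W hE' ha'
  let r₁ : Hom V o₁.toRep := Hom.ofMor _ ((isMor_toRepEquiv o₁).symm.comp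
    (V.act.isMor_projectionOnto h hE ha hE' ha'))
  let r₂ : Hom V o₂.toRep := Hom.ofMor _ ((isMor_toRepEquiv o₂).symm.comp
    (V.act.isMor_projectionOnto h.symm hE' ha' hE ha))
  have e₁ : ∀ v, r₁.tot v = o₁.toRepEquiv.symm (U.projectionOnto W h v) := fun v =>
    LinearMap.congr_fun (Hom.tot_ofMor _ _) v
  have e₂ : ∀ v, r₂.tot v = o₂.toRepEquiv.symm (W.projectionOnto U h.symm v) := fun v =>
    LinearMap.congr_fun (Hom.tot_ofMor _ _) v
  refine ⟨⟨fun x => (r₁.app x).prod (r₂.app x), fun a => ?_⟩, fun x => ?_, fun x => ?_⟩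
  · exact LinearMap.ext fun v => Prod.ext (LinearMap.congr_fun (r₁.comm a) v)
      (LinearMap.congr_fun (r₂.comm a) v)
  · rw [injective_iff_map_eq_zero]
    intro v hv
    have h1 : r₁.tot (Pi.single x v) = 0 := by
      rw [Hom.tot_single, show r₁.app x v = 0 from congrArg Prod.fst hv, Pi.single_zero]
    have h2 : r₂.tot (Pi.single x v) = 0 := by
      rw [Hom.tot_single, show r₂.app x v = 0 from congrArg Prod.snd hv, Pi.single_zero]
    rw [e₁, LinearEquiv.map_eq_zero_iff, Submodule.projectionOnto_apply_eq_zero_iff] at h1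
    rw [e₂, LinearEquiv.map_eq_zero_iff, Submodule.projectionOnto_apply_eq_zero_iff] at h2
    have := Submodule.disjoint_def.1 h.disjoint _ h2 h1
    simpa using this
  · rintro ⟨a, b⟩
    let v₁ : ∀ x, V.obj x := (o₁.toRepEquiv (Pi.single x a)).1
    let v₂ : ∀ x, V.obj x := (o₂.toRepEquiv (Pi.single x b)).1
    have h1 : r₁.tot (v₁ + v₂) = Pi.single x a := by
      rw [e₁, map_add, Submodule.projectionOnto_apply_left, Submodule.projectionOnto_apply_right,
        add_zero, LinearEquiv.symm_apply_apply]
    have h2 : r₂.tot (v₁ + v₂) = Pi.single x b := by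
      rw [e₂, map_add, Submodule.projectionOnto_apply_right, Submodule.projectionOnto_apply_left,
        zero_add, LinearEquiv.symm_apply_apply]
    refine ⟨(v₁ + v₂) x, Prod.ext ?_ ?_⟩
    · exact (congrFun h1 x).trans (Pi.single_eq_same x a)
    · exact (congrFun h2 x).trans (Pi.single_eq_same x b)

theorem isZero_toRep {M : Type u} [AddCommGroup M] [Module k M] {o : QAct k Q M} :
    o.toRep.IsZero ↔ Subsingleton M := by
  rw [isZero_iff]
  exact o.toRepEquiv.toEquiv.subsingleton_congr

theorem Indecomposable.eq_bot_or_eq_bot {V : QRep k Q} (hV : V.Indecomposable)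
    {U W : Submodule k (∀ x, V.obj x)} (h : IsCompl U W)
    (hE : ∀ x, ∀ m ∈ U, V.act.E x m ∈ U) (ha : ∀ a, ∀ m ∈ U, V.act.arr a m ∈ U)
    (hE' : ∀ x, ∀ m ∈ W, V.act.E x m ∈ W) (ha' : ∀ a, ∀ m ∈ W, V.act.arr a m ∈ W) :
    U = ⊥ ∨ W = ⊥ := by
  rcases hV.2 _ _ (V.isom_prod_of_isCompl h hE ha hE' ha') with h | h
  · rw [isZero_toRep] at h
    exact Or.inl (Submodule.eq_bot_of_subsingleton)
  · rw [isZero_toRep] at h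
    exact Or.inr (Submodule.eq_bot_of_subsingleton)

/-- Fitting's lemma. -/
theorem Indecomposable.endLocal {V : QRep k Q} (hV : V.Indecomposable) (hfin : V.IsFinDim) :
    V.act.EndLocal := by
  have := isFinDim_iff.1 hfin
  refine ⟨?_, fun φ hφ => ?_⟩
  · rw [← not_subsingleton_iff_nontrivial, ← isZero_iff]
    exact hV.1
  · obtain ⟨n, hn, hn0⟩ := ((LinearMap.eventually_isCompl_ker_pow_range_pow φ).and
      (Filter.eventually_gt_atTop 0)).exists
    have hm := hφ.pow n
    rcases hV.eq_bot_or_eq_bot hn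
      (fun x m h => by rw [LinearMap.mem_ker] at h ⊢; rw [hm.E, h, map_zero])
      (fun x m h => by rw [LinearMap.mem_ker] at h ⊢; rw [hm.arr, h, map_zero])
      (by rintro x _ ⟨m, rfl⟩; exact ⟨V.act.E x m, hm.E x m⟩)
      (by rintro x _ ⟨m, rfl⟩; exact ⟨V.act.arr x m, hm.arr x m⟩) with h | h
    · left
      have h1 : Function.Injective φ := by
        have := LinearMap.ker_eq_bot.1 h
        rw [Module.End.coe_pow, ← Nat.succ_pred_eq_of_pos hn0, Function.iterate_succ] at this
        exact this.of_comp
      exact ⟨h1, LinearMap.injective_iff_surjective.1 h1⟩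
    · right
      exact ⟨n, LinearMap.range_eq_bot.1 h⟩

end QRep

/-! ### Adjoint maps between projective modules -/

namespace QAct

variable {k : Type u} [Field k] {I A : Type} [Fintype I] [DecidableEq I] [Fintype A]
  {S : SymQuiver I A} {M N : Type u} [AddCommGroup M] [Module k M] [AddCommGroup N] [Module k N]
  {ι κ μ : Type} [Fintype ι] [Fintype κ] [Fintype μ]

/-- `d' : ⨁ P_{σ (y i)} → ⨁ P_{σ (x j)}` is adjoint to `d : ⨁ P_{x j} → ⨁ P_{y i}`: the transpose,
with respect to any invariant pairing, of the map that `d` induces on `Hom(⨁ P_{y i}, M)` is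
the map that `d'` induces on `Hom(⨁ P_{σ (x j)}, N)`. (In matrix terms, `d'` is the transposed
matrix with the anti-involution of the path algebra applied to the entries.) -/
def IsAdj (S : SymQuiver I A) {x x' : κ → I} {y y' : ι → I}
    (d : ProjTot k S.toQuiv x →ₗ[k] ProjTot k S.toQuiv y)
    (d' : ProjTot k S.toQuiv y' →ₗ[k] ProjTot k S.toQuiv x') : Prop :=
  ∀ ⦃M N : Type u⦄ [AddCommGroup M] [Module k M] [AddCommGroup N] [Module k N]
    (p : QAct k S.toQuiv M) (q : QAct k S.toQuiv N) (b : M →ₗ[k] N →ₗ[k] k),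
    IsPairing S p q b → ∀ (α : ProjTot k S.toQuiv y →ₗ[k] M) (β : ProjTot k S.toQuiv x' →ₗ[k] N),
      IsMor (pact k S.toQuiv y) p α → IsMor (pact k S.toQuiv x') q β →
      ∑ j, b (α (d (pgen k S.toQuiv x j))) (β (pgen k S.toQuiv x' j)) =
        ∑ i, b (α (pgen k S.toQuiv y i)) (β (d' (pgen k S.toQuiv y' i)))

variable {x x' : κ → I} {y y' : ι → I} {z z' : μ → I}
  {d : ProjTot k S.toQuiv x →ₗ[k] ProjTot k S.toQuiv y}
  {d' d'' : ProjTot k S.toQuiv y' →ₗ[k] ProjTot k S.toQuiv x'}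

namespace IsAdj

theorem symm (h : IsAdj S d d') : IsAdj S d' d := by
  intro M N _ _ _ _ p q b hb α β hα hβ
  exact (h q p b.flip hb.flip β α hβ hα).symm

theorem add {e : ProjTot k S.toQuiv x →ₗ[k] ProjTot k S.toQuiv y}
    {e' : ProjTot k S.toQuiv y' →ₗ[k] ProjTot k S.toQuiv x'} (h : IsAdj S d d')
    (h' : IsAdj S e e') : IsAdj S (d + e) (d' + e') := by
  intro M N _ _ _ _ p q b hb α β hα hβ
  simp only [LinearMap.add_apply, map_add, Finset.sum_add_distrib]
  rw [h p q b hb α β hα hβ, h' p q b hb α β hα hβ]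

theorem smul (c : k) (h : IsAdj S d d') : IsAdj S (c • d) (c • d') := by
  intro M N _ _ _ _ p q b hb α β hα hβ
  simp only [LinearMap.smul_apply, map_smul, ← Finset.smul_sum]
  rw [h p q b hb α β hα hβ]

theorem id : IsAdj S (LinearMap.id : ProjTot k S.toQuiv x →ₗ[k] ProjTot k S.toQuiv x)
    (LinearMap.id : ProjTot k S.toQuiv x' →ₗ[k] ProjTot k S.toQuiv x') := by
  intro M N _ _ _ _ p q b hb α β hα hβ
  rfl

theorem comp {e : ProjTot k S.toQuiv z →ₗ[k] ProjTot k S.toQuiv x}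
    {e' : ProjTot k S.toQuiv x' →ₗ[k] ProjTot k S.toQuiv z'} (h : IsAdj S d d')
    (h' : IsAdj S e e') (hd : IsMor (pact k _ x) (pact k _ y) d)
    (he' : IsMor (pact k _ x') (pact k _ z') e') : IsAdj S (d ∘ₗ e) (e' ∘ₗ d') := by
  intro M N _ _ _ _ p q b hb α β hα hβ
  exact (h' p q b hb (α ∘ₗ d) β (hα.comp hd) hβ).trans (h p q b hb α (β ∘ₗ e') hα (hβ.comp he'))

theorem unique [DecidableEq ι] (hy : ∀ i, y' i = S.σ (y i)) (h : IsAdj S d d')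
    (h' : IsAdj S d d'')
    (hd' : IsMor (pact k _ y') (pact k _ x') d') (hd'' : IsMor (pact k _ y') (pact k _ x') d'') :
    d' = d'' := by
  refine IsMor.proj_ext hd' hd'' fun i => ?_
  have key : ∀ ξ : Module.Dual k (ProjTot k S.toQuiv x'), ∀ d₀ : ProjTot k S.toQuiv y' →ₗ[k] _,
      IsMor (pact k _ y') (pact k _ x') d₀ → IsAdj S d d₀ →
      ξ (d₀ (pgen k S.toQuiv y' i)) = ∑ j, ((pact k S.toQuiv x').dual S).lift y (Pi.single i ξ)
        (d (pgen k S.toQuiv x j)) (pgen k S.toQuiv x' j) := by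
    intro ξ d₀ hd₀ h₀
    rw [show ∑ j, ((pact k S.toQuiv x').dual S).lift y (Pi.single i ξ)
        (d (pgen k S.toQuiv x j)) (pgen k S.toQuiv x' j) = _ from
      h₀ _ _ _ (isPairing_id (pact k S.toQuiv x')) _ LinearMap.id
        (((pact k S.toQuiv x').dual S).isMor_lift y (Pi.single i ξ)) (IsMor.id _),
      Finset.sum_eq_single i]
    · rw [lift_pgen, Pi.single_eq_same]
      simp only [LinearMap.id_apply]
      change _ = ξ ((pact k S.toQuiv x').E (S.σ (y i)) _)
      rw [← hy, hd₀.E_pgen]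
    · intro j _ hj
      rw [lift_pgen, Pi.single_eq_of_ne hj]
      simp
    · simp
  rw [← sub_eq_zero]
  refine (Module.forall_dual_apply_eq_zero_iff k _).1 fun ξ => ?_
  rw [map_sub, key ξ d' hd' h, key ξ d'' hd'' h', sub_self]

end IsAdj

theorem lift_add (o : QAct k S.toQuiv M) (v w : ι → M) : o.lift y (v + w) = o.lift y v + o.lift y w :=
  IsMor.proj_ext (o.isMor_lift _ _) ((o.isMor_lift _ _).add (o.isMor_lift _ _)) fun i => by
    simp [lift_pgen]

theorem lift_smul (o : QAct k S.toQuiv M) (c : k) (w : ι → M) : o.lift y (c • w) = c • o.lift y w :=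
  IsMor.proj_ext (o.isMor_lift _ _) ((o.isMor_lift _ _).smul c) fun i => by
    simp [lift_pgen]

theorem sum_lift_single [DecidableEq ι] {o : QAct k S.toQuiv M}
    {f : ProjTot k S.toQuiv y →ₗ[k] M} (hf : IsMor (pact k _ y) o f) (v : ProjTot k S.toQuiv y) :
    ∑ i, o.lift y (Pi.single i (f (pgen k S.toQuiv y i))) v = f v := by
  have : ∑ i, o.lift y (Pi.single i (f (pgen k S.toQuiv y i))) = f := by
    have hs : IsMor (pact k _ y) o (∑ i, o.lift y (Pi.single i (f (pgen k S.toQuiv y i)))) := by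
      refine ⟨fun x v => ?_, fun a v => ?_⟩
      · simp only [LinearMap.sum_apply, map_sum, (o.isMor_lift _ _).E]
      · simp only [LinearMap.sum_apply, map_sum, (o.isMor_lift _ _).arr]
    refine IsMor.proj_ext hs hf fun j => ?_
    rw [LinearMap.sum_apply, Finset.sum_eq_single j]
    · rw [lift_pgen, Pi.single_eq_same, hf.E_pgen]
    · intro i _ hi
      rw [lift_pgen, Pi.single_eq_of_ne hi.symm, map_zero]
    · simp
  rw [← LinearMap.sum_apply, this]

theorem exists_isAdj [DecidableEq ι] (hQ : S.toQuiv.Acyclic) (hx : ∀ j, x' j = S.σ (x j))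
    (hy : ∀ i, y' i = S.σ (y i))
    (hd : IsMor (pact k _ x) (pact k _ y) d) :
    ∃ d' : ProjTot k S.toQuiv y' →ₗ[k] ProjTot k S.toQuiv x',
      IsMor (pact k _ y') (pact k _ x') d' ∧ IsAdj S d d' := by
  have := finiteDimensional_proj (k := k) hQ x'
  let P := pact k S.toQuiv x'
  -- The value of `d'` on the `i`-th generator is read off from the pairing with the dual of
  -- the target: it is a functional on that dual, hence evaluation at a vector.
  have h1 : ∀ i, ∃ w : ProjTot k S.toQuiv x', ∀ ξ : Module.Dual k (ProjTot k S.toQuiv x'),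
      ∑ j, (P.dual S).lift y (Pi.single i ξ) (d (pgen k S.toQuiv x j)) (pgen k S.toQuiv x' j)
        = ξ w := by
    intro i
    let F : Module.Dual k (Module.Dual k (ProjTot k S.toQuiv x')) :=
      { toFun := fun ξ => ∑ j, (P.dual S).lift y (Pi.single i ξ) (d (pgen k S.toQuiv x j))
          (pgen k S.toQuiv x' j)
        map_add' := fun ξ ζ => by
          rw [← Finset.sum_add_distrib]
          refine Finset.sum_congr rfl fun j _ => ?_
          rw [Pi.single_add, lift_add]; rfl
        map_smul' := fun c ξ => by
          rw [RingHom.id_apply, Finset.smul_sum]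
          refine Finset.sum_congr rfl fun j _ => ?_
          rw [Pi.single_smul, lift_smul]; rfl }
    obtain ⟨w, hw⟩ := (Module.evalEquiv k (ProjTot k S.toQuiv x')).surjective F
    exact ⟨w, fun ξ => (LinearMap.congr_fun hw ξ).symm⟩
  choose w hw using h1
  refine ⟨P.lift y' w, P.isMor_lift y' w, ?_⟩
  intro M N _ _ _ _ p q b hb α β hα hβ
  have hc : IsPairing S p P (b.compl₂ β) := hb.comp₂ hβ
  have hγ : IsMor (pact k _ y) (P.dual S) (b.compl₂ β ∘ₗ α) := hc.isMor_dual.comp hα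
  have h2 : ∀ j, b (α (d (pgen k S.toQuiv x j))) (β (pgen k S.toQuiv x' j)) =
      ∑ i, (P.dual S).lift y (Pi.single i ((b.compl₂ β ∘ₗ α) (pgen k S.toQuiv y i)))
        (d (pgen k S.toQuiv x j)) (pgen k S.toQuiv x' j) := by
    intro j
    rw [← LinearMap.sum_apply, sum_lift_single hγ]
    rfl
  simp only [h2]
  rw [Finset.sum_comm]
  refine Finset.sum_congr rfl fun i _ => ?_
  rw [hw, lift_pgen, hy, hβ.E, ← hb.E, hα.E_pgen]
  rfl

/-- Solvability of `e = f ∘ d` is tested by the morphisms on the dual side that kill the adjoint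
of `d`. -/
theorem exists_factor_or_exists_dual [DecidableEq ι] [DecidableEq κ] {p : QAct k S.toQuiv M}
    {q : QAct k S.toQuiv N} [FiniteDimensional k M] [FiniteDimensional k N]
    (hx : ∀ j, x' j = S.σ (x j)) (hy : ∀ i, y' i = S.σ (y i))
    (hd : IsMor (pact k _ x) (pact k _ y) d) (hd' : IsMor (pact k _ y') (pact k _ x') d')
    (hadj : IsAdj S d d') {b : M →ₗ[k] N →ₗ[k] k} (hb : IsPairing S p q b) (hn : b.Nondegenerate)
    {e : ProjTot k S.toQuiv x →ₗ[k] M} (he : IsMor (pact k _ x) p e) :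
    (∃ f : ProjTot k S.toQuiv y →ₗ[k] M, IsMor (pact k _ y) p f ∧ f ∘ₗ d = e) ∨
    ∃ u : ProjTot k S.toQuiv x' →ₗ[k] N, IsMor (pact k _ x') q u ∧ u ∘ₗ d' = 0 ∧
      ∑ j, b (e (pgen k S.toQuiv x j)) (u (pgen k S.toQuiv x' j)) ≠ 0 := by
  -- In terms of the images of the generators, `f ↦ f ∘ d` is the linear map `R`; if `e` is not in
  -- its range, a functional that kills the range but not `e` is represented by some `u`.
  let R : (ι → M) →ₗ[k] (κ → M) :=
    { toFun := fun w j => p.lift y w (d (pgen k S.toQuiv x j))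
      map_add' := fun v w => by funext j; rw [lift_add]; rfl
      map_smul' := fun c w => by funext j; rw [lift_smul]; rfl }
  by_cases hmem : (fun j => e (pgen k S.toQuiv x j)) ∈ LinearMap.range R
  · left
    obtain ⟨w, hw⟩ := hmem
    exact ⟨p.lift y w, p.isMor_lift y w, IsMor.proj_ext ((p.isMor_lift y w).comp hd) he
      fun j => congrFun hw j⟩
  · right
    obtain ⟨F, hF, hR⟩ := Submodule.exists_le_ker_of_notMem hmem
    have hF' : ∀ v, F v = ∑ j, F (Pi.single j (v j)) := by
      intro v
      conv_lhs => rw [← Finset.univ_sum_single v]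
      rw [map_sum]
    have h1 : ∀ j, ∃ n, ∀ m, F (Pi.single j m) = b m n := by
      intro j
      obtain ⟨n, hn⟩ := exists_eq_of_nondegenerate (nondegenerate_flip hn)
        (F ∘ₗ LinearMap.single k (fun _ : κ => M) j)
      exact ⟨n, fun m => (LinearMap.congr_fun hn m).symm⟩
    choose u hu using h1
    have key : ∀ f : ProjTot k S.toQuiv x →ₗ[k] M, IsMor (pact k _ x) p f →
        F (fun j => f (pgen k S.toQuiv x j)) = ∑ j, b (f (pgen k S.toQuiv x j))
          (q.lift x' u (pgen k S.toQuiv x' j)) := by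
      intro f hf
      rw [hF']
      refine Finset.sum_congr rfl fun j _ => ?_
      rw [hu, lift_pgen, hx, ← hb.E, hf.E_pgen]
    refine ⟨q.lift x' u, q.isMor_lift x' u, ?_, ?_⟩
    · refine IsMor.proj_ext ((q.isMor_lift x' u).comp hd') IsMor.zero fun i => ?_
      refine hn.2 _ fun m => ?_
      have hm := p.isMor_lift y (Pi.single i m)
      have h2 := hadj p q b hb _ _ hm (q.isMor_lift x' u)
      have h3 := key _ (hm.comp hd)
      simp only [LinearMap.comp_apply] at h3
      rw [← h3] at h2
      have h4 : F (fun j => p.lift y (Pi.single i m) (d (pgen k S.toQuiv x j))) = 0 :=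
        hR ⟨Pi.single i m, rfl⟩
      rw [h4, Finset.sum_eq_single i] at h2
      · rw [lift_pgen, Pi.single_eq_same, hb.E, ← hy] at h2
        have h5 := ((q.isMor_lift x' u).comp hd').E_pgen i
        rw [LinearMap.comp_apply] at h5
        rw [h5] at h2
        exact h2.symm
      · intro j _ hj
        rw [lift_pgen, Pi.single_eq_of_ne hj]
        simp
      · simp
    · rw [← key _ he]
      exact hF

end QAct


/-! ### Almost split sequences from the dual of a module to the module -/

namespace QAct

variable {k : Type u} [Field k] {I A : Type} [Fintype I] {S : SymQuiver I A}
  {M N L : Type u} [AddCommGroup M] [Module k M] [AddCommGroup N] [Module k N]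
  [AddCommGroup L] [Module k L]
  {o : QAct k S.toQuiv M} {z : QAct k S.toQuiv N} {l : QAct k S.toQuiv L}

theorem IsMor.dualMap {h : M →ₗ[k] N} (hh : IsMor o z h) :
    IsMor (z.dual S) (o.dual S) h.dualMap :=
  ⟨fun x ξ => by ext m; exact (congrArg ξ (hh.E (S.σ x) m)).symm,
    fun a ξ => by ext m; exact (congrArg (fun n => -ξ n) (hh.arr (S.σ₁ a) m)).symm⟩

theorem IsMor.exists_transpose [FiniteDimensional k N] {r : Module.Dual k N →ₗ[k] Module.Dual k M}
    (hr : IsMor (z.dual S) (o.dual S) r) :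
    ∃ s : M →ₗ[k] N, IsMor o z s ∧ ∀ ξ m, ξ (s m) = r ξ m := by
  obtain ⟨s, hs, h⟩ := hr.isPairing.flip.exists_eval
  exact ⟨s, hs, fun ξ m => h m ξ⟩

/-- `0 → ∇M → N → M → 0` is a nonsplit exact sequence whose first map is left almost split. -/
structure IsLeftAS (S : SymQuiver I A) (o : QAct k S.toQuiv M) (z : QAct k S.toQuiv N)
    (f : Module.Dual k M →ₗ[k] N) (g : N →ₗ[k] M) : Prop where
  mor_f : IsMor (o.dual S) z f
  mor_g : IsMor z o g
  inj : Function.Injective f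
  surj : Function.Surjective g
  exact : LinearMap.range f = LinearMap.ker g
  not_section : ¬ ∃ r, IsMor z (o.dual S) r ∧ r ∘ₗ f = LinearMap.id
  not_retraction : ¬ ∃ s, IsMor o z s ∧ g ∘ₗ s = LinearMap.id
  left : ∀ {L : Type u} [AddCommGroup L] [Module k L] [FiniteDimensional k L]
    (l : QAct k S.toQuiv L) (h : Module.Dual k M →ₗ[k] L), IsMor (o.dual S) l h →
    (¬ ∃ r, IsMor l (o.dual S) r ∧ r ∘ₗ h = LinearMap.id) → ∃ h', IsMor z l h' ∧ h' ∘ₗ f = h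

/-- `0 → ∇M → N → M → 0` is an almost split sequence. -/
structure IsAS (S : SymQuiver I A) (o : QAct k S.toQuiv M) (z : QAct k S.toQuiv N)
    (f : Module.Dual k M →ₗ[k] N) (g : N →ₗ[k] M) : Prop extends IsLeftAS S o z f g where
  right : ∀ {L : Type u} [AddCommGroup L] [Module k L] [FiniteDimensional k L]
    (l : QAct k S.toQuiv L) (h : L →ₗ[k] M), IsMor l o h →
    (¬ ∃ s, IsMor o l s ∧ h ∘ₗ s = LinearMap.id) → ∃ h', IsMor l z h' ∧ g ∘ₗ h' = h

namespace IsLeftAS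

variable {f : Module.Dual k M →ₗ[k] N} {g : N →ₗ[k] M}

theorem g_f (h : IsLeftAS S o z f g) (ξ : Module.Dual k M) : g (f ξ) = 0 := by
  have : f ξ ∈ LinearMap.ker g := h.exact ▸ ⟨ξ, rfl⟩
  exact this

theorem exists_of_g (h : IsLeftAS S o z f g) {n : N} (hn : g n = 0) : ∃ ξ, f ξ = n := by
  have : n ∈ LinearMap.range f := h.exact ▸ hn
  exact this

theorem finrank_eq [FiniteDimensional k M] [FiniteDimensional k N] (h : IsLeftAS S o z f g) :
    Module.finrank k N = 2 * Module.finrank k M := by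
  have h1 := LinearMap.finrank_range_add_finrank_ker g
  rw [← h.exact, LinearMap.finrank_range_of_inj h.inj, Subspace.dual_finrank_eq,
    LinearMap.range_eq_top.2 h.surj, finrank_top] at h1
  omega

/-- The middle term carries an invariant bilinear form that induces the evaluation pairing. -/
theorem exists_pairing [FiniteDimensional k M] [FiniteDimensional k N] (h : IsLeftAS S o z f g) :
    ∃ b : N →ₗ[k] N →ₗ[k] k, IsPairing S z z b ∧ ∀ ξ n, b (f ξ) n = ξ (g n) := by
  -- The transpose of `g` is not split since `g` is not, so it extends along `f`.
  obtain ⟨b, hb, hbf⟩ := h.left (z.dual S) g.dualMap h.mor_g.dualMap (by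
    rintro ⟨r, hr, hrg⟩
    obtain ⟨s, hs, hs'⟩ := hr.exists_transpose
    refine h.not_retraction ⟨s, hs, LinearMap.ext fun m => ?_⟩
    rw [← sub_eq_zero]
    refine (Module.forall_dual_apply_eq_zero_iff k _).1 fun ξ => ?_
    have h1 := hs' (g.dualMap ξ) m
    have h2 := LinearMap.congr_fun (LinearMap.congr_fun hrg ξ) m
    rw [map_sub, sub_eq_zero]
    exact h1.trans h2)
  exact ⟨b, hb.isPairing, fun ξ n => LinearMap.congr_fun (LinearMap.congr_fun hbf ξ) n⟩

/-- The other half of such a form is the evaluation pairing twisted by an endomorphism. -/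
theorem exists_endo [FiniteDimensional k M] (h : IsLeftAS S o z f g) {b : N →ₗ[k] N →ₗ[k] k}
    (hb : IsPairing S z z b) (hbf : ∀ ξ n, b (f ξ) n = ξ (g n)) :
    ∃ φ : M →ₗ[k] M, IsMor o o φ ∧ ∀ n ξ, b n (f ξ) = ξ (φ (g n)) := by
  obtain ⟨t, ht, htb⟩ := (hb.comp₂ h.mor_f).exists_eval
  obtain ⟨φ, hφ, hφg⟩ := h.mor_g.exists_factor h.surj ht (by
    intro n hn
    obtain ⟨ζ, rfl⟩ := h.exists_of_g hn
    refine (Module.forall_dual_apply_eq_zero_iff k _).1 fun ξ => ?_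
    rw [htb]
    change b (f ζ) (f ξ) = 0
    rw [hbf, h.g_f, map_zero])
  refine ⟨φ, hφ, fun n ξ => ?_⟩
  have := LinearMap.congr_fun hφg n
  rw [LinearMap.comp_apply] at this
  rw [this, htb]
  rfl

/-- The `η`-symmetrization of the form is nondegenerate unless the scalar part of the twisting
endomorphism is `-η`. -/
theorem exists_form [FiniteDimensional k M] [FiniteDimensional k N] (h : IsLeftAS S o z f g)
    {b : N →ₗ[k] N →ₗ[k] k} (hb : IsPairing S z z b) (hbf : ∀ ξ n, b (f ξ) n = ξ (g n))
    {φ : M →ₗ[k] M} (hbφ : ∀ n ξ, b n (f ξ) = ξ (φ (g n))) {s : k} {n : ℕ}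
    (hφ : IsMor o o φ) (hs : (φ - s • LinearMap.id) ^ n = 0) {η : k} (hη : η * η = 1)
    (hsη : s ≠ -η) :
    ∃ (ψ : N →ₗ[k] N →ₗ[k] k) (χ : M →ₗ[k] M), IsPairing S z z ψ ∧ ψ.Nondegenerate ∧
      (∀ v w, ψ v w = η * ψ w v) ∧ IsMor o o χ ∧ Function.Bijective χ ∧
      ∀ ξ n, ψ (f ξ) n = ξ (χ (g n)) := by
  have hsymm : ∀ v w, (b + η • b.flip) v w = η * (b + η • b.flip) w v := by
    intro v w
    simp only [LinearMap.add_apply, LinearMap.smul_apply, LinearMap.flip_apply, smul_eq_mul]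
    rw [mul_add, ← mul_assoc, hη, one_mul, add_comm]
  have hfz : ∀ ξ w, (b + η • b.flip) (f ξ) w = ξ (g w + η • φ (g w)) := by
    intro ξ w
    simp only [LinearMap.add_apply, LinearMap.smul_apply, LinearMap.flip_apply, smul_eq_mul]
    rw [hbf, hbφ, map_add, map_smul, smul_eq_mul]
  have hη0 : η ≠ 0 := fun h0 => by simp [h0] at hη
  have hbij : Function.Bijective ((1 + η * s) • LinearMap.id + η • (φ - s • LinearMap.id) :
      M →ₗ[k] M) := by
    refine bijective_of_nilpotent (n := n) ?_ ?_
    · rw [smul_pow, hs, smul_zero]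
    · intro h0
      refine hsη ?_
      have : η * (1 + η * s) = 0 := by rw [h0, mul_zero]
      rw [mul_add, ← mul_assoc, hη, one_mul, mul_one] at this
      exact eq_neg_of_add_eq_zero_right this
  have hφ' : ∀ m, m + η • φ m = ((1 + η * s) • LinearMap.id + η • (φ - s • LinearMap.id) :
      M →ₗ[k] M) m := by
    intro m
    simp only [LinearMap.add_apply, LinearMap.smul_apply, LinearMap.sub_apply, LinearMap.id_apply,
      add_smul, one_smul, smul_sub, mul_smul]
    abel
  have key : ∀ w, (∀ v, (b + η • b.flip) v w = 0) → w = 0 := by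
    intro w hw
    have h1 : g w = 0 := by
      apply hbij.1
      rw [map_zero, ← hφ']
      refine (Module.forall_dual_apply_eq_zero_iff k _).1 fun ξ => ?_
      rw [← hfz, hw]
    obtain ⟨ξ, rfl⟩ := h.exists_of_g h1
    have h2 : ξ = 0 := by
      refine LinearMap.ext fun m => ?_
      obtain ⟨m', rfl⟩ := hbij.2 m
      obtain ⟨v, rfl⟩ := h.surj m'
      rw [← hφ', ← hfz, hsymm, hw, mul_zero, LinearMap.zero_apply]
    rw [h2, map_zero]
  refine ⟨b + η • b.flip, _, hb.add (hb.flip.smul η), ⟨fun w hw => key w fun v => ?_, key⟩, hsymm,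
    ((IsMor.id o).smul _).add ((hφ.sub ((IsMor.id o).smul s)).smul η), hbij, fun ξ n => ?_⟩
  · rw [hsymm, hw, mul_zero]
  · rw [hfz, hφ']

end IsLeftAS

/-- A direct summand of the middle term of half the dimension is impossible. -/
theorem IsAS.false_of_summand [FiniteDimensional k M] [FiniteDimensional k N]
    {f : Module.Dual k M →ₗ[k] N} {g : N →ₗ[k] M} (h : IsAS S o z f g)
    (ho : o.EndLocal) {X X' : Submodule k N} (hX : IsCompl X X')
    (hd : Module.finrank k X = Module.finrank k M)
    (hE : ∀ x, ∀ m ∈ X, z.E x m ∈ X) (ha : ∀ a, ∀ m ∈ X, z.arr a m ∈ X)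
    (hE' : ∀ x, ∀ m ∈ X', z.E x m ∈ X') (ha' : ∀ a, ∀ m ∈ X', z.arr a m ∈ X') : False := by
  let j := z.sub X hE ha
  have hj : IsMor j z X.subtype := z.isMor_subtype X hE ha
  let gX : X →ₗ[k] M := g ∘ₗ X.subtype
  have hgX : IsMor j o gX := h.mor_g.comp hj
  -- If `gX` is neither, its image is a proper submodule and lifts along `g` through some `t`; the
  -- difference between the inclusion of the summand and `t ∘ gX` lands in `∇M`, and composing it
  -- with the projection gives an endomorphism of `∇M` that fixes a nonzero vector of the kernel.
  -- It is not nilpotent, hence bijective, and `f` splits.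
  have key : Function.Injective gX ∨ Function.Surjective gX := by
    by_contra! hcon
    obtain ⟨hni, hns⟩ := hcon
    let R := LinearMap.range gX
    have hRE : ∀ x, ∀ m ∈ R, o.E x m ∈ R := by
      rintro x _ ⟨m, rfl⟩
      exact ⟨_, hgX.E x m⟩
    have hRa : ∀ a, ∀ m ∈ R, o.arr a m ∈ R := by
      rintro x _ ⟨m, rfl⟩
      exact ⟨_, hgX.arr x m⟩
    obtain ⟨t, ht, hgt⟩ := h.right (o.sub R hRE hRa) R.subtype (o.isMor_subtype R hRE hRa) (by
      rintro ⟨s, -, hs⟩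
      refine hns fun m => ?_
      have := (s m).2
      have h2 : ((s m : R) : M) = m := LinearMap.congr_fun hs m
      rw [h2] at this
      exact this)
    have hgt' : ∀ r : R, g (t r) = r := fun r => LinearMap.congr_fun hgt r
    have hgR : IsMor j (o.sub R hRE hRa) gX.rangeRestrict :=
      ⟨fun x m => Subtype.ext (hgX.E x m), fun a m => Subtype.ext (hgX.arr a m)⟩
    obtain ⟨r, hr, hfr⟩ := h.mor_f.exists_lift h.inj (hj.sub (ht.comp hgR)) (by
      intro x
      rw [h.exact, LinearMap.mem_ker, LinearMap.sub_apply, map_sub, LinearMap.comp_apply, hgt',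
        sub_eq_zero]
      rfl)
    let π := X.projectionOnto X' hX
    have hπ : IsMor z j π := z.isMor_projectionOnto hX hE ha hE' ha'
    have hψ : IsMor (o.dual S) (o.dual S) (r ∘ₗ π ∘ₗ f) := hr.comp (hπ.comp h.mor_f)
    rw [injective_iff_map_eq_zero] at hni
    push Not at hni
    obtain ⟨x, hx0, hx⟩ := hni
    obtain ⟨ξ, hξ⟩ := h.exists_of_g hx0
    have hfix : (r ∘ₗ π ∘ₗ f) ξ = ξ := by
      apply h.inj
      have h1 : π (f ξ) = x := by
        rw [hξ]
        exact Submodule.projectionOnto_apply_left hX x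
      have h2 := LinearMap.congr_fun hfr x
      rw [LinearMap.comp_apply, LinearMap.comp_apply, h1]
      rw [LinearMap.comp_apply, LinearMap.sub_apply, LinearMap.comp_apply,
        show gX.rangeRestrict x = 0 from Subtype.ext hx0, map_zero, sub_zero] at h2
      rw [h2, hξ]
    obtain ⟨ψ, hψm, hψt⟩ := hψ.exists_transpose
    rcases ho.bijective_or_nilpotent ψ hψm with hb | ⟨n, hn⟩
    · obtain ⟨ψ', hψ', hl, hr'⟩ := hψm.ofBijective hb
      refine h.not_section ⟨ψ'.dualMap ∘ₗ r ∘ₗ π, hψ'.dualMap.comp (hr.comp hπ), ?_⟩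
      refine LinearMap.ext fun ζ => LinearMap.ext fun m => ?_
      change (r ∘ₗ π ∘ₗ f) ζ (ψ' m) = ζ m
      rw [← hψt]
      exact congrArg ζ (LinearMap.congr_fun hr' m)
    · have : ∀ i m, ξ ((ψ ^ i) m) = ξ m := by
        intro i
        induction i with
        | zero => intro m; rfl
        | succ i ih =>
          intro m
          rw [pow_succ', Module.End.mul_apply, hψt, hfix, ih]
      have hξ0 : ξ = 0 := by
        refine LinearMap.ext fun m => ?_
        rw [← this n, hn]
        simp
      rw [hξ0, map_zero] at hξ
      exact hx (Subtype.ext hξ.symm)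
  have hbij : Function.Bijective gX := by
    have := LinearMap.injective_iff_surjective_of_finrank_eq_finrank (f := gX) hd
    tauto
  obtain ⟨s, hs, -, hs'⟩ := hgX.ofBijective hbij
  exact h.not_retraction ⟨X.subtype ∘ₗ s, hj.comp hs, hs'⟩

/-- Generalized eigenspaces of a skew-adjoint operator are orthogonal unless the eigenvalues are
opposite. -/
theorem apply_eq_zero_of_skewAdjoint [FiniteDimensional k N] {ψ : N →ₗ[k] N →ₗ[k] k}
    {h : N →ₗ[k] N} (hh : ∀ v w, ψ (h v) w = -ψ v (h w)) {μ ν : k} (hμν : μ ≠ -ν) {v w : N}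
    (hv : v ∈ Module.End.maxGenEigenspace h μ) (hw : w ∈ Module.End.maxGenEigenspace h ν) :
    ψ v w = 0 := by
  obtain ⟨n, hn⟩ := (Module.End.mem_maxGenEigenspace h μ v).1 hv
  have h1 : ∀ v w, ψ ((h - μ • (1 : Module.End k N)) v) w =
      -ψ v ((h - (-μ) • (1 : Module.End k N)) w) := by
    intro v w
    simp [hh]
    ring
  -- So `(h - μ) ^ n` moves across the form to `(h + μ) ^ n` up to sign, and the latter is invertible
  -- on the generalized eigenspace of `ν`.
  have h2 : ∀ (n : ℕ) v w, ψ (((h - μ • (1 : Module.End k N)) ^ n) v) w =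
      (-1) ^ n * ψ v (((h - (-μ) • (1 : Module.End k N)) ^ n) w) := by
    intro n
    induction n with
    | zero => intro v w; simp
    | succ n ih =>
      intro v w
      rw [pow_succ, Module.End.mul_apply, ih, h1, pow_succ' (h - _) n, Module.End.mul_apply,
        pow_succ (-1 : k) n]
      ring
  let W := Module.End.maxGenEigenspace h ν
  let T := (h - (-μ) • (1 : Module.End k N)) ^ n
  have hT : ∀ w ∈ W, T w ∈ W := by
    refine Module.End.mapsTo_maxGenEigenspace_of_comm (f := h) (g := T) ?_ ν
    exact ((Commute.refl h).sub_right ((Commute.one_right h).smul_right _)).pow_right n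
  have hinj : Function.Injective (T.restrict hT) := by
    rw [injective_iff_map_eq_zero]
    rintro ⟨w, hw⟩ h0
    have h0' : T w = 0 := congrArg Subtype.val h0
    have hmem : w ∈ Module.End.maxGenEigenspace h (-μ) :=
      (Module.End.mem_maxGenEigenspace h (-μ) w).2 ⟨n, h0'⟩
    have hdis := (Module.End.independent_maxGenEigenspace h).pairwiseDisjoint
      (show -μ ≠ ν from fun h' => hμν (by rw [← h', neg_neg]))
    exact Subtype.ext (Submodule.disjoint_def.1 hdis w hmem hw)
  obtain ⟨⟨w', hw'⟩, he⟩ := LinearMap.injective_iff_surjective.1 hinj ⟨w, hw⟩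
  have he' : T w' = w := congrArg Subtype.val he
  have h3 := h2 n v w'
  rw [hn, map_zero, LinearMap.zero_apply] at h3
  have h4 : ψ v (T w') = 0 := (mul_eq_zero.1 h3.symm).resolve_left (by simp)
  rwa [he'] at h4

theorem finrank_le_of_isotropic [FiniteDimensional k N] {ψ : N →ₗ[k] N →ₗ[k] k}
    (hψ : ψ.Nondegenerate) {X X' : Submodule k N} (hX : IsCompl X X')
    (hi : ∀ v ∈ X, ∀ w ∈ X, ψ v w = 0) :
    Module.finrank k X ≤ Module.finrank k X' := by
  rw [← Subspace.dual_finrank_eq (K := k) (V := X')]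
  refine LinearMap.finrank_le_finrank_of_injective
    (f := (X'.subtype.dualMap ∘ₗ ψ ∘ₗ X.subtype : X →ₗ[k] Module.Dual k X')) ?_
  rw [injective_iff_map_eq_zero]
  intro v hv
  refine Subtype.ext (hψ.1 _ fun w => ?_)
  obtain ⟨a, ha, b, hb, rfl⟩ := Submodule.mem_sup.1
    (show w ∈ X ⊔ X' from hX.sup_eq_top ▸ Submodule.mem_top)
  rw [map_add, hi _ v.2 a ha, zero_add]
  exact LinearMap.congr_fun hv ⟨b, hb⟩

theorem maxGenEigenspace_zero_of_injective {t : N →ₗ[k] N} (hinj : Function.Injective t) :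
    Module.End.maxGenEigenspace t 0 = ⊥ := by
  rw [eq_bot_iff]
  intro v hv
  obtain ⟨n, hn⟩ := (Module.End.mem_maxGenEigenspace t 0 v).1 hv
  rw [zero_smul, sub_zero, Module.End.coe_pow] at hn
  exact (Submodule.mem_bot k).2 (hinj.iterate n (hn.trans (Function.iterate_fixed t.map_zero n).symm))

/-- The sum of the generalized eigenspaces for the eigenvalues in `T`. -/
def eigenSum (t : N →ₗ[k] N) (T : Set k) : Submodule k N :=
  ⨆ μ ∈ T, Module.End.maxGenEigenspace t μ

theorem le_eigenSum (t : N →ₗ[k] N) {T : Set k} {μ : k} (h : μ ∈ T) :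
    Module.End.maxGenEigenspace t μ ≤ eigenSum t T :=
  le_biSup (fun μ => Module.End.maxGenEigenspace t μ) h

theorem isCompl_eigenSum [IsAlgClosed k] [FiniteDimensional k N] (t : N →ₗ[k] N) (T : Set k) :
    IsCompl (eigenSum t T) (eigenSum t Tᶜ) := by
  constructor
  · exact (Module.End.independent_maxGenEigenspace t).disjoint_biSup_biSup disjoint_compl_right
  · rw [codisjoint_iff, eq_top_iff, ← Module.End.iSup_maxGenEigenspace_eq_top t]
    refine iSup_le fun μ => ?_
    by_cases hμ : μ ∈ T
    · exact (le_eigenSum t hμ).trans le_sup_left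
    · exact (le_eigenSum t (T := Tᶜ) hμ).trans le_sup_right

theorem mem_eigenSum_of_comm {t e : N →ₗ[k] N} (he : ∀ m, t (e m) = e (t m)) (T : Set k) {v : N}
    (hv : v ∈ eigenSum t T) : e v ∈ eigenSum t T := by
  have : eigenSum t T ≤ (eigenSum t T).comap e := by
    refine iSup₂_le fun μ hμ v hv => le_eigenSum t hμ ?_
    exact Module.End.mapsTo_maxGenEigenspace_of_comm (f := t) (g := e)
      (LinearMap.ext fun m => he m) μ hv
  exact this hv

theorem eigenSum_isotropic [FiniteDimensional k N] {ψ : N →ₗ[k] N →ₗ[k] k} {t : N →ₗ[k] N}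
    (hinj : Function.Injective t) (hskew : ∀ v w, ψ (t v) w = -ψ v (t w)) {T : Set k}
    (hT : ∀ μ ∈ T, ∀ ν ∈ T, μ = -ν → μ = 0) :
    ∀ v ∈ eigenSum t T, ∀ w ∈ eigenSum t T, ψ v w = 0 := by
  have h1 : ∀ μ ∈ T, ∀ v ∈ Module.End.maxGenEigenspace t μ,
      eigenSum t T ≤ LinearMap.ker (ψ v) := by
    intro μ hμ v hv
    refine iSup₂_le fun ν hν w hw => ?_
    rw [LinearMap.mem_ker]
    by_cases hμν : μ = -ν
    · rw [hT μ hμ ν hν hμν, maxGenEigenspace_zero_of_injective hinj] at hv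
      rw [(Submodule.mem_bot k).1 hv, map_zero, LinearMap.zero_apply]
    · exact apply_eq_zero_of_skewAdjoint hskew hμν hv hw
  intro v hv w hw
  have h2 : eigenSum t T ≤ LinearMap.ker (ψ.flip w) :=
    iSup₂_le fun μ hμ v hv => h1 μ hμ v hv hw
  exact h2 hv

/-- The middle term cannot be both orthogonal and symplectic: comparing the two forms gives a
skew-adjoint automorphism, and the sum of one half of its generalized eigenspaces is a direct
summand of half the dimension. -/
theorem IsAS.not_both [IsAlgClosed k] [CharZero k] [FiniteDimensional k M]
    [FiniteDimensional k N] {f : Module.Dual k M →ₗ[k] N} {g : N →ₗ[k] M} (h : IsAS S o z f g)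
    (ho : o.EndLocal) {ε : k} (hε : ε * ε = 1) {ψ χ : N →ₗ[k] N →ₗ[k] k}
    (hψ : IsPairing S z z ψ) (hψn : ψ.Nondegenerate) (hψs : ∀ v w, ψ v w = ε * ψ w v)
    (hχ : IsPairing S z z χ) (hχn : χ.Nondegenerate) (hχs : ∀ v w, χ v w = -ε * χ w v) :
    False := by
  obtain ⟨t, ht, hψt⟩ := hψ.exists_repr hψn hχ
  have hinj : Function.Injective t := by
    rw [injective_iff_map_eq_zero]
    intro v hv
    exact hχn.1 v fun w => by rw [← hψt, hv]; simp
  have hskew : ∀ v w, ψ (t v) w = -ψ v (t w) := by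
    intro v w
    rw [hψt, hχs, hψs v, ← hψt]
    ring
  -- One of each pair of opposite nonzero scalars is selected with the help of a linear order.
  obtain ⟨rel, hrel⟩ : ∃ rel : k → k → Prop, IsWellOrder k rel := ⟨_, WellOrderingRel.isWellOrder⟩
  let T : Set k := {μ | rel μ (-μ)}
  have h1 := finrank_le_of_isotropic hψn (isCompl_eigenSum t T) (eigenSum_isotropic hinj hskew (by
    intro μ hμ ν hν hμν
    exfalso
    have h1 : rel μ (-μ) := hμ
    rw [hμν, neg_neg] at h1
    exact asymm_of rel h1 hν))
  have h2 := finrank_le_of_isotropic hψn (isCompl_eigenSum t T).symm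
    (eigenSum_isotropic hinj hskew (by
      intro μ hμ ν hν hμν
      have h1 : ¬ rel μ (-μ) := hμ
      rw [hμν, neg_neg] at h1
      rcases trichotomous_of rel (-ν) ν with h2 | h2 | h2
      · exact absurd h2 h1
      · rw [hμν, h2]
        exact self_eq_neg.1 h2.symm
      · exact absurd h2 hν))
  have h3 := Submodule.finrank_add_eq_of_isCompl (isCompl_eigenSum t T)
  have h4 := h.finrank_eq
  exact h.false_of_summand ho (isCompl_eigenSum t T) (by omega)
    (fun x m hm => mem_eigenSum_of_comm (ht.E x) _ hm)
    (fun a m hm => mem_eigenSum_of_comm (ht.arr a) _ hm)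
    (fun x m hm => mem_eigenSum_of_comm (ht.E x) _ hm)
    (fun a m hm => mem_eigenSum_of_comm (ht.arr a) _ hm)

/-- On the middle term of an almost split sequence that carries an `ε`-symmetric form there is an
invariant pairing that induces the evaluation pairing and is `ε`-symmetric up to a nilpotent
endomorphism. -/
theorem IsAS.exists_sign [IsAlgClosed k] [CharZero k] [FiniteDimensional k M]
    [FiniteDimensional k N] {f : Module.Dual k M →ₗ[k] N} {g : N →ₗ[k] M} (h : IsAS S o z f g)
    (ho : o.EndLocal) {ε : k} (hε : ε * ε = 1) {ψ : N →ₗ[k] N →ₗ[k] k}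
    (hψ : IsPairing S z z ψ) (hψn : ψ.Nondegenerate) (hψs : ∀ v w, ψ v w = ε * ψ w v) :
    ∃ (b : N →ₗ[k] N →ₗ[k] k) (φ : M →ₗ[k] M) (n : ℕ), IsPairing S z z b ∧
      (∀ ξ n, b (f ξ) n = ξ (g n)) ∧ IsMor o o φ ∧ (∀ n ξ, b n (f ξ) = ξ (φ (g n))) ∧
      (φ - ε • LinearMap.id) ^ n = 0 := by
  obtain ⟨b, hb, hbf⟩ := h.exists_pairing
  obtain ⟨φ, hφ, hbφ⟩ := h.exists_endo hb hbf
  obtain ⟨s, n, hs⟩ := ho.exists_scalar hφ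
  obtain rfl : s = ε := by
    by_contra hne
    -- Otherwise the `(-ε)`-symmetrization of `b` is nondegenerate, next to the `ε`-symmetric `ψ`.
    obtain ⟨χ, -, hχ, hχn, hχs, -⟩ := h.exists_form hb hbf hbφ hφ hs (η := -ε) (by rw [neg_mul_neg, hε])
      (by rwa [neg_neg])
    exact h.not_both ho hε hψ hψn hψs hχ hχn hχs
  exact ⟨b, φ, n, hb, hbf, hφ, hbφ, hs⟩

end QAct


/-! ### Minimal projective resolutions -/

namespace QAct

variable {k : Type u} [Field k] {I A : Type} [Fintype I] [DecidableEq I] [Fintype A]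
  {Q : Quiv I A} {M N L : Type u} [AddCommGroup M] [Module k M] [AddCommGroup N] [Module k N]
  [AddCommGroup L] [Module k L] {ι κ : Type} [Fintype ι] [Fintype κ] [DecidableEq ι]
  [DecidableEq κ] {x : κ → I} {y : ι → I}

/-- A morphism to a projective module is onto if it is so after composing with a map whose kernel
lies in the radical. -/
theorem surjective_of_comp (hQ : Q.Acyclic) {l : QAct k Q L}
    {p : ProjTot k Q y →ₗ[k] M} (htop : ∀ v, p v = 0 → topCoord k Q y v = 0)
    {h : L →ₗ[k] ProjTot k Q y} (hh : IsMor l (pact k Q y) h)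
    (hs : Function.Surjective (p ∘ₗ h)) : Function.Surjective h := by
  rw [← LinearMap.range_eq_top]
  refine nakayama hQ (pact k Q y) ?_ ?_ fun v => ?_
  · rintro x _ ⟨m, rfl⟩
    exact ⟨_, hh.E x m⟩
  · rintro x _ ⟨m, rfl⟩
    exact ⟨_, hh.arr x m⟩
  · obtain ⟨w, hw⟩ := hs (p v)
    obtain ⟨q, hq⟩ := exists_decomp y (v - h w)
    rw [htop (v - h w) (by rw [map_sub, sub_eq_zero]; exact hw.symm)] at hq
    refine ⟨h w, ⟨w, rfl⟩, q, ?_⟩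
    rw [← sub_eq_iff_eq_add', hq]
    simp

/-- Projective covers exist. -/
theorem exists_cover (hQ : Q.Acyclic) [FiniteDimensional k M] (o : QAct k Q M) :
    ∃ (n : ℕ) (y : Fin n → I) (p : ProjTot k Q y →ₗ[k] M), IsMor (pact k Q y) o p ∧
      Function.Surjective p ∧ ∀ v, p v = 0 → topCoord k Q y v = 0 := by
  -- `R` is the radical of `M`; the generators are lifts of homogeneous bases of `M / R`.
  let R : Submodule k M := LinearMap.range (∑ a, o.arr a ∘ₗ LinearMap.proj (φ := fun _ : A => M) a)
  have hR : ∀ m ∈ R, ∃ q : A → M, m = ∑ a, o.arr a (q a) := by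
    rintro _ ⟨q, rfl⟩
    exact ⟨q, by simp [LinearMap.sum_apply]⟩
  have hR' : ∀ q : A → M, ∑ a, o.arr a (q a) ∈ R := fun q => ⟨q, by simp [LinearMap.sum_apply]⟩
  classical
  have hR1 : ∀ a m, o.arr a m ∈ R := by
    intro a m
    have := hR' (Pi.single a m)
    rw [Finset.sum_eq_single a] at this
    · rwa [Pi.single_eq_same] at this
    · intro b _ hb
      rw [Pi.single_eq_of_ne hb, map_zero]
    · simp
  have hRE : ∀ x, ∀ m ∈ R, o.E x m ∈ R := by
    intro x m hm
    obtain ⟨q, rfl⟩ := hR m hm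
    rw [map_sum]
    refine R.sum_mem fun a _ => ?_
    by_cases h : x = Q.tgt a
    · rw [h, o.E_arr]
      exact hR1 _ _
    · rw [o.E_arr_ne h]
      exact R.zero_mem
  let t := o.quot R hRE fun a m _ => hR1 a m
  let W : I → Submodule k (M ⧸ R) := fun x => LinearMap.range (t.E x)
  let b : ∀ x, Module.Basis (Fin (Module.finrank k (W x))) k (W x) := fun x => Module.finBasis k (W x)
  have hb : ∀ x j, t.E x (b x j : M ⧸ R) = b x j := by
    intro x j
    obtain ⟨m, hm⟩ := (b x j).2
    rw [← hm, t.E_same]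
  let J := Σ x, Fin (Module.finrank k (W x))
  have hlift : ∀ s : J, ∃ m : M, o.E s.1 m = m ∧ R.mkQ m = b s.1 s.2 := by
    intro s
    obtain ⟨m, hm⟩ := R.mkQ_surjective (b s.1 s.2 : M ⧸ R)
    refine ⟨o.E s.1 m, o.E_same _ _, ?_⟩
    rw [(o.isMor_mkQ R hRE fun a m _ => hR1 a m).E, hm]
    exact hb _ _
  choose w hw hw' using hlift
  let e := Fintype.equivFin J
  let y : Fin (Fintype.card J) → I := fun i => (e.symm i).1
  let w' : Fin (Fintype.card J) → M := fun i => w (e.symm i)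
  let p := o.lift y w'
  have hp : IsMor (pact k Q y) o p := o.isMor_lift y w'
  have hpg : ∀ i, p (pgen k Q y i) = w' i := fun i => o.lift_pgen' y w' i (hw _)
  have hsum : ∀ c : Fin (Fintype.card J) → k, R.mkQ (p (∑ i, c i • pgen k Q y i)) =
      ∑ x, ((∑ j, c (e ⟨x, j⟩) • b x j : W x) : M ⧸ R) := by
    intro c
    rw [map_sum, map_sum]
    simp only [map_smul, hpg]
    rw [← e.sum_comp]
    simp only [w', Equiv.symm_apply_apply, hw']
    rw [Fintype.sum_sigma]
    refine Finset.sum_congr rfl fun x _ => ?_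
    rw [AddSubmonoidClass.coe_finsetSum]
    rfl
  refine ⟨Fintype.card J, y, p, hp, ?_, ?_⟩
  · rw [← LinearMap.range_eq_top]
    refine nakayama hQ o ?_ ?_ fun m => ?_
    · rintro x _ ⟨m, rfl⟩
      exact ⟨_, hp.E x m⟩
    · rintro x _ ⟨m, rfl⟩
      exact ⟨_, hp.arr x m⟩
    · let c : Fin (Fintype.card J) → k := fun i =>
        (b (e.symm i).1).repr ⟨t.E (e.symm i).1 (R.mkQ m), ⟨_, rfl⟩⟩ (e.symm i).2
      have h1 : R.mkQ (p (∑ i, c i • pgen k Q y i)) = R.mkQ m := by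
        rw [hsum, ← t.sum_E (R.mkQ m)]
        refine Finset.sum_congr rfl fun x _ => ?_
        have : ∑ j, c (e ⟨x, j⟩) • b x j = ⟨t.E x (R.mkQ m), ⟨_, rfl⟩⟩ := by
          conv_rhs => rw [← (b x).sum_repr ⟨t.E x (R.mkQ m), ⟨_, rfl⟩⟩]
          refine Finset.sum_congr rfl fun j _ => ?_
          simp only [c]
          rw [e.symm_apply_apply]
        rw [this]
      have h2 : m - p (∑ i, c i • pgen k Q y i) ∈ R :=
        (Submodule.Quotient.eq R).1 h1.symm
      obtain ⟨q, hq⟩ := hR _ h2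
      exact ⟨_, ⟨_, rfl⟩, q, by rw [← hq]; abel⟩
  · intro v hv
    obtain ⟨q, hq⟩ := exists_decomp y v
    have h1 := hsum (topCoord k Q y v)
    have h2 : R.mkQ (p (∑ i, topCoord k Q y v i • pgen k Q y i)) = 0 := by
      have : p (∑ i, topCoord k Q y v i • pgen k Q y i) = -∑ a, o.arr a (p (q a)) := by
        rw [eq_neg_iff_add_eq_zero, ← hv]
        conv_rhs => rw [hq, map_add, map_sum _ _ (Finset.univ : Finset A)]
        simp only [hp.arr]
      rw [this]
      refine (Submodule.Quotient.mk_eq_zero R).2 (R.neg_mem (hR' _))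
    rw [h2] at h1
    funext i
    have h3 : t.E (e.symm i).1 (∑ x, ((∑ j, topCoord k Q y v (e ⟨x, j⟩) • b x j : W x) : M ⧸ R)) = 0 := by
      rw [← h1, map_zero]
    rw [map_sum, Finset.sum_eq_single (e.symm i).1] at h3
    · have h4 : ∀ x (u : W x), t.E x (u : M ⧸ R) = u := by
        rintro x ⟨_, m, rfl⟩
        exact t.E_same x m
      rw [h4] at h3
      have h5 := (Fintype.linearIndependent_iff.1 (b (e.symm i).1).linearIndependent)
        (fun j => topCoord k Q y v (e ⟨(e.symm i).1, j⟩)) (Subtype.ext h3) (e.symm i).2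
      have h6 : e ⟨(e.symm i).1, (e.symm i).2⟩ = i := e.apply_symm_apply i
      rwa [h6] at h5
    · intro x _ hx
      have h4 : ∀ x (u : W x), t.E x (u : M ⧸ R) = u := by
        rintro x ⟨_, m, rfl⟩
        exact t.E_same x m
      rw [← h4, t.E_ne _ _ _ (Ne.symm hx)]
    · simp

/-- The path algebra is hereditary: a projective cover of a submodule of a projective module is
injective. A linear section of the cover is corrected to a morphism, since its defect can be
extended to the big projective module, where it is trivialized by `QAct.ext`. -/
theorem cover_injective (hQ : Q.Acyclic) {l : QAct k Q L} {i : L →ₗ[k] ProjTot k Q y}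
    (hi : IsMor l (pact k Q y) i) (hinj : Function.Injective i) {q : ProjTot k Q x →ₗ[k] L}
    (hq : IsMor (pact k Q x) l q) (hsurj : Function.Surjective q)
    (htop : ∀ v, q v = 0 → topCoord k Q x v = 0) : Function.Injective q := by
  let P := pact k Q x
  obtain ⟨s₀, hs₀⟩ := q.exists_rightInverse_of_surjective (LinearMap.range_eq_top.2 hsurj)
  obtain ⟨r, hr⟩ := i.exists_leftInverse_of_injective (LinearMap.ker_eq_bot.2 hinj)
  have hr' : ∀ v, r (i v) = v := LinearMap.congr_fun hr
  -- `s` is a section of `q` that respects the grading, and `c` is its failure to commute with the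
  -- arrows, extended to the big projective module along the retraction `r`.
  let s : L →ₗ[k] ProjTot k Q x := ∑ z, P.E z ∘ₗ s₀ ∘ₗ l.E z
  have hs : ∀ v, s v = ∑ z, P.E z (s₀ (l.E z v)) := fun v => by simp [s, LinearMap.sum_apply]
  have hqs : ∀ v, q (s v) = v := by
    intro v
    rw [hs, map_sum]
    conv_rhs => rw [← l.sum_E v]
    refine Finset.sum_congr rfl fun z _ => ?_
    have : q (s₀ (l.E z v)) = l.E z v := LinearMap.congr_fun hs₀ _
    rw [hq.E, this, l.E_same]
  have hsE : ∀ z v, s (l.E z v) = P.E z (s v) := by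
    intro z v
    rw [hs, hs, map_sum, Finset.sum_eq_single z, Finset.sum_eq_single z]
    · rw [P.E_same, l.E_same]
    · intro b _ hb
      rw [P.E_ne _ _ _ hb.symm]
    · simp
    · intro b _ hb
      rw [l.E_ne _ _ _ hb, map_zero, map_zero]
    · simp
  let c : A → ProjTot k Q y →ₗ[k] ProjTot k Q x := fun a => (s ∘ₗ l.arr a - P.arr a ∘ₗ s) ∘ₗ r
  have hqc : ∀ a v, q (c a v) = 0 := by
    intro a v
    simp only [c, LinearMap.comp_apply, LinearMap.sub_apply, map_sub, hqs, hq.arr, P, sub_self]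
  have hqL : ∀ v, q (P.ext c (0 : ι → _) v) = 0 := by
    intro v
    refine LinearMap.congr_fun (proj_hom_ext l (f := q ∘ₗ P.ext c (0 : ι → _)) (g := 0) ?_ ?_) v
    · intro j
      simp [ext_pgen]
    · intro a v hv
      rw [LinearMap.comp_apply, ext_arr, map_add, hq.arr, hq.E, hqc]
      rw [LinearMap.comp_apply] at hv
      rw [hv]
      simp
  let s' : L →ₗ[k] ProjTot k Q x := s - P.ext c (0 : ι → _) ∘ₗ i
  have hs' : IsMor l P s' := by
    refine ⟨fun z v => ?_, fun a v => ?_⟩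
    · simp only [s', LinearMap.sub_apply, LinearMap.comp_apply, map_sub, hsE, hi.E, ext_E]
    · simp only [s', LinearMap.sub_apply, LinearMap.comp_apply, map_sub, hi.arr, ext_arr]
      rw [← hi.E]
      have h1 : c a (i (l.E (Q.src a) v)) = s (l.arr a v) - P.arr a (s v) := by
        simp only [c, LinearMap.comp_apply, LinearMap.sub_apply, hr', l.arr_E, hsE, P.arr_E]
      rw [h1, map_sub, ← hsE, l.E_arr, P.E_arr]
      abel
  have hqs' : ∀ v, q (s' v) = v := by
    intro v
    simp only [s', LinearMap.sub_apply, LinearMap.comp_apply, map_sub, hqs, hqL, sub_zero]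
  have hsurj' := surjective_of_comp hQ htop hs' fun v => ⟨v, hqs' v⟩
  rw [injective_iff_map_eq_zero]
  intro v hv
  obtain ⟨m, rfl⟩ := hsurj' v
  rw [hqs'] at hv
  rw [hv, map_zero]

/-- A minimal projective resolution `0 → ⨁ P_{x j} → ⨁ P_{y i} → M → 0`. -/
structure IsMinRes (o : QAct k Q M) (d : ProjTot k Q x →ₗ[k] ProjTot k Q y)
    (p : ProjTot k Q y →ₗ[k] M) : Prop where
  mor_d : IsMor (pact k Q x) (pact k Q y) d
  mor_p : IsMor (pact k Q y) o p
  inj : Function.Injective d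
  surj : Function.Surjective p
  exact : LinearMap.range d = LinearMap.ker p
  top : ∀ v, p v = 0 → topCoord k Q y v = 0

namespace IsMinRes

variable {o : QAct k Q M} {d : ProjTot k Q x →ₗ[k] ProjTot k Q y} {p : ProjTot k Q y →ₗ[k] M}

theorem p_d (h : IsMinRes o d p) (v : ProjTot k Q x) : p (d v) = 0 := by
  have : d v ∈ LinearMap.ker p := h.exact ▸ ⟨v, rfl⟩
  exact this

theorem exists_of_p (h : IsMinRes o d p) {v : ProjTot k Q y} (hv : p v = 0) : ∃ w, d w = v := by
  have : v ∈ LinearMap.range d := h.exact ▸ hv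
  exact this

end IsMinRes

theorem exists_isMinRes (hQ : Q.Acyclic) [FiniteDimensional k M] (o : QAct k Q M) :
    ∃ (n : ℕ) (y : Fin n → I) (m : ℕ) (x : Fin m → I) (d : ProjTot k Q x →ₗ[k] ProjTot k Q y)
      (p : ProjTot k Q y →ₗ[k] M), IsMinRes o d p := by
  obtain ⟨n, y, p, hp, hs, htop⟩ := exists_cover hQ o
  have hfd := finiteDimensional_proj (k := k) hQ y
  let K := LinearMap.ker p
  have hKE : ∀ x, ∀ m ∈ K, (pact k Q y).E x m ∈ K := fun x m hm => by
    rw [LinearMap.mem_ker] at hm ⊢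
    rw [hp.E, hm, map_zero]
  have hKa : ∀ a, ∀ m ∈ K, (pact k Q y).arr a m ∈ K := fun x m hm => by
    rw [LinearMap.mem_ker] at hm ⊢
    rw [hp.arr, hm, map_zero]
  obtain ⟨m, x, q, hq, hqs, hqt⟩ := exists_cover hQ ((pact k Q y).sub K hKE hKa)
  have hi := (pact k Q y).isMor_subtype K hKE hKa
  refine ⟨n, y, m, x, K.subtype ∘ₗ q, p, hi.comp hq, hp,
    K.injective_subtype.comp (cover_injective hQ hi K.injective_subtype hq hqs hqt), hs, ?_, htop⟩
  rw [LinearMap.range_comp, LinearMap.range_eq_top.2 hqs, Submodule.map_top, Submodule.range_subtype]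

end QAct

/-! ### Symmetric resolutions from almost split sequences with a form -/

namespace QAct

variable {k : Type u} [Field k] {I A : Type} [Fintype I] [DecidableEq I] [Fintype A]
  {S : SymQuiver I A} {M N L : Type u} [AddCommGroup M] [Module k M] [AddCommGroup N] [Module k N]
  [AddCommGroup L] [Module k L] {ι κ : Type} [Fintype ι] [Fintype κ] [DecidableEq ι]
  [DecidableEq κ] {x x' : κ → I} {y y' : ι → I}
  {o : QAct k S.toQuiv M} {z : QAct k S.toQuiv N} {l : QAct k S.toQuiv L}
  {f : Module.Dual k M →ₗ[k] N} {g : N →ₗ[k] M}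
  {d : ProjTot k S.toQuiv x →ₗ[k] ProjTot k S.toQuiv y} {p : ProjTot k S.toQuiv y →ₗ[k] M}
  {d' : ProjTot k S.toQuiv y' →ₗ[k] ProjTot k S.toQuiv x'}
  {e : ProjTot k S.toQuiv x →ₗ[k] Module.Dual k M} {P : ProjTot k S.toQuiv y →ₗ[k] N}

/-- If `h` factors through the left almost split map then `h ∘ e` extends along `d`, so that it is
orthogonal to everything killed by the adjoint of `d`. -/
theorem sum_eq_zero_of_factor (hd : IsMor (pact k _ x) (pact k _ y) d)
    (hd' : IsMor (pact k _ y') (pact k _ x') d') (hadj : IsAdj S d d')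
    (hP : IsMor (pact k _ y) z P) (hfe : f ∘ₗ e = P ∘ₗ d)
    {m : N →ₗ[k] Module.Dual k L} (hm : IsMor z (l.dual S) m)
    {u : ProjTot k S.toQuiv x' →ₗ[k] L} (hu : IsMor (pact k _ x') l u) (hud : u ∘ₗ d' = 0) :
    ∑ j, m (f (e (pgen k S.toQuiv x j))) (u (pgen k S.toQuiv x' j)) = 0 := by
  have h1 := hadj _ _ _ (isPairing_id l) _ _ (hm.comp hP) hu
  have h2 : ∀ v, f (e v) = P (d v) := LinearMap.congr_fun hfe
  have h3 : ∀ v, u (d' v) = 0 := LinearMap.congr_fun hud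
  simp only [h2]
  refine Eq.trans ?_ (h1.trans ?_)
  · rfl
  · simp [h3]

/-- Comparing the two orders of the arguments of the pairing produces a morphism between the
resolution of `M` and its adjoint which is symmetric up to the sign `ε`. -/
theorem IsAS.exists_comparison [CharZero k] (hQ : S.toQuiv.Acyclic) [FiniteDimensional k M]
    (h : IsAS S o z f g) {ε : k} (hε : ε * ε = 1) {b : N →ₗ[k] N →ₗ[k] k}
    {φ : M →ₗ[k] M} {n : ℕ} (hb : IsPairing S z z b) (hbf : ∀ ξ n, b (f ξ) n = ξ (g n))
    (hφ : IsMor o o φ) (hbφ : ∀ n ξ, b n (f ξ) = ξ (φ (g n)))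
    (hn : (φ - ε • LinearMap.id) ^ n = 0) (hM : Nontrivial M) (hr : IsMinRes o d p)
    (hx : ∀ j, x' j = S.σ (x j)) (hy : ∀ i, y' i = S.σ (y i))
    (hd' : IsMor (pact k _ y') (pact k _ x') d') (hadj : IsAdj S d d')
    (hP : IsMor (pact k _ y) z P) (hgP : g ∘ₗ P = p) (he : IsMor (pact k _ x) (o.dual S) e)
    (hfe : f ∘ₗ e = P ∘ₗ d) :
    ∃ (Θ : ProjTot k S.toQuiv x' →ₗ[k] ProjTot k S.toQuiv y)
      (Ψ : ProjTot k S.toQuiv y' →ₗ[k] ProjTot k S.toQuiv x),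
      IsMor (pact k _ x') (pact k _ y) Θ ∧ IsMor (pact k _ y') (pact k _ x) Ψ ∧
      d ∘ₗ Ψ = Θ ∘ₗ d' ∧ IsAdj S Θ (ε • Ψ) ∧
      ∑ j, e (pgen k S.toQuiv x j) (p (Θ (pgen k S.toQuiv x' j))) ≠ 0 := by
  have hx' : ∀ j, x j = S.σ (x' j) := fun j => by rw [hx, S.σ_invol]
  have hgP' : ∀ v, g (P v) = p v := LinearMap.congr_fun hgP
  have hfe' : ∀ v, f (e v) = P (d v) := LinearMap.congr_fun hfe
  obtain ⟨u, hu, hud, hne⟩ : ∃ u : ProjTot k S.toQuiv x' →ₗ[k] M, IsMor (pact k _ x') o u ∧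
      u ∘ₗ d' = 0 ∧ ∑ j, e (pgen k S.toQuiv x j) (u (pgen k S.toQuiv x' j)) ≠ 0 := by
    refine (exists_factor_or_exists_dual hx hy hr.mor_d hd' hadj (isPairing_id o)
      nondegenerate_id he).resolve_left ?_
    rintro ⟨t, ht, htd⟩
    -- Otherwise the lift of `p` to the middle term can be corrected to split `g`.
    have hk : ∀ v, p v = 0 → (P - f ∘ₗ t) v = 0 := by
      intro v hv
      obtain ⟨w, rfl⟩ := hr.exists_of_p hv
      have := LinearMap.congr_fun htd w
      rw [LinearMap.comp_apply] at this
      rw [LinearMap.sub_apply, LinearMap.comp_apply, this, hfe', sub_self]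
    obtain ⟨s, hs, hsp⟩ := hr.mor_p.exists_factor hr.surj (hP.sub (h.mor_f.comp ht)) hk
    refine h.not_retraction ⟨s, hs, LinearMap.ext fun m => ?_⟩
    obtain ⟨v, rfl⟩ := hr.surj m
    have := LinearMap.congr_fun hsp v
    rw [LinearMap.comp_apply] at this
    rw [LinearMap.comp_apply, this, LinearMap.sub_apply, map_sub, hgP', LinearMap.comp_apply, h.g_f,
      sub_zero, LinearMap.id_apply]
  -- The morphism of cokernels induced by `u` lifts to the resolutions; `Θ₀'` and `Θ₁'` are the
  -- adjoints of the two components of the lift.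
  obtain ⟨Θ₀, hΘ₀, hpΘ₀⟩ := exists_lift_proj hr.mor_p hu fun i => hr.surj _
  obtain ⟨Θ₁, hΘ₁, hdΘ₁⟩ := exists_lift_proj hr.mor_d (hΘ₀.comp hd') (by
    intro i
    rw [hr.exact, LinearMap.mem_ker, LinearMap.comp_apply]
    have h1 := LinearMap.congr_fun hpΘ₀ (d' (pgen k S.toQuiv y' i))
    rw [LinearMap.comp_apply] at h1
    rw [h1]
    exact LinearMap.congr_fun hud _)
  obtain ⟨Θ₀', hΘ₀', hadj₀⟩ := exists_isAdj hQ hx' hy hΘ₀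
  have hy' : ∀ i, y i = S.σ (y' i) := fun i => by rw [hy, S.σ_invol]
  obtain ⟨Θ₁', hΘ₁', hadj₁⟩ := exists_isAdj hQ hy' hx hΘ₁
  have hcomm : d ∘ₗ Θ₀' = Θ₁' ∘ₗ d' := by
    refine (hadj₀.comp hadj.symm hΘ₀ hr.mor_d).unique hy ?_ (hr.mor_d.comp hΘ₀') (hΘ₁'.comp hd')
    rw [← hdΘ₁]
    exact hadj.comp hadj₁ hr.mor_d hΘ₁'
  have hpΘ₁ : ∀ v, p (Θ₁' (d' v)) = 0 := by
    intro v
    have h1 := LinearMap.congr_fun hcomm v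
    rw [LinearMap.comp_apply, LinearMap.comp_apply] at h1
    rw [← h1, hr.p_d]
  -- The sign rule, up to the nilpotent part of `φ`.
  have h1 : ∑ j, e (pgen k S.toQuiv x j) (p (Θ₀ (pgen k S.toQuiv x' j))) =
      ∑ j, e (pgen k S.toQuiv x j) (φ (p (Θ₁' (pgen k S.toQuiv x' j)))) := by
    have e1 := hadj₀ _ _ _ hb.flip _ _ hP (hP.comp hr.mor_d)
    have e2 := hadj.symm _ _ _ hb _ _ (hP.comp hΘ₁') hP
    have hc : ∀ v, d (Θ₀' v) = Θ₁' (d' v) := LinearMap.congr_fun hcomm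
    simp only [LinearMap.flip_apply, LinearMap.comp_apply, hc] at e1
    simp only [LinearMap.comp_apply] at e2
    simp only [← hgP', ← hbf, ← hbφ, hfe']
    exact e1.trans e2
  have h2 : ∑ j, e (pgen k S.toQuiv x j)
      ((φ - ε • LinearMap.id : M →ₗ[k] M) (p (Θ₁' (pgen k S.toQuiv x' j)))) = 0 := by
    have hν : IsMor o o (φ - ε • LinearMap.id) := hφ.sub ((IsMor.id o).smul ε)
    -- The transpose of the nilpotent part is not split, so it extends along `f`.
    obtain ⟨m, hm, hmf⟩ := h.left (o.dual S) _ hν.dualMap (by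
      rintro ⟨r, hr, hrν⟩
      have hinj : Function.Injective (φ - ε • LinearMap.id).dualMap := by
        intro ξ ζ hξζ
        have h3 := congrArg r hξζ
        rw [← LinearMap.comp_apply, ← LinearMap.comp_apply, hrν] at h3
        exact h3
      have hsurj : Function.Surjective (φ - ε • LinearMap.id : M →ₗ[k] M) :=
        LinearMap.dualMap_injective_iff.1 hinj
      exact EndLocal.not_both o (LinearMap.injective_iff_surjective.2 hsurj) n hn)
    have h3 : ∀ ξ v, m (f ξ) v = ξ ((φ - ε • LinearMap.id : M →ₗ[k] M) v) := fun ξ v =>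
      LinearMap.congr_fun (LinearMap.congr_fun hmf ξ) v
    have h4 := sum_eq_zero_of_factor hr.mor_d hd' hadj hP hfe hm (hr.mor_p.comp hΘ₁')
      (LinearMap.ext hpΘ₁)
    simp only [h3] at h4
    exact h4
  have h3 : ∑ j, e (pgen k S.toQuiv x j) (p (Θ₀ (pgen k S.toQuiv x' j))) =
      ε * ∑ j, e (pgen k S.toQuiv x j) (p (Θ₁' (pgen k S.toQuiv x' j))) := by
    rw [h1, Finset.mul_sum, ← sub_eq_zero, ← Finset.sum_sub_distrib, ← h2]
    refine Finset.sum_congr rfl fun j _ => ?_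
    simp
  refine ⟨Θ₀ + ε • Θ₁', Θ₁ + ε • Θ₀', hΘ₀.add (hΘ₁'.smul ε), hΘ₁.add (hΘ₀'.smul ε), ?_, ?_, ?_⟩
  · rw [LinearMap.comp_add, hdΘ₁, LinearMap.comp_smul, hcomm, LinearMap.add_comp,
      LinearMap.smul_comp]
  · rw [smul_add, smul_smul, hε, one_smul, add_comm]
    exact (hadj₁.symm.smul ε).add hadj₀
  · have h4 : ∀ v, p (Θ₀ v) = u v := LinearMap.congr_fun hpΘ₀
    simp only [LinearMap.add_apply, LinearMap.smul_apply, map_add, map_smul, smul_eq_mul,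
      Finset.sum_add_distrib, ← Finset.mul_sum, ← h3]
    simp only [h4, ← two_mul]
    exact mul_ne_zero two_ne_zero hne

/-- A comparison morphism that pairs nontrivially with `e` is an isomorphism: on cokernels it
induces a retraction since the sequence is almost split, and the resolutions are minimal. -/
theorem IsAS.bijective_comparison (hQ : S.toQuiv.Acyclic) [FiniteDimensional k M]
    (h : IsAS S o z f g) {ε : k} (hε : ε * ε = 1) (hr : IsMinRes o d p)
    (hx : ∀ j, x' j = S.σ (x j)) (hy : ∀ i, y' i = S.σ (y i))
    (hd' : IsMor (pact k _ y') (pact k _ x') d') (hadj : IsAdj S d d')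
    (hP : IsMor (pact k _ y) z P) (hfe : f ∘ₗ e = P ∘ₗ d)
    {Θ : ProjTot k S.toQuiv x' →ₗ[k] ProjTot k S.toQuiv y}
    {Ψ : ProjTot k S.toQuiv y' →ₗ[k] ProjTot k S.toQuiv x}
    (hΘ : IsMor (pact k _ x') (pact k _ y) Θ) (hΨ : IsMor (pact k _ y') (pact k _ x) Ψ)
    (hcomm : d ∘ₗ Ψ = Θ ∘ₗ d') (hΘΨ : IsAdj S Θ (ε • Ψ))
    (hne : ∑ j, e (pgen k S.toQuiv x j) (p (Θ (pgen k S.toQuiv x' j))) ≠ 0) :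
    Function.Bijective Ψ := by
  have hfdx := finiteDimensional_proj (k := k) hQ x
  have hfdx' := finiteDimensional_proj (k := k) hQ x'
  have hfdy := finiteDimensional_proj (k := k) hQ y
  have hcomm' : ∀ v, d (Ψ v) = Θ (d' v) := LinearMap.congr_fun hcomm
  -- `c` is the cokernel of `d'`, and `θ` the morphism to `M` that `Θ` induces on cokernels. If `θ`
  -- were not a retraction, its transpose would factor through `f`, contradicting `hne`.
  let C := LinearMap.range d'
  have hCE : ∀ x, ∀ m ∈ C, (pact k S.toQuiv x').E x m ∈ C := by
    rintro x _ ⟨m, rfl⟩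
    exact ⟨_, hd'.E x m⟩
  have hCa : ∀ a, ∀ m ∈ C, (pact k S.toQuiv x').arr a m ∈ C := by
    rintro x _ ⟨m, rfl⟩
    exact ⟨_, hd'.arr x m⟩
  let c := (pact k S.toQuiv x').quot C hCE hCa
  have hq := (pact k S.toQuiv x').isMor_mkQ C hCE hCa
  obtain ⟨θ, hθ, hθq⟩ := hq.exists_factor C.mkQ_surjective (hr.mor_p.comp hΘ) (by
    intro v hv
    have hv' : v ∈ C := by rwa [← LinearMap.mem_ker, Submodule.ker_mkQ] at hv
    obtain ⟨w, rfl⟩ := hv'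
    rw [LinearMap.comp_apply, ← hcomm', hr.p_d])
  have hθq' : ∀ v, θ (C.mkQ v) = p (Θ v) := LinearMap.congr_fun hθq
  obtain ⟨s, hs, hθs⟩ : ∃ s, IsMor o c s ∧ θ ∘ₗ s = LinearMap.id := by
    by_contra hcon
    obtain ⟨m, hm, hmf⟩ := h.left (c.dual S) _ hθ.dualMap (by
      rintro ⟨r, hr, hrθ⟩
      obtain ⟨s, hs, hrs⟩ := hr.exists_transpose
      refine hcon ⟨s, hs, LinearMap.ext fun m => ?_⟩
      rw [← sub_eq_zero]
      refine (Module.forall_dual_apply_eq_zero_iff k _).1 fun ξ => ?_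
      have h1 := hrs (θ.dualMap ξ) m
      have h2 := LinearMap.congr_fun (LinearMap.congr_fun hrθ ξ) m
      rw [map_sub, sub_eq_zero]
      exact h1.trans h2)
    have h3 : ∀ ξ v, m (f ξ) v = ξ (θ v) := fun ξ v =>
      LinearMap.congr_fun (LinearMap.congr_fun hmf ξ) v
    have h4 := sum_eq_zero_of_factor hr.mor_d hd' hadj hP hfe hm hq (by
      refine LinearMap.ext fun v => ?_
      exact (Submodule.Quotient.mk_eq_zero C).2 ⟨v, rfl⟩)
    simp only [h3, hθq'] at h4
    exact hne h4
  -- The section `s` of `θ` lifts to the resolutions, and `Θ ∘ S₀` is onto by minimality.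
  obtain ⟨S₀, hS₀, hqS₀⟩ := exists_lift_proj hq (hs.comp hr.mor_p) fun i => C.mkQ_surjective _
  have hpS₀ : ∀ v, p (Θ (S₀ v)) = p v := by
    intro v
    have h1 := LinearMap.congr_fun hqS₀ v
    rw [LinearMap.comp_apply, LinearMap.comp_apply] at h1
    rw [← hθq', h1]
    exact LinearMap.congr_fun hθs (p v)
  obtain ⟨S₁, hS₁, hdS₁⟩ := exists_lift_proj hd' (hS₀.comp hr.mor_d) (by
    intro j
    rw [LinearMap.comp_apply]
    have h1 := LinearMap.congr_fun hqS₀ (d (pgen k S.toQuiv x j))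
    rw [LinearMap.comp_apply, LinearMap.comp_apply, hr.p_d, map_zero] at h1
    exact (Submodule.Quotient.mk_eq_zero C).1 h1)
  have hb₀ : Function.Surjective (Θ ∘ₗ S₀) := by
    refine surjective_of_comp hQ hr.top (hΘ.comp hS₀) fun m => ?_
    obtain ⟨v, rfl⟩ := hr.surj m
    exact ⟨v, hpS₀ v⟩
  have hi₀ := LinearMap.injective_iff_surjective.2 hb₀
  have hi₁ : Function.Injective (Ψ ∘ₗ S₁) := by
    intro v w hvw
    apply hr.inj
    apply hi₀
    have h1 : ∀ v, d (Ψ (S₁ v)) = Θ (S₀ (d v)) := fun v => by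
      rw [hcomm']
      exact congrArg Θ (LinearMap.congr_fun hdS₁ v)
    rw [LinearMap.comp_apply, LinearMap.comp_apply, ← h1, ← h1]
    exact congrArg d hvw
  refine ⟨?_, ?_⟩
  · -- A right inverse of `Θ` gives a left inverse of its adjoint.
    obtain ⟨t, ht, htl, htr⟩ := (hΘ.comp hS₀).ofBijective ⟨hi₀, hb₀⟩
    have hT : IsMor (pact k _ y) (pact k _ x') (S₀ ∘ₗ t) := hS₀.comp ht
    obtain ⟨T', hT', hTadj⟩ := exists_isAdj hQ hy (fun j => by rw [hx, S.σ_invol]) hT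
    have h1 : T' ∘ₗ (ε • Ψ) = LinearMap.id := by
      have h2 : IsAdj S (Θ ∘ₗ S₀ ∘ₗ t) (T' ∘ₗ (ε • Ψ)) := hΘΨ.comp hTadj hΘ hT'
      rw [← LinearMap.comp_assoc, htr] at h2
      exact h2.unique hy IsAdj.id (hT'.comp (hΨ.smul ε)) (IsMor.id _)
    intro v w hvw
    have h3 := LinearMap.congr_fun h1 v
    have h4 := LinearMap.congr_fun h1 w
    rw [LinearMap.comp_apply, LinearMap.smul_apply] at h3 h4
    rw [hvw] at h3
    exact h3.symm.trans h4
  · have := LinearMap.injective_iff_surjective.1 hi₁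
    exact Function.Surjective.of_comp (g := S₁) this

/-- If the middle term of the almost split sequence that ends in `M` carries an `ε`-symmetric
form, then `M` has a minimal projective resolution whose differential is `ε` times its adjoint. -/
theorem IsAS.exists_symmetric_resolution [IsAlgClosed k] [CharZero k] (hQ : S.toQuiv.Acyclic)
    [FiniteDimensional k M] [FiniteDimensional k N] (h : IsAS S o z f g) (ho : o.EndLocal) {ε : k}
    (hε : ε * ε = 1) {ψ : N →ₗ[k] N →ₗ[k] k} (hψ : IsPairing S z z ψ) (hψn : ψ.Nondegenerate)
    (hψs : ∀ v w, ψ v w = ε * ψ w v) :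
    ∃ (n : ℕ) (y : Fin n → I)
      (d : ProjTot k S.toQuiv (fun i => S.σ (y i)) →ₗ[k] ProjTot k S.toQuiv y)
      (p : ProjTot k S.toQuiv y →ₗ[k] M), IsMinRes o d p ∧ IsAdj S d (ε • d) := by
  obtain ⟨b, φ, n, hb, hbf, hφ, hbφ, hn⟩ := h.exists_sign ho hε hψ hψn hψs
  obtain ⟨ny, y, nx, x, d, p, hr⟩ := exists_isMinRes hQ o
  have hx : ∀ j, (fun j => S.σ (x j)) j = S.σ (x j) := fun _ => rfl
  have hy : ∀ i, (fun i => S.σ (y i)) i = S.σ (y i) := fun _ => rfl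
  obtain ⟨d', hd', hadj⟩ := exists_isAdj hQ hx hy hr.mor_d
  obtain ⟨P, hP, hgP⟩ := exists_lift_proj h.mor_g hr.mor_p fun i => h.surj _
  obtain ⟨e, he, hfe⟩ := h.mor_f.exists_lift h.inj (hP.comp hr.mor_d) (by
    intro v
    rw [h.exact, LinearMap.mem_ker]
    exact (LinearMap.congr_fun hgP (d v)).trans (hr.p_d v))
  obtain ⟨Θ, Ψ, hΘ, hΨ, hcomm, hΘΨ, hne⟩ := h.exists_comparison hQ hε hb hbf hφ hbφ hn
    ho.nontrivial hr hx hy hd' hadj hP hgP he hfe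
  have hbij := h.bijective_comparison hQ hε hr hx hy hd' hadj hP hfe hΘ hΨ hcomm hΘΨ hne
  refine ⟨ny, y, d ∘ₗ Ψ, p, ⟨hr.mor_d.comp hΨ, hr.mor_p, hr.inj.comp hbij.1, hr.surj, ?_, hr.top⟩, ?_⟩
  · rw [LinearMap.range_comp, LinearMap.range_eq_top.2 hbij.2, Submodule.map_top, hr.exact]
  · have h1 : IsAdj S Ψ (ε • Θ) := by
      have := hΘΨ.symm.smul ε
      rwa [smul_smul, hε, one_smul] at this
    have h2 := hadj.comp h1 hr.mor_d (hΘ.smul ε)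
    rwa [LinearMap.smul_comp, ← hcomm] at h2

end QAct


/-! ### Passing between representations and modules -/

namespace SymQuiver

open QRep QAct

variable {k : Type u} [Field k] {I A : Type} [Fintype I] [DecidableEq I] {S : SymQuiver I A}

theorem isAS_of_isAlmostSplit {V Z : QRep k S.toQuiv} {f : Hom (S.dual V) Z} {g : Hom Z V}
    (h : Hom.IsAlmostSplit f g) :
    IsAS S V.act Z.act (f.tot ∘ₗ (S.dualEquiv V).symm.toLinearMap) g.tot := by
  have he := S.isMor_dualEquiv V
  have hes := he.symm
  refine ⟨⟨f.isMor_tot.comp hes, g.isMor_tot,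
    (Hom.injective_iff.1 h.exact.1).comp (S.dualEquiv V).symm.injective,
    Hom.surjective_iff.1 h.exact.2.1, ?_, ?_, ?_, ?_⟩, ?_⟩
  · rw [LinearMap.range_comp, LinearEquiv.range, Submodule.map_top]
    exact Hom.range_eq_ker_iff.1 h.exact.2.2
  · rintro ⟨r, hr, hrf⟩
    refine h.not_section (Hom.isSection_iff.2 ⟨(S.dualEquiv V).symm.toLinearMap ∘ₗ r,
      hes.comp hr, LinearMap.ext fun v => ?_⟩)
    have := LinearMap.congr_fun hrf (S.dualEquiv V v)
    simp only [LinearMap.comp_apply, LinearEquiv.coe_coe, LinearEquiv.symm_apply_apply,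
      LinearMap.id_apply] at this ⊢
    rw [this, LinearEquiv.symm_apply_apply]
  · rintro ⟨s, hs, hgs⟩
    exact h.not_retraction (Hom.isRetraction_iff.2 ⟨s, hs, hgs⟩)
  · intro L _ _ _ l t ht hns
    have hl := isMor_toRepEquiv l
    have hl' := hl.symm
    have hfd : l.toRep.IsFinDim := isFinDim_iff.2 (Module.Finite.equiv l.toRepEquiv.symm)
    obtain ⟨t', ht'⟩ := h.left l.toRep hfd (Hom.ofMor _ (hl'.comp (ht.comp he))) (by
      intro hsec
      obtain ⟨r, hr, hrt⟩ := Hom.isSection_iff.1 hsec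
      refine hns ⟨(S.dualEquiv V).toLinearMap ∘ₗ r ∘ₗ l.toRepEquiv.symm.toLinearMap,
        he.comp (hr.comp hl'), LinearMap.ext fun ξ => ?_⟩
      have := LinearMap.congr_fun hrt ((S.dualEquiv V).symm ξ)
      rw [Hom.tot_ofMor] at this
      simp only [LinearMap.comp_apply, LinearEquiv.coe_coe, LinearEquiv.apply_symm_apply,
        LinearMap.id_apply] at this ⊢
      rw [this, LinearEquiv.apply_symm_apply])
    refine ⟨l.toRepEquiv.toLinearMap ∘ₗ t'.tot, hl.comp t'.isMor_tot, LinearMap.ext fun ξ => ?_⟩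
    have := LinearMap.congr_fun (congrArg Hom.tot ht') ((S.dualEquiv V).symm ξ)
    rw [Hom.tot_ofMor, Hom.tot_comp] at this
    simp only [LinearMap.comp_apply, LinearEquiv.coe_coe, LinearEquiv.apply_symm_apply] at this ⊢
    rw [this, LinearEquiv.apply_symm_apply]
  · intro L _ _ _ l t ht hns
    have hl := isMor_toRepEquiv l
    have hl' := hl.symm
    have hfd : l.toRep.IsFinDim := isFinDim_iff.2 (Module.Finite.equiv l.toRepEquiv.symm)
    obtain ⟨t', ht'⟩ := h.right l.toRep hfd (Hom.ofMor _ (ht.comp hl)) (by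
      intro hret
      obtain ⟨r, hr, hrt⟩ := Hom.isRetraction_iff.1 hret
      refine hns ⟨l.toRepEquiv.toLinearMap ∘ₗ r, hl.comp hr, ?_⟩
      rw [Hom.tot_ofMor] at hrt
      exact hrt)
    refine ⟨t'.tot ∘ₗ l.toRepEquiv.symm.toLinearMap, t'.isMor_tot.comp hl', LinearMap.ext fun v => ?_⟩
    have := LinearMap.congr_fun (congrArg Hom.tot ht') (l.toRepEquiv.symm v)
    rw [Hom.tot_ofMor, Hom.tot_comp] at this
    simp only [LinearMap.comp_apply, LinearEquiv.coe_coe, LinearEquiv.apply_symm_apply] at this ⊢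
    exact this

theorem exists_isAlmostSplit_of_isAS {V : QRep k S.toQuiv} {N : Type u} [AddCommGroup N]
    [Module k N] {z : QAct k S.toQuiv N} {f : Module.Dual k (∀ x, V.obj x) →ₗ[k] N}
    {g : N →ₗ[k] (∀ x, V.obj x)} (h : IsAS S V.act z f g) :
    ∃ (f' : Hom (S.dual V) z.toRep) (g' : Hom z.toRep V), Hom.IsAlmostSplit f' g' := by
  have he := S.isMor_dualEquiv V
  have hes := he.symm
  have hz := isMor_toRepEquiv z
  have hz' := hz.symm
  refine ⟨Hom.ofMor _ (hz'.comp (h.mor_f.comp he)), Hom.ofMor _ (h.mor_g.comp hz),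
    ⟨?_, ?_, ?_⟩, ?_, ?_, ?_, ?_⟩
  · rw [Hom.injective_iff, Hom.tot_ofMor]
    exact z.toRepEquiv.symm.injective.comp (h.inj.comp (S.dualEquiv V).injective)
  · rw [Hom.surjective_iff, Hom.tot_ofMor]
    exact h.surj.comp z.toRepEquiv.surjective
  · rw [Hom.range_eq_ker_iff, Hom.tot_ofMor, Hom.tot_ofMor]
    ext v
    constructor
    · rintro ⟨α, rfl⟩
      simp [h.g_f]
    · intro hv
      obtain ⟨ξ, hξ⟩ := h.exists_of_g (n := z.toRepEquiv v) hv
      refine ⟨(S.dualEquiv V).symm ξ, ?_⟩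
      simp [hξ]
  · intro hsec
    obtain ⟨r, hr, hrt⟩ := Hom.isSection_iff.1 hsec
    rw [Hom.tot_ofMor] at hrt
    refine h.not_section ⟨(S.dualEquiv V).toLinearMap ∘ₗ r ∘ₗ z.toRepEquiv.symm.toLinearMap,
      he.comp (hr.comp hz'), LinearMap.ext fun ξ => ?_⟩
    have := LinearMap.congr_fun hrt ((S.dualEquiv V).symm ξ)
    simp only [LinearMap.comp_apply, LinearEquiv.coe_coe, LinearEquiv.apply_symm_apply,
      LinearMap.id_apply] at this ⊢
    rw [this, LinearEquiv.apply_symm_apply]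
  · intro hret
    obtain ⟨r, hr, hrt⟩ := Hom.isRetraction_iff.1 hret
    rw [Hom.tot_ofMor] at hrt
    exact h.not_retraction ⟨z.toRepEquiv.toLinearMap ∘ₗ r, hz.comp hr, hrt⟩
  · intro Y hY t hns
    have := isFinDim_iff.1 hY
    obtain ⟨t', ht', htf⟩ := h.left Y.act (t.tot ∘ₗ (S.dualEquiv V).symm.toLinearMap)
      (t.isMor_tot.comp hes) (by
        rintro ⟨r, hr, hrt⟩
        refine hns (Hom.isSection_iff.2 ⟨(S.dualEquiv V).symm.toLinearMap ∘ₗ r, hes.comp hr,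
          LinearMap.ext fun v => ?_⟩)
        have := LinearMap.congr_fun hrt (S.dualEquiv V v)
        simp only [LinearMap.comp_apply, LinearEquiv.coe_coe, LinearEquiv.symm_apply_apply,
          LinearMap.id_apply] at this ⊢
        rw [this, LinearEquiv.symm_apply_apply])
    refine ⟨Hom.ofMor _ (ht'.comp hz), Hom.tot_injective ?_⟩
    rw [Hom.tot_comp, Hom.tot_ofMor, Hom.tot_ofMor]
    refine LinearMap.ext fun v => ?_
    have := LinearMap.congr_fun htf (S.dualEquiv V v)
    simp only [LinearMap.comp_apply, LinearEquiv.coe_coe, LinearEquiv.symm_apply_apply,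
      LinearEquiv.apply_symm_apply] at this ⊢
    exact this
  · intro X hX t hns
    have := isFinDim_iff.1 hX
    obtain ⟨t', ht', htg⟩ := h.right X.act t.tot t.isMor_tot (by
      rintro ⟨s, hs, hst⟩
      exact hns (Hom.isRetraction_iff.2 ⟨s, hs, hst⟩))
    refine ⟨Hom.ofMor _ (hz'.comp ht'), Hom.tot_injective ?_⟩
    rw [Hom.tot_comp, Hom.tot_ofMor, Hom.tot_ofMor]
    refine LinearMap.ext fun v => ?_
    have := LinearMap.congr_fun htg v
    simp only [LinearMap.comp_apply, LinearEquiv.coe_coe, LinearEquiv.apply_symm_apply] at this ⊢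
    exact this

variable [Fintype A]

theorem isMinimalResolution_of_isMinRes (hQ : S.toQuiv.Acyclic) {n m : ℕ} {y : Fin n → I}
    {x : Fin m → I} {V : QRep k S.toQuiv} {d : ProjTot k S.toQuiv x →ₗ[k] ProjTot k S.toQuiv y}
    {p : ProjTot k S.toQuiv y →ₗ[k] (∀ x, V.obj x)} (h : IsMinRes V.act d p) :
    IsMinimalResolution (Hom.ofMor d h.mor_d) (Hom.ofMor p h.mor_p) := by
  refine ⟨⟨?_, ?_, ?_⟩, ?_, fun X t ht => ?_⟩
  · rw [Hom.injective_iff, Hom.tot_ofMor]; exact h.inj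
  · rw [Hom.surjective_iff, Hom.tot_ofMor]; exact h.surj
  · rw [Hom.range_eq_ker_iff, Hom.tot_ofMor, Hom.tot_ofMor]; exact h.exact
  · rw [Hom.surjective_iff, Hom.tot_ofMor]; exact h.surj
  · rw [Hom.surjective_iff, Hom.tot_comp, Hom.tot_ofMor] at ht
    exact Hom.surjective_iff.2 (surjective_of_comp hQ h.top t.isMor_tot ht)

theorem isMinRes_of_isMinimalResolution {n m : ℕ} {y : Fin n → I}
    {x : Fin m → I} {V : QRep k S.toQuiv} {d : Hom (proj k S.toQuiv x) (proj k S.toQuiv y)}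
    {p : Hom (proj k S.toQuiv y) V} (h : IsMinimalResolution d p) :
    IsMinRes V.act d.tot p.tot := by
  refine ⟨d.isMor_tot, p.isMor_tot, Hom.injective_iff.1 h.1.1, Hom.surjective_iff.1 h.1.2.1,
    Hom.range_eq_ker_iff.1 h.1.2.2, fun v hv => ?_⟩
  by_contra hne
  obtain ⟨i, hi⟩ : ∃ i, topCoord k S.toQuiv y v i ≠ 0 := by
    by_contra! hcon
    exact hne (funext hcon)
  -- The elements whose `i`-th top coordinate vanishes already cover `V`.
  let U : Submodule k (ProjTot k S.toQuiv y) :=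
    LinearMap.ker (LinearMap.proj i ∘ₗ topCoord k S.toQuiv y)
  have hU : ∀ w, w ∈ U ↔ topCoord k S.toQuiv y w i = 0 := fun w => Iff.rfl
  have hUE : ∀ x, ∀ m ∈ U, (pact k S.toQuiv y).E x m ∈ U := by
    intro x w hw
    rw [hU] at hw ⊢
    have h1 : topCoord k S.toQuiv y ((pact k S.toQuiv y).E x w) =
      (topAct k S.toQuiv y).E x (topCoord k S.toQuiv y w) :=
      ((topAct k S.toQuiv y).isMor_lift y _).E x w
    rw [h1]
    change (if y i = x then (LinearMap.proj i : (Fin n → k) →ₗ[k] k) else 0) _ = 0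
    split_ifs
    · exact hw
    · rfl
  have hUa : ∀ a, ∀ m ∈ U, (pact k S.toQuiv y).arr a m ∈ U := by
    intro a w hw
    rw [hU, topCoord_arr]
    rfl
  let u := (pact k S.toQuiv y).sub U hUE hUa
  let t : Hom u.toRep (proj k S.toQuiv y) := Hom.ofMor _
    (((pact k S.toQuiv y).isMor_subtype U hUE hUa).comp (isMor_toRepEquiv u))
  have ht : ∀ w, t.tot w = (u.toRepEquiv w : U) := fun w =>
    LinearMap.congr_fun (Hom.tot_ofMor _ _) w
  have hs := h.2.2 u.toRep t (by
    rw [Hom.surjective_iff, Hom.tot_comp]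
    intro m
    obtain ⟨w, rfl⟩ := Hom.surjective_iff.1 h.2.1 m
    have hw : w - (topCoord k S.toQuiv y w i / topCoord k S.toQuiv y v i) • v ∈ U := by
      rw [hU, map_sub, map_smul]
      simp [div_mul_cancel₀ _ hi]
    refine ⟨u.toRepEquiv.symm ⟨_, hw⟩, ?_⟩
    rw [LinearMap.comp_apply, ht, LinearEquiv.apply_symm_apply]
    simp [hv])
  obtain ⟨w, hw⟩ := Hom.surjective_iff.1 hs (pgen k S.toQuiv y i)
  have h1 : pgen k S.toQuiv y i ∈ U := by
    rw [← hw, ht]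
    exact Subtype.mem _
  rw [hU, topCoord_pgen, Pi.single_eq_same] at h1
  exact one_ne_zero h1

theorem homForm_eq {n : ℕ} {y : Fin n → I}
    (d : Hom (proj k S.toQuiv (fun i => S.σ (y i))) (proj k S.toQuiv y))
    {W : QRep k S.toQuiv} (B : LinearMap.BilinForm k (∀ x, W.obj x))
    (f g : Hom (proj k S.toQuiv y) W) : S.homForm d B f g =
      ∑ i, B (f.tot (d.tot (pgen k S.toQuiv (fun i => S.σ (y i)) i))) (g.tot (pgen k S.toQuiv y i)) := by
  refine Finset.sum_congr rfl fun i _ => ?_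
  rw [pgen, pgen, Hom.tot_single, Hom.tot_single, Hom.tot_single]
  rfl

/-- If the almost split sequence has a middle term with an `ε`-symmetric form, then the
differential of a suitable minimal resolution is skew-symmetric on representations with a
`(-ε)`-symmetric form. -/
theorem isSkewOn_of_isAlmostSplit [IsAlgClosed k] [CharZero k] (hQ : S.toQuiv.Acyclic) {ε : k}
    (hε : ε * ε = 1) {V Z : QRep k S.toQuiv} (hfin : V.IsFinDim) (hV : V.Indecomposable)
    {f : Hom (S.dual V) Z} {g : Hom Z V} (h : Hom.IsAlmostSplit f g)
    {B : LinearMap.BilinForm k (∀ x, Z.obj x)} (hB : S.IsForm ε Z B) (β : I → ℕ) :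
    S.IsSkewOn (-ε) V β := by
  have hfd := isFinDim_iff.1 hfin
  have hAS := isAS_of_isAlmostSplit h
  have hfdZ : FiniteDimensional k (∀ x, Z.obj x) := by
    -- The middle term is finite dimensional as an extension of `V` by its dual.
    have h1 : FiniteDimensional k (LinearMap.ker g.tot) := by
      rw [← hAS.exact]
      infer_instance
    have h2 : FiniteDimensional k ((∀ x, Z.obj x) ⧸ LinearMap.ker g.tot) :=
      Module.Finite.equiv (g.tot.quotKerEquivOfSurjective hAS.surj).symm
    exact Module.Finite.of_submodule_quotient (LinearMap.ker g.tot)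
  obtain ⟨hp, hn, hs⟩ := S.isForm_iff.1 hB
  obtain ⟨n, y, d, p, hr, hd⟩ := hAS.exists_symmetric_resolution hQ (hV.endLocal hfin) hε hp hn hs
  refine ⟨n, y, Hom.ofMor d hr.mor_d, Hom.ofMor p hr.mor_p, isMinimalResolution_of_isMinRes hQ hr, ?_⟩
  intro W C _ _ hC s t
  obtain ⟨hCp, -, hCs⟩ := S.isForm_iff.1 hC
  rw [homForm_eq, homForm_eq, Hom.tot_ofMor]
  refine (hd _ _ C hCp s.tot t.tot s.isMor_tot t.isMor_tot).trans ?_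
  rw [← Finset.sum_neg_distrib]
  refine Finset.sum_congr rfl fun i _ => ?_
  rw [hCs, LinearMap.smul_apply, map_smul, map_smul, LinearMap.smul_apply, smul_eq_mul, neg_mul,
    ← mul_assoc, hε, one_mul]

end SymQuiver


/-! ### Representations with a form detect elements of projective modules -/

namespace Quiv

variable {I A : Type} [Fintype I] [DecidableEq I] {Q : Quiv I A}

/-- The set of arrows that occur in a path. -/
def pathArrows {x : I} : ∀ {z : I}, Q.Path x z → Set A :=
  fun {z} q => @Quiver.Path.rec I Q.toQuiver x (fun _ _ => Set A) ∅ (fun _ a s => insert a.1 s) z q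

theorem pathArrows_snoc {x : I} (a : A) (q : Q.Path x (Q.src a)) :
    pathArrows (Path.snoc a q) = insert a (pathArrows q) := rfl

theorem reflTransGen_of_mem_pathArrows {x z : I} (q : Q.Path x z) {a : A}
    (ha : a ∈ pathArrows q) :
    Relation.ReflTransGen (fun y z => ∃ a, Q.src a = y ∧ Q.tgt a = z) (Q.tgt a) z := by
  refine QAct.path_induction (P := fun {z} q => a ∈ pathArrows q →
    Relation.ReflTransGen (fun y z => ∃ a, Q.src a = y ∧ Q.tgt a = z) (Q.tgt a) z)
    (fun h => absurd h (Set.notMem_empty a)) (fun b q ih h => ?_) q ha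
  rw [pathArrows_snoc] at h
  rcases h with rfl | h
  · exact Relation.ReflTransGen.refl
  · exact (ih h).tail ⟨b, rfl, rfl⟩

theorem Acyclic.notMem_pathArrows (hQ : Q.Acyclic) {x : I} {a b : A} (hab : Q.tgt b = Q.tgt a)
    (q : Q.Path x (Q.src b)) : a ∉ pathArrows q := by
  intro h
  have h1 := reflTransGen_of_mem_pathArrows q h
  refine hQ (Q.tgt a) ?_
  exact Relation.TransGen.tail' h1 ⟨b, rfl, hab⟩

theorem transGen_of_path {x z : I} (q : Q.Path x z) :
    x = z ∨ Relation.TransGen (fun y z => ∃ a, Q.src a = y ∧ Q.tgt a = z) x z := by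
  refine QAct.path_induction (P := fun {z} q => x = z ∨
    Relation.TransGen (fun y z => ∃ a, Q.src a = y ∧ Q.tgt a = z) x z) (Or.inl rfl)
    (fun b q ih => Or.inr ?_) q
  rcases ih with h | h
  · exact Relation.TransGen.single ⟨b, h.symm, rfl⟩
  · exact h.tail ⟨b, rfl, rfl⟩

/-- Without oriented cycles, a path that only uses arrows of a parallel path is equal to it. -/
theorem Acyclic.eq_of_pathArrows_subset (hQ : Q.Acyclic) {x z : I} (q p : Q.Path x z)
    (h : pathArrows q ⊆ pathArrows p) : q = p := by
  revert p
  refine QAct.path_induction (P := fun {z} q => ∀ p : Q.Path x z, pathArrows q ⊆ pathArrows p → q = p)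
    ?_ (fun a q ih p hqp => ?_) q
  · intro p _
    rcases QAct.path_cases p with ⟨h, hp⟩ | ⟨a, p', -⟩
    · exact hp.symm
    · exfalso
      refine hQ x ?_
      rcases transGen_of_path p' with h | h
      · exact Relation.TransGen.single ⟨a.1, h.symm, a.2⟩
      · exact h.tail ⟨a.1, rfl, a.2⟩
  · rw [pathArrows_snoc, Set.insert_subset_iff] at hqp
    rcases QAct.path_cases p with ⟨h, hp⟩ | ⟨⟨b, hb⟩, p', hp⟩
    · exfalso
      refine hQ x ?_
      rcases transGen_of_path q with h' | h'
      · exact Relation.TransGen.single ⟨a, h'.symm, h.symm⟩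
      · exact h'.tail ⟨a, rfl, h.symm⟩
    · have hpa : pathArrows p = insert b (pathArrows p') := by rw [hp]; rfl
      rw [hpa] at hqp
      obtain rfl : a = b := hqp.1.resolve_right (hQ.notMem_pathArrows hb p')
      rw [hp, ih p' fun c hc => (hqp.2 hc).resolve_left fun hca =>
        hQ.notMem_pathArrows rfl q (hca ▸ hc)]
      rfl

end Quiv

namespace SymQuiver

open QRep QAct

variable {k : Type u} [Field k] {I A : Type} [Fintype I] [DecidableEq I] {S : SymQuiver I A}

/-- Orthogonal representations exist in all symmetric dimensions. -/
theorem exists_orthogonal {β : I → ℕ} (hβ : S.IsSymmDim β) :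
    ∃ (W : QRep k S.toQuiv) (B : LinearMap.BilinForm k (∀ x, W.obj x)),
      W.IsFinDim ∧ W.dim = β ∧ S.IsForm 1 W B := by
  -- The arrows act by zero, and the form pairs the standard bases in degrees `x` and `σ x`.
  let W : QRep k S.toQuiv := { obj := fun x => Fin (β x) → k, map := fun _ => 0 }
  let c : ∀ x, (Fin (β x) → k) →ₗ[k] (Fin (β (S.σ x)) → k) →ₗ[k] k := fun x =>
    LinearMap.mk₂ k (fun v w => ∑ i, v i * w (Fin.cast (hβ x).symm i))
      (fun v v' w => by simp [add_mul, Finset.sum_add_distrib])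
      (fun r v w => by simp [Finset.mul_sum, mul_assoc])
      (fun v w w' => by simp [mul_add, Finset.sum_add_distrib])
      (fun r v w => by simp [Finset.mul_sum, mul_left_comm])
  have hc : ∀ x v w, c x v w = ∑ i, v i * w (Fin.cast (hβ x).symm i) := fun x v w => rfl
  let B : LinearMap.BilinForm k (∀ x, W.obj x) :=
    ∑ x, (c x).compl₁₂ (LinearMap.proj x) (LinearMap.proj (S.σ x))
  have hB : ∀ v w : ∀ x, Fin (β x) → k,
      B v w = ∑ x, ∑ i, v x i * w (S.σ x) (Fin.cast (hβ x).symm i) := by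
    intro v w
    simp only [B, LinearMap.sum_apply]
    rfl
  have hsymm : ∀ v w, B v w = B w v := by
    intro v w
    have h1 : ∀ x, ∑ i, v (S.σ x) i * w (S.σ (S.σ x)) (Fin.cast (hβ (S.σ x)).symm i) =
        ∑ i, w x i * v (S.σ x) (Fin.cast (hβ x).symm i) := by
      intro x
      rw [← Equiv.sum_comp (finCongr (hβ x)).symm]
      refine Finset.sum_congr rfl fun i _ => ?_
      rw [mul_comm]
      have key : ∀ (y z : I) (h : y = z) (i : Fin (β z)) (j : Fin (β y)), j.1 = i.1 →
          w y j = w z i := by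
        rintro y z rfl i j hij
        rw [Fin.ext hij]
      rw [key _ x (S.σ_invol x) i _ rfl]
      rfl
    rw [hB v w, hB w v, ← Finset.sum_congr rfl fun x _ => h1 x]
    exact (Equiv.sum_comp ⟨S.σ, S.σ, S.σ_invol, S.σ_invol⟩
      fun x => ∑ i, v x i * w (S.σ x) (Fin.cast (hβ x).symm i)).symm
  have hsep : ∀ v, (∀ w, B v w = 0) → v = 0 := by
    intro v hv
    funext x
    refine funext fun i => ?_
    have := hv (Pi.single (S.σ x) (Pi.single (Fin.cast (hβ x).symm i) (1 : k)))
    rw [hB v, Finset.sum_eq_single x, Finset.sum_eq_single i] at this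
    · rw [Pi.single_eq_same, Pi.single_eq_same, mul_one] at this
      exact this
    · intro j _ hj
      have : Fin.cast (hβ x).symm j ≠ Fin.cast (hβ x).symm i := fun h => hj (by simpa using h)
      simp [Pi.single_eq_of_ne this]
    · simp
    · intro y _ hy
      have : S.σ y ≠ S.σ x := fun h => hy (S.σ_injective h)
      rw [Pi.single_eq_of_ne this]
      exact Finset.sum_eq_zero fun j _ => mul_zero _
    · simp
  refine ⟨W, B, fun x => inferInstanceAs (FiniteDimensional k (Fin (β x) → k)),
    funext fun x => Module.finrank_fin_fun k, ?_⟩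
  refine S.isForm_iff.2 ⟨⟨fun x v w => ?_, fun a v w => ?_⟩,
    ⟨hsep, fun w hw => hsep w fun v => by rw [hsymm, hw]⟩, fun v w => by rw [one_mul, hsymm]⟩
  · rw [act_E, act_E, hB, hB, Finset.sum_eq_single x, Finset.sum_eq_single x]
    · rw [Pi.single_eq_same, Pi.single_eq_same]
    · intro y _ hy
      have : S.σ y ≠ S.σ x := fun h => hy (S.σ_injective h)
      rw [Pi.single_eq_of_ne this]
      exact Finset.sum_eq_zero fun j _ => mul_zero _
    · simp
    · intro y _ hy
      rw [Pi.single_eq_of_ne hy]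
      exact Finset.sum_eq_zero fun j _ => zero_mul _
    · simp
  · rw [act_arr, act_arr]
    simp [W]

end SymQuiver

namespace QAct

variable {k : Type u} [Field k] {I A : Type} [Fintype I] [DecidableEq I]
  {S : SymQuiver I A} {N : Type u} [AddCommGroup N] [Module k N]

/-- A bilinear form on a space of dimension at least two over an algebraically closed field has a
nonzero isotropic vector. -/
theorem exists_isotropic [IsAlgClosed k] [CharZero k] (B : N →ₗ[k] N →ₗ[k] k) {U : Submodule k N}
    (hU : 2 ≤ Module.finrank k U) : ∃ v ∈ U, v ≠ 0 ∧ B v v = 0 := by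
  have hfd : FiniteDimensional k U := Module.finite_of_finrank_pos (by omega)
  have hU0 : U ≠ ⊥ := by
    rintro rfl
    simp at hU
  obtain ⟨u, hu, hu0⟩ := U.exists_mem_ne_zero_of_ne_bot hU0
  by_cases huu : B u u = 0
  · exact ⟨u, hu, hu0, huu⟩
  obtain ⟨w, hw, hwu⟩ : ∃ w ∈ U, w ∉ Submodule.span k {u} := by
    by_contra! hcon
    have h1 := Submodule.finrank_mono (show U ≤ Submodule.span k {u} from hcon)
    have h2 := finrank_span_singleton (K := k) hu0
    omega
  obtain ⟨s, hs⟩ := IsAlgClosed.exists_eq_mul_self (discrim (B u u) (B w u + B u w) (B w w))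
  obtain ⟨t, ht⟩ := exists_quadratic_eq_zero huu ⟨s, hs⟩
  refine ⟨w + t • u, U.add_mem hw (U.smul_mem t hu), fun h => hwu ?_, ?_⟩
  · rw [eq_neg_of_add_eq_zero_left h]
    exact Submodule.neg_mem _ (Submodule.smul_mem _ _ (Submodule.mem_span_singleton_self u))
  · rw [← ht]
    simp only [map_add, map_smul, LinearMap.add_apply, LinearMap.smul_apply, smul_eq_mul]
    ring

/-- In a graded space with an invariant form all of whose components have dimension at least two,
there are nonzero homogeneous vectors `x z`, one in each degree, with `x z` orthogonal to
`x (σ z)`. -/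
theorem exists_isotropic_family [IsAlgClosed k] [CharZero k] {z : QAct k S.toQuiv N}
    {B : N →ₗ[k] N →ₗ[k] k} {ε : k} (hB : ∀ v w, B v w = ε * B w v)
    (hdim : ∀ i, 2 ≤ Module.finrank k (LinearMap.range (z.E i))) :
    ∃ x : I → N, (∀ i, z.E i (x i) = x i) ∧ (∀ i, x i ≠ 0) ∧ ∀ i, B (x i) (x (S.σ i)) = 0 := by
  have hE : ∀ i, ∀ v ∈ LinearMap.range (z.E i), z.E i v = v := by
    rintro i _ ⟨v, rfl⟩
    exact z.E_same i v
  have key : ∀ i, ∃ u v : N, z.E i u = u ∧ z.E (S.σ i) v = v ∧ u ≠ 0 ∧ v ≠ 0 ∧ B u v = 0 ∧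
      (S.σ i = i → u = v) := by
    intro i
    by_cases hi : S.σ i = i
    · obtain ⟨u, hu, hu0, huu⟩ := exists_isotropic B (hdim i)
      exact ⟨u, u, hE i u hu, by rw [hi, hE i u hu], hu0, hu0, huu, fun _ => rfl⟩
    · obtain ⟨u, hu, hu0, -⟩ := exists_isotropic B (hdim i)
      have hfd : FiniteDimensional k (LinearMap.range (z.E (S.σ i))) :=
        Module.finite_of_finrank_pos (by have := hdim (S.σ i); omega)
      obtain ⟨v, hv, hv0⟩ : ∃ v : LinearMap.range (z.E (S.σ i)),
          (B u ∘ₗ (LinearMap.range (z.E (S.σ i))).subtype) v = 0 ∧ v ≠ 0 := by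
        by_contra! hcon
        have h1 : Function.Injective (B u ∘ₗ (LinearMap.range (z.E (S.σ i))).subtype) :=
          (injective_iff_map_eq_zero _).2 hcon
        have h2 := LinearMap.finrank_le_finrank_of_injective h1
        have h3 := hdim (S.σ i)
        rw [Module.finrank_self] at h2
        omega
      exact ⟨u, v, hE i u hu, hE _ _ v.2, hu0, fun h => hv0 (Subtype.ext h), hv,
        fun h => absurd h hi⟩
  choose u v hu hv hu0 hv0 huv huv' using key
  have hB0 : ∀ v w, B v w = 0 → B w v = 0 := fun v w h => by rw [hB, h, mul_zero]
  -- One of the two vectors is used at `i`, the other one at `σ i`.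
  let r := Fintype.equivFin I
  refine ⟨fun i => if r i ≤ r (S.σ i) then u i else v (S.σ i), fun i => ?_, fun i => ?_, fun i => ?_⟩
  · dsimp only
    split_ifs
    · exact hu i
    · have := hv (S.σ i)
      rwa [S.σ_invol] at this
  · dsimp only
    split_ifs
    · exact hu0 i
    · exact hv0 _
  · dsimp only
    rw [S.σ_invol]
    by_cases h1 : r i ≤ r (S.σ i) <;> by_cases h2 : r (S.σ i) ≤ r i
    · have h3 : S.σ i = i := (r.injective (le_antisymm h1 h2)).symm
      rw [if_pos h1, if_pos h2, h3]
      have := huv i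
      rwa [← huv' i h3] at this
    · rw [if_pos h1, if_neg h2]
      exact huv i
    · rw [if_neg h1, if_pos h2]
      exact hB0 _ _ (huv _)
    · exact absurd (le_total (r i) (r (S.σ i))) (by tauto)

end QAct

namespace SymQuiver

open QRep QAct

variable {k : Type u} [Field k] {I A : Type} [Fintype I] [DecidableEq I] {S : SymQuiver I A}

/-- Changing the arrows of a representation with a form: the arrows of `J` act by the rank one maps
`x (ta) ↦ x (ha)`, corrected so that the form stays invariant. -/
theorem exists_rep_of_arrows {W : QRep k S.toQuiv} {B : LinearMap.BilinForm k (∀ x, W.obj x)}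
    {ε : k} (hε : ε * ε = 1) (hB : S.IsForm ε W B) {x x' : I → ∀ x, W.obj x}
    (hx : ∀ i, W.act.E i (x i) = x i) (hx' : ∀ i, W.act.E (S.σ i) (x' i) = x' i)
    (hxx : ∀ i, B (x i) (x (S.σ i)) = 0) (hxx' : ∀ i, B (x i) (x' i) = 1) (J : Set A) :
    ∃ (U : QRep k S.toQuiv) (C : LinearMap.BilinForm k (∀ x, U.obj x)) (o : ∀ i, ∀ x, U.obj x)
      (o' : I → ∀ x, U.obj x),
      U.IsFinDim = W.IsFinDim ∧ U.dim = W.dim ∧ S.IsForm ε U C ∧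
      (∀ i, U.act.E i (o i) = o i) ∧ (∀ i, U.act.E (S.σ i) (o' i) = o' i) ∧
      (∀ i, C (o i) (o' i) = 1) ∧ (∀ a ∈ J, U.act.arr a (o (S.src a)) = o (S.tgt a)) ∧
      ∀ a ∉ J, U.act.arr a (o (S.src a)) = 0 := by
  classical
  obtain ⟨hBp, hBn, hBs⟩ := S.isForm_iff.1 hB
  -- The second term is the skew adjoint of the rank one map of `σ₁ a`; it does not disturb the
  -- action on the vectors `x i`, because `x i` is orthogonal to `x (σ i)`.
  let t : A → (∀ x, W.obj x) →ₗ[k] (∀ x, W.obj x) := fun a =>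
    (if a ∈ J then (B.flip (x' (S.src a))).smulRight (x (S.tgt a)) else 0) -
    (if S.σ₁ a ∈ J then (B (x (S.tgt (S.σ₁ a)))).smulRight (x' (S.src (S.σ₁ a))) else 0)
  have ht : ∀ a v, t a v = (if a ∈ J then B v (x' (S.src a)) • x (S.tgt a) else 0) -
      (if S.σ₁ a ∈ J then B (x (S.tgt (S.σ₁ a))) v • x' (S.src (S.σ₁ a)) else 0) := by
    intro a v
    simp only [t, LinearMap.sub_apply]
    congr 1 <;> split_ifs <;> rfl
  have ht1 : ∀ a v, W.act.E (S.tgt a) (t a v) = t a v := by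
    intro a v
    have h2 : W.act.E (S.tgt a) (x' (S.src (S.σ₁ a))) = x' (S.src (S.σ₁ a)) := by
      have := hx' (S.src (S.σ₁ a))
      rwa [S.src_σ₁, S.σ_invol, ← S.src_σ₁] at this
    rw [ht, map_sub]
    congr 1 <;> split_ifs
    · rw [map_smul, hx]
    · rw [map_zero]
    · rw [map_smul, h2]
    · rw [map_zero]
  have ht2 : ∀ a v, t a (W.act.E (S.src a) v) = t a v := by
    intro a v
    have h2 : B (x (S.tgt (S.σ₁ a))) (W.act.E (S.src a) v) = B (x (S.tgt (S.σ₁ a))) v := by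
      rw [hBp.E', ← S.tgt_σ₁, hx]
    rw [ht, ht, hBp.E, hx', h2]
  let U : QRep k S.toQuiv :=
    { obj := W.obj
      map := fun a => LinearMap.proj (S.tgt a) ∘ₗ t a ∘ₗ LinearMap.single k W.obj (S.src a) }
  have hU : ∀ a v, U.act.arr a v = t a v := by
    intro a v
    rw [← ht2, ← ht1]
    rfl
  refine ⟨U, B, x, x', rfl, rfl, S.isForm_iff.2 ⟨⟨hBp.E, fun a v w => ?_⟩, hBn, hBs⟩, hx, hx', hxx',
    fun a ha => ?_, fun a ha => ?_⟩
  · rw [hU, hU, ht, ht, S.σ₁_invol, map_sub, LinearMap.sub_apply, map_sub]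
    have e1 : B (if a ∈ J then B v (x' (S.src a)) • x (S.tgt a) else 0) w =
        B v (if a ∈ J then B (x (S.tgt a)) w • x' (S.src a) else 0) := by
      split_ifs
      · simp [mul_comm]
      · simp
    have e2 : B (if S.σ₁ a ∈ J then B (x (S.tgt (S.σ₁ a))) v • x' (S.src (S.σ₁ a)) else 0) w =
        B v (if S.σ₁ a ∈ J then B w (x' (S.src (S.σ₁ a))) • x (S.tgt (S.σ₁ a)) else 0) := by
      split_ifs
      · rw [map_smul, LinearMap.smul_apply, map_smul, smul_eq_mul, smul_eq_mul, hBs (x _) v,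
          hBs w (x' _)]
        ring
      · simp
    rw [e1, e2]
    ring
  all_goals
    have h0 : B (x (S.tgt (S.σ₁ a))) (x (S.src a)) = 0 := by
      rw [hBs, S.tgt_σ₁, hxx, mul_zero]
    rw [hU, ht, h0, zero_smul, ite_self, sub_zero, hxx', one_smul]
  · rw [if_pos ha]
  · rw [if_neg ha]

/-- Elements of a projective module are detected by the representations of dimension `β` with an
`ε`-symmetric form, when there are such and all `β x` are at least two. -/
theorem eq_zero_of_forall_form [Fintype A] [IsAlgClosed k] [CharZero k] (hQ : S.toQuiv.Acyclic)
    {β : I → ℕ} (hβ : ∀ x, 2 ≤ β x) {ε : k} (hε : ε * ε = 1)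
    (hex : ∃ (W : QRep k S.toQuiv) (B : LinearMap.BilinForm k (∀ x, W.obj x)),
      W.IsFinDim ∧ W.dim = β ∧ S.IsForm ε W B) {n : ℕ} {y : Fin n → I}
    {v : ProjTot k S.toQuiv y} (hv : ∀ (W : QRep k S.toQuiv)
      (B : LinearMap.BilinForm k (∀ x, W.obj x)), W.IsFinDim → W.dim = β → S.IsForm ε W B →
      ∀ f : ProjTot k S.toQuiv y →ₗ[k] ∀ x, W.obj x, IsMor (pact k S.toQuiv y) W.act f → f v = 0) :
    v = 0 := by
  classical
  obtain ⟨W, B, hW, hWβ, hB⟩ := hex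
  have hfd := isFinDim_iff.1 hW
  obtain ⟨hBp, hBn, hBs⟩ := S.isForm_iff.1 hB
  obtain ⟨x, hx, hx0, hxx⟩ := exists_isotropic_family (z := W.act) hBs (by
    intro i
    have h1 : Function.Injective ((LinearMap.single k W.obj i).codRestrict
        (LinearMap.range (W.act.E i)) fun v => ⟨Pi.single i v, act_E_single _ _ _⟩) := by
      intro v w hvw
      exact Pi.single_injective i (congrArg Subtype.val hvw)
    have h2 := LinearMap.finrank_le_finrank_of_injective h1
    have h3 : Module.finrank k (W.obj i) = β i := congrFun hWβ i
    have h4 := hβ i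
    omega)
  have hx' : ∀ i, ∃ x' : ∀ x, W.obj x, W.act.E (S.σ i) x' = x' ∧ B (x i) x' = 1 := by
    intro i
    obtain ⟨w, hw⟩ : ∃ w, B (x i) w ≠ 0 := by
      by_contra! hcon
      exact hx0 i (hBn.1 _ hcon)
    refine ⟨W.act.E (S.σ i) ((B (x i) w)⁻¹ • w), W.act.E_same _ _, ?_⟩
    rw [← hBp.E, hx, map_smul, smul_eq_mul, inv_mul_cancel₀ hw]
  choose x' hx' hxx' using hx'
  -- The coefficient of the path `q` is read off from the action in which exactly the arrows of
  -- `q` act by `x (ta) ↦ x (ha)`.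
  have key : ∀ (z : I) (i : Fin n) (q : S.toQuiv.Path (y i) z),
      projComp k S.toQuiv y z (v z) ⟨i, q⟩ = 0 := by
    intro z i q
    obtain ⟨U, C, o, o', hU1, hU2, hC, ho, ho', hoo, hJ, hJ'⟩ :=
      S.exists_rep_of_arrows hε hB hx hx' hxx hxx' (Quiv.pathArrows q)
    obtain ⟨hCp, -, -⟩ := S.isForm_iff.1 hC
    let f := U.act.lift y (Pi.single i (o (y i)))
    have hf : IsMor (pact k S.toQuiv y) U.act f := U.act.isMor_lift y _
    have hf0 := hv U C (hU1 ▸ hW) (hU2.trans hWβ) hC f hf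
    have h1 : ∀ (j : Fin n) (z' : I) (r : S.toQuiv.Path (y j) z'), f (pathVec k y r) =
        if j = i ∧ Quiv.pathArrows r ⊆ Quiv.pathArrows q then o z' else 0 := by
      intro j z' r
      refine path_induction (P := fun {z'} r => f (pathVec k y r) =
        if j = i ∧ Quiv.pathArrows r ⊆ Quiv.pathArrows q then o z' else 0) ?_ (fun a r ih => ?_) r
      · change f (pgen k S.toQuiv y j) = _
        rw [lift_pgen]
        by_cases hj : j = i
        · subst hj
          rw [Pi.single_eq_same, ho, if_pos ⟨rfl, Set.empty_subset _⟩]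
        · rw [Pi.single_eq_of_ne hj, map_zero, if_neg fun h => hj h.1]
      · rw [pathVec_cons, hf.arr, ih]
        by_cases ha : a ∈ Quiv.pathArrows q
        · have : (j = i ∧ Quiv.pathArrows (Quiv.Path.snoc a r) ⊆ Quiv.pathArrows q) ↔
              (j = i ∧ Quiv.pathArrows r ⊆ Quiv.pathArrows q) := by
            rw [Quiv.pathArrows_snoc, Set.insert_subset_iff]
            tauto
          simp only [this]
          split_ifs
          · exact hJ a ha
          · exact map_zero _
        · have : ¬ (j = i ∧ Quiv.pathArrows (Quiv.Path.snoc a r) ⊆ Quiv.pathArrows q) := by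
            rw [Quiv.pathArrows_snoc, Set.insert_subset_iff]
            tauto
          rw [if_neg this]
          split_ifs
          · exact hJ' a ha
          · exact map_zero _
    -- `ℓ ∘ f` and the coefficient of `q` agree on the basis of paths.
    let ℓ : (∀ x, U.obj x) →ₗ[k] k := LinearMap.flip C (o' z)
    have hℓ : ∀ u, ℓ u = C u (o' z) := fun _ => rfl
    have h2 : LinearMap.eqLocus (ℓ ∘ₗ f)
        (Finsupp.lapply ⟨i, q⟩ ∘ₗ (projComp k S.toQuiv y z).toLinearMap ∘ₗ LinearMap.proj z) = ⊤ := by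
      refine pathVec_span y fun j z' r => ?_
      rw [LinearMap.mem_eqLocus]
      simp only [LinearMap.comp_apply, LinearMap.proj_apply,
        LinearEquiv.coe_coe, h1]
      by_cases hz : z = z'
      · subst hz
        have e1 : pathVec k y r z = (projComp k S.toQuiv y z).symm (Finsupp.single ⟨j, r⟩ 1) :=
          Pi.single_eq_same _ _
        rw [e1, LinearEquiv.apply_symm_apply, Finsupp.lapply_apply, Finsupp.single_apply]
        by_cases hj : j = i
        · subst hj
          by_cases hr : r = q
          · subst hr
            rw [if_pos ⟨rfl, subset_rfl⟩, if_pos rfl, hℓ, hoo]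
          · rw [if_neg, if_neg, map_zero]
            · intro h
              simp only [Sigma.mk.injEq, heq_eq_eq, true_and] at h
              exact hr h
            · rintro ⟨-, h⟩
              exact hr (hQ.eq_of_pathArrows_subset r q h)
        · rw [if_neg fun h => hj h.1, if_neg, map_zero]
          intro h
          exact hj (congrArg Sigma.fst h)
      · have e1 : pathVec k y r z = 0 := Pi.single_eq_of_ne hz _
        rw [e1, map_zero, map_zero]
        split_ifs
        · rw [hℓ, ← ho' z, ← hCp.E, ← ho z', U.act.E_ne _ _ _ hz, map_zero, LinearMap.zero_apply]
        · rw [map_zero]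
    have h3 : v ∈ LinearMap.eqLocus (ℓ ∘ₗ f)
        (Finsupp.lapply ⟨i, q⟩ ∘ₗ (projComp k S.toQuiv y z).toLinearMap ∘ₗ LinearMap.proj z) :=
      h2 ▸ Submodule.mem_top
    rw [LinearMap.mem_eqLocus] at h3
    simp only [LinearMap.comp_apply, LinearMap.proj_apply,
        LinearEquiv.coe_coe, hf0, map_zero] at h3
    exact h3.symm
  funext z
  refine (projComp k S.toQuiv y z).injective (Finsupp.ext ?_)
  rintro ⟨i, q⟩
  rw [key]
  rfl

/-- If the differential is skew-symmetric on all representations of dimension `β` with an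
`ε`-symmetric form, then it is `-ε` times its own adjoint. -/
theorem isAdj_of_skew [Fintype A] [IsAlgClosed k] [CharZero k] (hQ : S.toQuiv.Acyclic)
    {β : I → ℕ} (hβ : ∀ x, 2 ≤ β x) {ε : k} (hε : ε * ε = 1)
    (hex : ∃ (W : QRep k S.toQuiv) (B : LinearMap.BilinForm k (∀ x, W.obj x)),
      W.IsFinDim ∧ W.dim = β ∧ S.IsForm ε W B) {n : ℕ} {y : Fin n → I}
    {d : Hom (proj k S.toQuiv (fun i => S.σ (y i))) (proj k S.toQuiv y)}
    (hd : ∀ (W : QRep k S.toQuiv) (B : LinearMap.BilinForm k (∀ x, W.obj x)),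
      W.IsFinDim → W.dim = β → S.IsForm ε W B →
      ∀ f g : QRep.Hom (QRep.proj k S.toQuiv y) W, S.homForm d B f g = -S.homForm d B g f) :
    IsAdj S d.tot (-ε • d.tot) := by
  have hx : ∀ i, y i = S.σ ((fun i => S.σ (y i)) i) := fun i => (S.σ_invol _).symm
  obtain ⟨d', hd', hadj⟩ := exists_isAdj hQ hx (fun _ => rfl) d.isMor_tot
  suffices h : d' = -ε • d.tot by rwa [← h]
  refine IsMor.proj_ext hd' (d.isMor_tot.smul _) fun i => ?_
  rw [← sub_eq_zero]
  refine S.eq_zero_of_forall_form hQ hβ hε hex fun W B hW hWβ hB f hf => ?_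
  obtain ⟨hBp, hBn, hBs⟩ := S.isForm_iff.1 hB
  refine hBn.2 _ fun m => ?_
  have hm := W.act.isMor_lift y (Pi.single i m)
  have h1 := hadj _ _ B hBp _ _ hm hf
  have h2 := hd W B hW hWβ hB (Hom.ofMor _ hm) (Hom.ofMor _ hf)
  rw [homForm_eq, homForm_eq, Hom.tot_ofMor, Hom.tot_ofMor, h1] at h2
  have h3 : ∀ w : Fin n → ∀ x, W.obj x, (∀ j, W.act.E (S.σ (y j)) (w j) = w j) →
      ∑ j, B (W.act.lift y (Pi.single i m) (pgen k S.toQuiv y j)) (w j) = B m (w i) := by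
    intro w hw
    rw [Finset.sum_eq_single i]
    · rw [lift_pgen, Pi.single_eq_same, hBp.E, hw]
    · intro j _ hj
      rw [lift_pgen, Pi.single_eq_of_ne hj, map_zero, map_zero, LinearMap.zero_apply]
    · simp
  rw [h3 (fun j => f (d' (pgen k S.toQuiv (fun x => S.σ (y x)) j))) fun j => (hf.comp hd').E_pgen j,
    Finset.sum_congr rfl fun j _ => hBs (f _) _, ← Finset.mul_sum,
    h3 (fun j => f (d.tot (pgen k S.toQuiv (fun x => S.σ (y x)) j)))
      fun j => (hf.comp d.isMor_tot).E_pgen j] at h2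
  rw [map_sub, map_sub, h2, LinearMap.smul_apply, map_smul, map_smul, smul_eq_mul]
  ring

end SymQuiver


/-! ### Almost split sequences from symmetric resolutions -/

namespace QAct

section Pushout

variable {k : Type u} [Field k] {I A : Type} [Fintype I] {Q : Quiv I A}
  {M K P L : Type u} [AddCommGroup M] [Module k M] [AddCommGroup K] [Module k K]
  [AddCommGroup P] [Module k P] [AddCommGroup L] [Module k L]
  {m : QAct k Q M} {r : QAct k Q K} {q : QAct k Q P} {l : QAct k Q L}

/-- The pushout of a short exact sequence. -/
theorem exists_pushout [FiniteDimensional k P] [FiniteDimensional k L] {d : K →ₗ[k] P}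
    {p : P →ₗ[k] M} {e : K →ₗ[k] L} (hd : IsMor r q d) (hp : IsMor q m p) (he : IsMor r l e)
    (hinj : Function.Injective d) (hsurj : Function.Surjective p)
    (hex : LinearMap.range d = LinearMap.ker p) :
    ∃ (N : Type u) (_ : AddCommGroup N) (_ : Module k N) (_ : FiniteDimensional k N)
      (z : QAct k Q N) (f : L →ₗ[k] N) (g : N →ₗ[k] M) (t : P →ₗ[k] N),
      IsMor l z f ∧ IsMor z m g ∧ IsMor q z t ∧ Function.Injective f ∧ Function.Surjective g ∧
      LinearMap.range f = LinearMap.ker g ∧ (∀ v, f (e v) = t (d v)) ∧ (∀ v, g (t v) = p v) ∧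
      ∀ {L' : Type u} [AddCommGroup L'] [Module k L'] (l' : QAct k Q L') (h : L →ₗ[k] L')
        (s : P →ₗ[k] L'), IsMor l l' h → IsMor q l' s → (∀ v, h (e v) = s (d v)) →
        ∃ h', IsMor z l' h' ∧ h' ∘ₗ f = h := by
  -- The pushout is the quotient of `L × P` by the image of `(e, -d)`.
  let D : K →ₗ[k] L × P := e.prod (-d)
  have hD : IsMor r (l.prod q) D :=
    ⟨fun x v => Prod.ext (he.E x v) (by simp [D, hd.E, QAct.prod]),
      fun a v => Prod.ext (he.arr a v) (by simp [D, hd.arr, QAct.prod])⟩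
  let U := LinearMap.range D
  have hUE : ∀ x, ∀ v ∈ U, (l.prod q).E x v ∈ U := by
    rintro x _ ⟨v, rfl⟩
    exact ⟨_, hD.E x v⟩
  have hUa : ∀ a, ∀ v ∈ U, (l.prod q).arr a v ∈ U := by
    rintro x _ ⟨v, rfl⟩
    exact ⟨_, hD.arr x v⟩
  have hinl : IsMor l (l.prod q) (LinearMap.inl k L P) :=
    ⟨fun x v => Prod.ext rfl (map_zero (q.E x)).symm,
      fun a v => Prod.ext rfl (map_zero (q.arr a)).symm⟩
  have hinr : IsMor q (l.prod q) (LinearMap.inr k L P) :=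
    ⟨fun x v => Prod.ext (map_zero (l.E x)).symm rfl,
      fun a v => Prod.ext (map_zero (l.arr a)).symm rfl⟩
  have hsnd : IsMor (l.prod q) q (LinearMap.snd k L P) := ⟨fun _ _ => rfl, fun _ _ => rfl⟩
  have hfst : IsMor (l.prod q) l (LinearMap.fst k L P) := ⟨fun _ _ => rfl, fun _ _ => rfl⟩
  have hmk := (l.prod q).isMor_mkQ U hUE hUa
  have hpd : ∀ v, p (d v) = 0 := fun v => by
    have : d v ∈ LinearMap.ker p := hex ▸ ⟨v, rfl⟩
    exact this
  have hker : ∀ v : L × P, U.mkQ v = 0 → ∃ w, e w = v.1 ∧ -d w = v.2 := by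
    intro v hv
    obtain ⟨w, hw⟩ : v ∈ U := (Submodule.Quotient.mk_eq_zero U).1 hv
    exact ⟨w, congrArg Prod.fst hw, congrArg Prod.snd hw⟩
  obtain ⟨g, hg, hgU⟩ := hmk.exists_factor U.mkQ_surjective (hp.comp hsnd) (by
    intro v hv
    obtain ⟨w, -, hw⟩ := hker v hv
    rw [LinearMap.comp_apply, LinearMap.snd_apply, ← hw, map_neg, hpd, neg_zero])
  have hgU' : ∀ v, g (U.mkQ v) = p v.2 := LinearMap.congr_fun hgU
  refine ⟨(L × P) ⧸ U, inferInstance, inferInstance, inferInstance, (l.prod q).quot U hUE hUa,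
    U.mkQ ∘ₗ LinearMap.inl k L P, g, U.mkQ ∘ₗ LinearMap.inr k L P, hmk.comp hinl, hg,
    hmk.comp hinr, ?_, ?_, ?_, ?_, ?_, ?_⟩
  · rw [injective_iff_map_eq_zero]
    intro v hv
    obtain ⟨w, hw, hw'⟩ := hker _ hv
    have h0 : d w = d 0 := by
      rw [map_zero]
      exact neg_eq_zero.1 hw'
    rw [hinj h0, map_zero] at hw
    exact hw.symm
  · intro v
    obtain ⟨w, rfl⟩ := hsurj v
    exact ⟨U.mkQ (0, w), hgU' _⟩
  · ext v
    constructor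
    · rintro ⟨w, rfl⟩
      rw [LinearMap.mem_ker, LinearMap.comp_apply, hgU']
      exact map_zero p
    · intro hv
      obtain ⟨⟨a, b⟩, rfl⟩ := U.mkQ_surjective v
      rw [LinearMap.mem_ker, hgU'] at hv
      obtain ⟨w, hw⟩ : b ∈ LinearMap.range d := hex ▸ hv
      refine ⟨a + e w, ?_⟩
      refine (Submodule.Quotient.eq U).2 ⟨w, Prod.ext ?_ ?_⟩
      · change e w = a + e w - a
        abel
      · change -d w = 0 - b
        rw [hw, zero_sub]
  · intro v
    refine (Submodule.Quotient.eq U).2 ⟨v, Prod.ext ?_ ?_⟩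
    · change e v = e v - 0
      rw [sub_zero]
    · change -d v = 0 - d v
      rw [zero_sub]
  · exact fun v => hgU' _
  · intro L' _ _ l' h s hh hs hhs
    obtain ⟨h', hh', hh'U⟩ := hmk.exists_factor U.mkQ_surjective
      ((hh.comp hfst).add (hs.comp hsnd)) (by
        intro v hv
        obtain ⟨w, hw, hw'⟩ := hker v hv
        simp only [LinearMap.add_apply, LinearMap.comp_apply, LinearMap.fst_apply,
          LinearMap.snd_apply, ← hw, ← hw', hhs, map_neg, add_neg_cancel])
    refine ⟨h', hh', LinearMap.ext fun v => ?_⟩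
    have := LinearMap.congr_fun hh'U (v, 0)
    simp only [LinearMap.add_apply, LinearMap.comp_apply, LinearMap.fst_apply,
          LinearMap.snd_apply, map_zero, add_zero] at this
    exact this

end Pushout

variable {k : Type u} [Field k] {I A : Type} [Fintype I] [DecidableEq I] [Fintype A]
  {S : SymQuiver I A} {M N L : Type u} [AddCommGroup M] [Module k M] [AddCommGroup N] [Module k N]
  [AddCommGroup L] [Module k L] {ι : Type} [Fintype ι] [DecidableEq ι] {y : ι → I}
  {o : QAct k S.toQuiv M} {d : ProjTot k S.toQuiv (fun i => S.σ (y i)) →ₗ[k] ProjTot k S.toQuiv y}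
  {p : ProjTot k S.toQuiv y →ₗ[k] M}

/-- The trace of endomorphisms of `M`, extended to `Hom(⨁ P_{y i}, M)`, is the evaluation at a
morphism `⨁ P_{σ (y i)} → ∇M`. This morphism will define the almost split extension. -/
theorem exists_trace (hp : IsMor (pact k S.toQuiv y) o p) (hs : Function.Surjective p) :
    ∃ e : ProjTot k S.toQuiv (fun i => S.σ (y i)) →ₗ[k] Module.Dual k M,
      IsMor (pact k S.toQuiv fun i => S.σ (y i)) (o.dual S) e ∧ ∀ φ : M →ₗ[k] M, IsMor o o φ →
      ∑ i, e (pgen k S.toQuiv (fun i => S.σ (y i)) i) (φ (p (pgen k S.toQuiv y i))) =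
        LinearMap.trace k M φ := by
  -- Endomorphisms embed into `M ^ ι` by their values on the generators, so the trace extends to a
  -- functional on `M ^ ι`, whose components are the images of the generators under `e`.
  let R : Submodule k (M →ₗ[k] M) :=
    { carrier := {φ | IsMor o o φ}
      add_mem' := fun h h' => h.add h'
      zero_mem' := IsMor.zero
      smul_mem' := fun c _ h => h.smul c }
  let Φ : R →ₗ[k] (ι → M) :=
    LinearMap.pi fun i => (LinearMap.applyₗ (p (pgen k S.toQuiv y i))) ∘ₗ R.subtype
  have hΦ : Function.Injective Φ := by
    rw [injective_iff_map_eq_zero]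
    intro φ hφ
    have h1 : (φ : M →ₗ[k] M) ∘ₗ p = 0 := by
      have hφm : IsMor o o (φ : M →ₗ[k] M) := φ.2
      exact IsMor.proj_ext (hφm.comp hp) IsMor.zero fun i => congrFun hφ i
    refine Subtype.ext (LinearMap.ext fun m => ?_)
    obtain ⟨v, rfl⟩ := hs m
    exact LinearMap.congr_fun h1 v
  obtain ⟨r, hr⟩ := Φ.exists_leftInverse_of_injective (LinearMap.ker_eq_bot.2 hΦ)
  let F : (ι → M) →ₗ[k] k := LinearMap.trace k M ∘ₗ R.subtype ∘ₗ r
  have hF : ∀ φ (hφ : IsMor o o φ), F (fun i => φ (p (pgen k S.toQuiv y i))) =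
      LinearMap.trace k M φ := by
    intro φ hφ
    have := LinearMap.congr_fun hr ⟨φ, hφ⟩
    exact congrArg (fun ψ : R => LinearMap.trace k M ψ.1) this
  refine ⟨(o.dual S).lift _ fun i => F ∘ₗ LinearMap.single k (fun _ => M) i,
    (o.dual S).isMor_lift _ _, fun φ hφ => ?_⟩
  rw [← hF φ hφ, ← Finset.univ_sum_single (fun i => φ (p (pgen k S.toQuiv y i))), map_sum]
  refine Finset.sum_congr rfl fun i _ => ?_
  rw [lift_pgen]
  change F (Pi.single i (o.E (S.σ (S.σ (y i))) _)) = _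
  rw [S.σ_invol, ← hφ.E, hp.E_pgen]

/-- The extension defined by the trace is left almost split. -/
theorem exists_isLeftAS [CharZero k] [FiniteDimensional k M] (hQ : S.toQuiv.Acyclic)
    (ho : o.EndLocal) {η : k} (hη : η ≠ 0) (hr : IsMinRes o d p) (hadj : IsAdj S d (η • d)) :
    ∃ (e : ProjTot k S.toQuiv (fun i => S.σ (y i)) →ₗ[k] Module.Dual k M) (N : Type u)
      (_ : AddCommGroup N) (_ : Module k N) (_ : FiniteDimensional k N) (z : QAct k S.toQuiv N)
      (f : Module.Dual k M →ₗ[k] N) (g : N →ₗ[k] M) (t : ProjTot k S.toQuiv y →ₗ[k] N),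
      IsLeftAS S o z f g ∧ IsMor (pact k S.toQuiv y) z t ∧
      (∀ v, f (e v) = t (d v)) ∧ (∀ v, g (t v) = p v) ∧ ∀ φ : M →ₗ[k] M, IsMor o o φ →
      ∑ i, e (pgen k S.toQuiv (fun i => S.σ (y i)) i) (φ (p (pgen k S.toQuiv y i))) =
        LinearMap.trace k M φ := by
  have hfdy := finiteDimensional_proj (k := k) hQ y
  have := ho.nontrivial
  have hdim : (Module.finrank k M : k) ≠ 0 :=
    Nat.cast_ne_zero.2 (Module.finrank_pos (R := k) (M := M)).ne'
  obtain ⟨e, he, htr⟩ := exists_trace hr.mor_p hr.surj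
  obtain ⟨N, _, _, _, z, f, g, t, hf, hg, ht, hfi, hgs, hfg, hfe, hgt, huniv⟩ :=
    exists_pushout hr.mor_d hr.mor_p he hr.inj hr.surj hr.exact
  -- If `f` splits, then `e` extends along `d`, and by adjunction the trace of the identity
  -- vanishes.
  have hsec : ¬ ∃ r, IsMor z (o.dual S) r ∧ r ∘ₗ f = LinearMap.id := by
    rintro ⟨r, hrm, hrf⟩
    have h1 := htr LinearMap.id (IsMor.id o)
    rw [LinearMap.trace_id] at h1
    refine hdim (h1.symm.trans ?_)
    have h2 : ∀ v, e v = r (t (d v)) := by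
      intro v
      rw [← hfe]
      exact (LinearMap.congr_fun hrf (e v)).symm
    simp only [h2, LinearMap.id_apply]
    refine (hadj _ _ _ (isPairing_id o) _ _ (hrm.comp ht) hr.mor_p).trans ?_
    refine Finset.sum_eq_zero fun i _ => ?_
    rw [LinearMap.smul_apply, map_smul, hr.p_d, smul_zero, map_zero]
  refine ⟨e, N, _, _, inferInstance, z, f, g, t, ⟨hf, hg, hfi, hgs, hfg, hsec, ?_, ?_⟩, ht, hfe, hgt,
    htr⟩
  · rintro ⟨s, hs, hgs'⟩
    obtain ⟨r, hrm, hfr⟩ := hf.exists_lift hfi ((IsMor.id z).sub (hs.comp hg)) (by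
      intro n
      have h1 : g (s (g n)) = g n := LinearMap.congr_fun hgs' (g n)
      rw [hfg, LinearMap.mem_ker, LinearMap.sub_apply, map_sub, LinearMap.comp_apply, h1]
      exact sub_self _)
    refine hsec ⟨r, hrm, LinearMap.ext fun ξ => hfi ?_⟩
    have h1 := LinearMap.congr_fun hfr (f ξ)
    have h2 : g (f ξ) = 0 := by
      have : f ξ ∈ LinearMap.ker g := hfg ▸ ⟨ξ, rfl⟩
      exact this
    rw [LinearMap.comp_apply, LinearMap.sub_apply, LinearMap.comp_apply, h2, map_zero, sub_zero] at h1
    exact h1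
  · intro L _ _ _ l h hh hns
    -- Either `h ∘ e` extends along `d`, and `h` extends to the pushout, or some `u` detects the
    -- obstruction. Then `u` factors through `p` as `w ∘ p`, and the endomorphism `φ = hᵗ ∘ w` of `M`
    -- has nonzero trace. It is bijective, so `h` splits.
    rcases exists_factor_or_exists_dual (x' := y) (y' := fun i => S.σ (y i))
      (fun i => (S.σ_invol _).symm) (fun _ => rfl) hr.mor_d (hr.mor_d.smul η) hadj
      (isPairing_id l).flip (nondegenerate_flip nondegenerate_id) (hh.comp he) with
      ⟨s, hs, hsd⟩ | ⟨u, hu, hud, hne⟩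
    · exact huniv l h s hh hs fun v => (LinearMap.congr_fun hsd v).symm
    · exfalso
      obtain ⟨w, hw, hwp⟩ := hr.mor_p.exists_factor hr.surj hu (by
        intro v hv
        obtain ⟨v', rfl⟩ := hr.exists_of_p hv
        have := LinearMap.congr_fun hud v'
        rw [LinearMap.comp_apply, LinearMap.smul_apply, map_smul] at this
        exact (smul_eq_zero.1 this).resolve_left hη)
      obtain ⟨φ, hφ, hφw⟩ := (hw.isPairing.comp₂ hh).exists_eval
      have hφw' : ∀ m ξ, ξ (φ m) = w m (h ξ) := hφw
      have h1 : LinearMap.trace k M φ ≠ 0 := by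
        rw [← htr φ hφ]
        have h2 : ∀ v, u v = w (p v) := fun v => (LinearMap.congr_fun hwp v).symm
        simp only [hφw', ← h2]
        exact hne
      rcases ho.bijective_or_nilpotent φ hφ with hb | hn
      · obtain ⟨φ', hφ', hφ'l, hφ'r⟩ := hφ.ofBijective hb
        refine hns ⟨φ'.dualMap ∘ₗ (w : M →ₗ[k] Module.Dual k L).flip,
          hφ'.dualMap.comp (hw.isPairing.flip.isMor_dual), ?_⟩
        refine LinearMap.ext fun ξ => LinearMap.ext fun m => ?_
        change w (φ' m) (h ξ) = ξ m
        rw [← hφw']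
        exact congrArg ξ (LinearMap.congr_fun hφ'r m)
      · exact h1 (LinearMap.isNilpotent_trace_of_isNilpotent hn).eq_zero

/-- A symmetric invariant form on the middle term turns left almost split into right almost
split. -/
theorem IsLeftAS.isAS [FiniteDimensional k M] [FiniteDimensional k N] {z : QAct k S.toQuiv N}
    {f : Module.Dual k M →ₗ[k] N} {g : N →ₗ[k] M} (h : IsLeftAS S o z f g)
    {ψ : N →ₗ[k] N →ₗ[k] k} (hψ : IsPairing S z z ψ) (hψn : ψ.Nondegenerate) {χ : M →ₗ[k] M}
    (hχ : IsMor o o χ) (hχb : Function.Bijective χ) (hψf : ∀ ξ n, ψ (f ξ) n = ξ (χ (g n))) :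
    IsAS S o z f g := by
  refine ⟨h, ?_⟩
  intro L _ _ _ l t ht hns
  obtain ⟨χ', hχ', hl, hr⟩ := hχ.ofBijective hχb
  have hl' : ∀ m, χ' (χ m) = m := LinearMap.congr_fun hl
  have hr' : ∀ m, χ (χ' m) = m := LinearMap.congr_fun hr
  obtain ⟨s, hs, hsf⟩ := h.left (l.dual S) (χ ∘ₗ t).dualMap (hχ.comp ht).dualMap (by
    rintro ⟨r, hrm, hrt⟩
    obtain ⟨s, hs, hrs⟩ := hrm.exists_transpose
    refine hns ⟨s ∘ₗ χ, hs.comp hχ, LinearMap.ext fun m => hχb.1 ?_⟩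
    rw [← sub_eq_zero]
    refine (Module.forall_dual_apply_eq_zero_iff k _).1 fun ξ => ?_
    have h1 := hrs ((χ ∘ₗ t).dualMap ξ) (χ m)
    have h2 := LinearMap.congr_fun (LinearMap.congr_fun hrt ξ) (χ m)
    rw [map_sub, sub_eq_zero]
    exact h1.trans h2)
  obtain ⟨t', ht', hψt⟩ := hψ.flip.exists_repr (nondegenerate_flip hψn) hs.isPairing.flip
  refine ⟨t', ht', LinearMap.ext fun v => hχb.1 ?_⟩
  rw [← sub_eq_zero]
  refine (Module.forall_dual_apply_eq_zero_iff k _).1 fun ξ => ?_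
  rw [map_sub, sub_eq_zero, LinearMap.comp_apply, ← hψf]
  exact (hψt v (f ξ)).trans (LinearMap.congr_fun (LinearMap.congr_fun hsf ξ) v)

/-- A module with a minimal resolution that is `η` times its adjoint is the end of an almost split
sequence that starts with its dual, and whose middle term carries an `η`-symmetric form. -/
theorem exists_isAS [IsAlgClosed k] [CharZero k] [FiniteDimensional k M] (hQ : S.toQuiv.Acyclic)
    (ho : o.EndLocal) {η : k} (hη : η * η = 1) (hr : IsMinRes o d p) (hadj : IsAdj S d (η • d)) :
    ∃ (N : Type u) (_ : AddCommGroup N) (_ : Module k N) (_ : FiniteDimensional k N)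
      (z : QAct k S.toQuiv N) (f : Module.Dual k M →ₗ[k] N) (g : N →ₗ[k] M),
      IsAS S o z f g ∧ ∃ ψ : N →ₗ[k] N →ₗ[k] k, IsPairing S z z ψ ∧ ψ.Nondegenerate ∧
        ∀ v w, ψ v w = η * ψ w v := by
  have := ho.nontrivial
  have hη0 : η ≠ 0 := by
    rintro rfl
    simp at hη
  obtain ⟨e, N, _, _, _, z, f, g, t, h, ht, hfe, hgt, htr⟩ := exists_isLeftAS hQ ho hη0 hr hadj
  obtain ⟨b, hb, hbf⟩ := h.exists_pairing
  obtain ⟨φ, hφ, hbφ⟩ := h.exists_endo hb hbf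
  obtain ⟨s, n, hs⟩ := ho.exists_scalar hφ
  have hdim : (Module.finrank k M : k) ≠ 0 :=
    Nat.cast_ne_zero.2 (Module.finrank_pos (R := k) (M := M)).ne'
  -- Both sides of the adjunction for the pairing `b` are traces.
  have h1 : LinearMap.trace k M LinearMap.id = η * LinearMap.trace k M φ := by
    rw [← htr _ (IsMor.id o), ← htr φ hφ]
    have h2 := hadj _ _ b hb _ _ ht ht
    simp only [← hfe, hbf, hgt, LinearMap.smul_apply, map_smul, hbφ, smul_eq_mul,
      ← Finset.mul_sum] at h2
    exact h2
  have h2 : LinearMap.trace k M φ = s * Module.finrank k M := by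
    have h3 := (LinearMap.isNilpotent_trace_of_isNilpotent (⟨n, hs⟩ : IsNilpotent _)).eq_zero
    rw [map_sub, map_smul, LinearMap.trace_id, sub_eq_zero] at h3
    exact h3
  rw [LinearMap.trace_id, h2, ← mul_assoc] at h1
  have h3 : η * s = 1 := by
    have : (η * s - 1) * (Module.finrank k M : k) = 0 := by rw [sub_mul, ← h1]; ring
    exact sub_eq_zero.1 ((mul_eq_zero.1 this).resolve_right hdim)
  have h4 : s ≠ -η := by
    rintro rfl
    have : (2 : k) = 0 := by linear_combination -h3 - hη
    exact two_ne_zero this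
  obtain ⟨ψ, χ, hψ, hψn, hψs, hχ, hχb, hψf⟩ := h.exists_form hb hbf hbφ hφ hs hη h4
  exact ⟨N, _, _, inferInstance, z, f, g, h.isAS hψ hψn hχ hχb hψf, ψ, hψ, hψn, hψs⟩

end QAct


/-! ### Functionals on cochains and mesh relations -/

namespace QAct

section Trace

variable {k : Type u} [Field k] {M P : Type u} [AddCommGroup M] [Module k M]
  [AddCommGroup P] [Module k P]

/-- The trace pairing identifies the functionals on `Hom(M, P)` with `Hom(P, M)`. -/
theorem exists_trace_repr [FiniteDimensional k M] (F : (M →ₗ[k] P) →ₗ[k] k) :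
    ∃ N : P →ₗ[k] M, ∀ c, F c = LinearMap.trace k M (N ∘ₗ c) := by
  let b := Module.finBasis k M
  let G : P →ₗ[k] Module.Dual k (Module.Dual k M) :=
    LinearMap.mk₂ k (fun ξ ω => F (ω.smulRight ξ))
      (fun ξ ζ ω => by rw [← map_add]; congr 1; ext; simp)
      (fun c ξ ω => by rw [← map_smul]; congr 1; ext m; exact smul_comm (ω m) c ξ)
      (fun ξ ω ω' => by rw [← map_add]; congr 1; ext; simp [add_smul])
      (fun c ξ ω => by rw [← map_smul]; congr 1; ext; simp [mul_smul])
  let N : P →ₗ[k] M := (Module.evalEquiv k M).symm.toLinearMap ∘ₗ G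
  have hN : ∀ (ω : Module.Dual k M) (ξ : P), ω (N ξ) = F (ω.smulRight ξ) := fun ω ξ => by
    change ω ((Module.evalEquiv k M).symm (G ξ)) = _
    rw [Module.apply_evalEquiv_symm_apply]
    rfl
  refine ⟨N, fun c => ?_⟩
  have hc : c = ∑ j, (b.coord j).smulRight (c (b j)) := by
    refine b.ext fun i => ?_
    rw [LinearMap.sum_apply, Finset.sum_eq_single i]
    · simp
    · intro j _ hj
      simp [hj.symm]
    · simp
  rw [LinearMap.trace_eq_matrix_trace k b, Matrix.trace]
  conv_lhs => rw [hc, map_sum]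
  refine Finset.sum_congr rfl fun j _ => ?_
  rw [← hN, Matrix.diag_apply, LinearMap.toMatrix_apply]
  rfl

theorem trace_comp_smulRight [FiniteDimensional k M] (N : P →ₗ[k] M) (ω : Module.Dual k M) (ξ : P) :
    LinearMap.trace k M (N ∘ₗ ω.smulRight ξ) = ω (N ξ) := by
  have : N ∘ₗ ω.smulRight ξ = ω.smulRight (N ξ) := by ext; simp
  rw [this, LinearMap.trace_smulRight]

end Trace

section Mesh

variable {k : Type u} [Field k] {I A : Type} [Fintype I] [DecidableEq I] [Fintype A]
  [DecidableEq A] {Q : Quiv I A} {M P : Type u} [AddCommGroup M] [Module k M]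
  [AddCommGroup P] [Module k P] (o : QAct k Q M) (r : QAct k Q P)

/-- A homogeneous functional on the cochains `(c_a : M → P)` that vanishes on the coboundaries is
given by traces with maps `N_a : P → M` in the opposite direction, and the vanishing on the
coboundaries becomes a mesh relation. -/
theorem exists_mesh [FiniteDimensional k M] (F : (A → M →ₗ[k] P) →ₗ[k] k)
    (hcob : ∀ h : M →ₗ[k] P, (∀ x m, h (o.E x m) = r.E x (h m)) →
      F (fun a => r.arr a ∘ₗ h - h ∘ₗ o.arr a) = 0)
    (hE : ∀ c, F (fun a => r.E (Q.tgt a) ∘ₗ c a ∘ₗ o.E (Q.src a)) = F c) :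
    ∃ N : A → P →ₗ[k] M, (∀ c, F c = ∑ a, LinearMap.trace k M (N a ∘ₗ c a)) ∧
      (∀ a ξ, o.E (Q.src a) (N a ξ) = N a ξ) ∧ (∀ a ξ, N a (r.E (Q.tgt a) ξ) = N a ξ) ∧
      ∀ ξ, ∑ a, N a (r.arr a ξ) = ∑ a, o.arr a (N a ξ) := by
  choose N' hN' using fun a : A => exists_trace_repr (F ∘ₗ LinearMap.single k (fun _ => M →ₗ[k] P) a)
  let N : A → P →ₗ[k] M := fun a => o.E (Q.src a) ∘ₗ N' a ∘ₗ r.E (Q.tgt a)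
  have hN1 : ∀ a ξ, o.E (Q.src a) (N a ξ) = N a ξ := fun a ξ => o.E_same _ _
  have hN2 : ∀ a ξ, N a (r.E (Q.tgt a) ξ) = N a ξ := fun a ξ => by
    simp only [N, LinearMap.comp_apply, r.E_same]
  have hNF : ∀ c, F c = ∑ a, LinearMap.trace k M (N a ∘ₗ c a) := by
    intro c
    rw [← hE, ← Finset.univ_sum_single (fun a => r.E (Q.tgt a) ∘ₗ c a ∘ₗ o.E (Q.src a)), map_sum]
    refine Finset.sum_congr rfl fun a _ => (hN' a _).trans ?_
    rw [← LinearMap.comp_assoc, ← LinearMap.comp_assoc, LinearMap.trace_comp_comm']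
    rfl
  refine ⟨N, hNF, hN1, hN2, fun ξ => ?_⟩
  rw [← sub_eq_zero]
  refine (Module.forall_dual_apply_eq_zero_iff k _).1 fun ω => ?_
  -- The coboundary of the homogeneous part of the rank one map `ω ⊗ ξ` tests the mesh relation on
  -- `ξ` against `ω`.
  let h : M →ₗ[k] P := ∑ x, r.E x ∘ₗ ω.smulRight ξ ∘ₗ o.E x
  have hh : ∀ m, h m = ∑ x, ω (o.E x m) • r.E x ξ := fun m => by simp [h]
  have hl : ∀ x m, h (o.E x m) = ω (o.E x m) • r.E x ξ := by
    intro x m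
    rw [hh, Finset.sum_eq_single x]
    · rw [o.E_same]
    · intro z _ hz
      rw [o.E_ne _ _ _ hz, map_zero, zero_smul]
    · simp
  have hr : ∀ x m, r.E x (h m) = ω (o.E x m) • r.E x ξ := by
    intro x m
    rw [hh, map_sum, Finset.sum_eq_single x]
    · rw [map_smul, r.E_same]
    · intro z _ hz
      rw [map_smul, r.E_ne _ _ _ hz.symm, smul_zero]
    · simp
  have h0 := hcob h fun x m => (hl x m).trans (hr x m).symm
  rw [hNF] at h0
  have key : ∀ a, LinearMap.trace k M (N a ∘ₗ (r.arr a ∘ₗ h - h ∘ₗ o.arr a)) =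
      ω (N a (r.arr a ξ)) - ω (o.arr a (N a ξ)) := by
    intro a
    rw [LinearMap.comp_sub, map_sub]
    congr 1
    · have : N a ∘ₗ r.arr a ∘ₗ h = (N a ∘ₗ r.arr a ∘ₗ ω.smulRight ξ) ∘ₗ o.E (Q.src a) := by
        ext m
        simp only [LinearMap.comp_apply, LinearMap.smulRight_apply, map_smul]
        rw [← r.arr_E a (h m), hr, map_smul, map_smul, r.arr_E]
      rw [this, LinearMap.trace_comp_comm']
      refine (congrArg _ (LinearMap.ext fun m => ?_)).trans (trace_comp_smulRight (N a ∘ₗ r.arr a) ω ξ)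
      simp only [LinearMap.comp_apply, hN1]
    · have : N a ∘ₗ h ∘ₗ o.arr a = (N a ∘ₗ ω.smulRight ξ) ∘ₗ o.arr a := by
        ext m
        simp only [LinearMap.comp_apply, LinearMap.smulRight_apply, map_smul]
        rw [← o.E_arr a m, hl, map_smul, hN2, o.E_arr]
      rw [this, LinearMap.trace_comp_comm', ← LinearMap.comp_assoc]
      exact trace_comp_smulRight (o.arr a ∘ₗ N a) ω ξ
  simp only [key] at h0
  rw [map_sub, map_sum, map_sum, ← Finset.sum_sub_distrib, h0]

end Mesh

end QAct


/-! ### The mesh of a symmetric resolution -/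

namespace QAct

variable {k : Type u} [Field k] {I A : Type} [Fintype I] [DecidableEq I] [Fintype A]
  [DecidableEq A]

section Coordinates

variable {Q : Quiv I A} {ι : Type} [Fintype ι] [DecidableEq ι] {M : Type u} [AddCommGroup M]
  [Module k M]

theorem exists_arrCoord_eq (y : ι → I) (v : ProjTot k Q y) :
    v = ∑ i, topCoord k Q y v i • pgen k Q y i + ∑ a, (pact k Q y).arr a (arrCoord k y a v) := by
  obtain ⟨q, hq⟩ := exists_decomp y v
  have h : ∀ a, (pact k Q y).arr a (arrCoord k y a v) = (pact k Q y).arr a (q a) := by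
    intro a
    have : arrCoord k y a v = (pact k Q y).E (Q.src a) (q a) := by
      rw [hq, map_add, map_sum, map_sum, Finset.sum_eq_zero, zero_add, Finset.sum_eq_single a]
      · rw [arrCoord_arr, if_pos rfl]
      · intro b _ hb
        rw [arrCoord_arr, if_neg hb]
      · simp
      · intro i _
        rw [map_smul, arrCoord_pgen, smul_zero]
    rw [this, arr_E]
  simp only [h]
  exact hq

theorem arrCoord_E (y : ι → I) (a : A) (x : I) (v : ProjTot k Q y) :
    arrCoord k y a ((pact k Q y).E x v) = if x = Q.tgt a then arrCoord k y a v else 0 := by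
  rw [arrCoord, ext_E]
  by_cases h : x = Q.tgt a
  · simp [concAct, h]
  · simp [concAct, h]

theorem E_arrCoord (y : ι → I) (a : A) (v : ProjTot k Q y) :
    (pact k Q y).E (Q.src a) (arrCoord k y a v) = arrCoord k y a v := by
  obtain ⟨q, hq⟩ := exists_decomp y v
  rw [hq]
  simp only [map_add, map_sum, map_smul, arrCoord_pgen, smul_zero, map_zero, arrCoord_arr]
  congr 1
  refine Finset.sum_congr rfl fun b _ => ?_
  split_ifs with h
  · subst h
    exact (pact k Q y).E_same _ _
  · exact map_zero _

/-- A projective is the sum of its top and of one copy of its component at the tail of each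
arrow. -/
theorem finrank_proj (hQ : Q.Acyclic) (y : ι → I) :
    Module.finrank k (ProjTot k Q y) = Fintype.card ι +
      ∑ a, Module.finrank k (LinearMap.range ((pact k Q y).E (Q.src a))) := by
  have := finiteDimensional_proj (k := k) hQ y
  let f : ProjTot k Q y →ₗ[k] (ι → k) × (∀ a, LinearMap.range ((pact k Q y).E (Q.src a))) :=
    (topCoord k Q y).prod (LinearMap.pi fun a =>
      (arrCoord k y a).codRestrict _ fun v => ⟨_, E_arrCoord y a v⟩)
  have hf : Function.Bijective f := by
    constructor
    · rw [injective_iff_map_eq_zero]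
      intro v hv
      have h1 : topCoord k Q y v = 0 := congrArg Prod.fst hv
      have h2 : ∀ a, arrCoord k y a v = 0 := fun a =>
        congrArg Subtype.val (congrFun (congrArg Prod.snd hv) a)
      rw [exists_arrCoord_eq y v]
      simp [h1, h2]
    · rintro ⟨c, q⟩
      refine ⟨∑ i, c i • pgen k Q y i + ∑ a, (pact k Q y).arr a (q a), Prod.ext ?_ ?_⟩
      · change topCoord k Q y _ = c
        simp only [map_add, map_sum, map_smul, topCoord_pgen, topCoord_arr, Finset.sum_const_zero,
          add_zero]
        ext j
        simp [Pi.single_apply]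
      · funext a
        refine Subtype.ext ?_
        change arrCoord k (Q := Q) y a _ = (q a : ProjTot k Q y)
        simp only [map_add, map_sum, map_smul, arrCoord_pgen, smul_zero, Finset.sum_const_zero,
          zero_add]
        rw [Finset.sum_eq_single a]
        · obtain ⟨w, hw⟩ := (q a).2
          rw [arrCoord_arr, if_pos rfl, ← hw, E_same]
        · intro b _ hb
          rw [arrCoord_arr, if_neg hb]
        · simp
  rw [(LinearEquiv.ofBijective f hf).finrank_eq, Module.finrank_prod, Module.finrank_pi,
    Module.finrank_pi_fintype]

theorem finrank_range_E_add {L K : Type u} [AddCommGroup L] [Module k L] [AddCommGroup K]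
    [Module k K] [FiniteDimensional k L] [FiniteDimensional k K] {l : QAct k Q L} {q : QAct k Q K}
    {o : QAct k Q M} {d : L →ₗ[k] K} {p : K →ₗ[k] M} (hd : IsMor l q d) (hp : IsMor q o p)
    (hi : Function.Injective d) (hs : Function.Surjective p)
    (he : LinearMap.range d = LinearMap.ker p) (x : I) :
    Module.finrank k (LinearMap.range (o.E x)) + Module.finrank k (LinearMap.range (l.E x)) =
      Module.finrank k (LinearMap.range (q.E x)) := by
  let g : LinearMap.range (q.E x) →ₗ[k] LinearMap.range (o.E x) := p.restrict (by
    rintro _ ⟨v, rfl⟩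
    exact ⟨p v, (hp.E _ _).symm⟩)
  let f : LinearMap.range (l.E x) →ₗ[k] LinearMap.range (q.E x) := d.restrict (by
    rintro _ ⟨v, rfl⟩
    exact ⟨d v, (hd.E _ _).symm⟩)
  have hg : Function.Surjective g := by
    rintro ⟨_, ⟨m, rfl⟩⟩
    obtain ⟨v, rfl⟩ := hs m
    exact ⟨⟨q.E x v, v, rfl⟩, Subtype.ext (hp.E _ _)⟩
  have hf : Function.Injective f := fun v w h => Subtype.ext (hi (congrArg Subtype.val h))
  have hfg : LinearMap.range f = LinearMap.ker g := by
    ext ⟨v, hv⟩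
    constructor
    · rintro ⟨w, hw⟩
      have h1 : d w ∈ LinearMap.ker p := he ▸ ⟨_, rfl⟩
      have h2 : d w = v := congrArg Subtype.val hw
      rw [h2] at h1
      exact Subtype.ext h1
    · intro h
      have h1 : v ∈ LinearMap.range d := by
        rw [he]
        exact congrArg Subtype.val h
      obtain ⟨w, rfl⟩ := h1
      obtain ⟨u, hu⟩ := hv
      refine ⟨⟨l.E x w, w, rfl⟩, Subtype.ext ?_⟩
      change d (l.E x w) = d w
      rw [hd.E, ← hu, E_same]
  rw [← LinearMap.finrank_range_add_finrank_ker g, LinearMap.range_eq_top.2 hg, finrank_top, ← hfg,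
    LinearMap.finrank_range_of_inj hf]

/-- The dimension of a module whose minimal resolution has terms with equally many summands. -/
theorem IsMinRes.finrank_eq (hQ : Q.Acyclic) {x y : ι → I} {o : QAct k Q M}
    {d : ProjTot k Q x →ₗ[k] ProjTot k Q y} {p : ProjTot k Q y →ₗ[k] M} (h : IsMinRes o d p) :
    Module.finrank k M = ∑ a, Module.finrank k (LinearMap.range (o.E (Q.src a))) := by
  have := finiteDimensional_proj (k := k) hQ y
  have := finiteDimensional_proj (k := k) hQ x
  have h1 := finrank_proj (k := k) hQ x
  have h2 := finrank_proj (k := k) hQ y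
  have h3 := LinearMap.finrank_range_add_finrank_ker p
  rw [LinearMap.range_eq_top.2 h.surj, finrank_top, ← h.exact,
    LinearMap.finrank_range_of_inj h.inj] at h3
  have h4 := Finset.sum_congr rfl fun a (_ : a ∈ Finset.univ) =>
    finrank_range_E_add h.mor_d h.mor_p h.inj h.surj h.exact (Q.src a)
  rw [Finset.sum_add_distrib] at h4
  omega

end Coordinates

end QAct


namespace QAct

variable {k : Type u} [Field k] {I A : Type} [Fintype I] [DecidableEq I] [Fintype A]
  [DecidableEq A]

theorem ext_add {Q : Quiv I A} {ι : Type} {M : Type u} [AddCommGroup M] [Module k M]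
    (o : QAct k Q M) {y : ι → I} (c c' : A → ProjTot k Q y →ₗ[k] M) :
    o.ext (c + c') 0 = o.ext c 0 + o.ext c' 0 := by
  refine proj_hom_ext o (fun i => by simp [ext_pgen]) fun a v hv => ?_
  simp only [LinearMap.add_apply, ext_arr, Pi.add_apply, map_add] at hv ⊢
  rw [hv, map_add]
  abel

theorem ext_smul {Q : Quiv I A} {ι : Type} {M : Type u} [AddCommGroup M] [Module k M]
    (o : QAct k Q M) {y : ι → I} (t : k) (c : A → ProjTot k Q y →ₗ[k] M) :
    o.ext (t • c) 0 = t • o.ext c 0 := by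
  refine proj_hom_ext o (fun i => by simp [ext_pgen]) fun a v hv => ?_
  simp only [LinearMap.smul_apply, ext_arr, Pi.smul_apply, map_smul, smul_add] at hv ⊢
  rw [hv, map_smul]

/-- The mesh of a module `M`: maps `N_a : ∇M → M` which, together with the arrows of `∇M` and of
`M`, form an exact sequence `0 → ∇M → ⨁_a (∇M)(ha) ⊕ M(ta) → M → 0`. The scalar `c` is the sign in
the mesh relation. -/
structure IsMesh (S : SymQuiver I A) {M : Type u} [AddCommGroup M] [Module k M]
    (o : QAct k S.toQuiv M) (c : k) (N : A → Module.Dual k M →ₗ[k] M) : Prop where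
  E_src : ∀ a α, o.E (S.src a) (N a α) = N a α
  E_tgt : ∀ a α, N a ((o.dual S).E (S.tgt a) α) = N a α
  mesh : ∀ α, ∑ a, N a ((o.dual S).arr a α) = c • ∑ a, o.arr a (N a α)
  inj : ∀ α, (∀ a, (o.dual S).arr a α = 0) → (∀ a, N a α = 0) → α = 0
  surj : ∀ m, ∃ (α : A → Module.Dual k M) (v : A → M), m = ∑ a, N a (α a) + ∑ a, o.arr a (v a)
  exact : ∀ (α : A → Module.Dual k M) (v : A → M), (∀ a, (o.dual S).E (S.tgt a) (α a) = α a) →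
    (∀ a, o.E (S.src a) (v a) = v a) → ∑ a, N a (α a) = c • ∑ a, o.arr a (v a) →
    ∃ β, ∀ a, (o.dual S).arr a β = α a ∧ N a β = v a

variable {S : SymQuiver I A} {M : Type u} [AddCommGroup M] [Module k M] {ι : Type} [Fintype ι]
  [DecidableEq ι] {y : ι → I} {o : QAct k S.toQuiv M}
  {d : ProjTot k S.toQuiv (fun i => S.σ (y i)) →ₗ[k] ProjTot k S.toQuiv y}
  {p : ProjTot k S.toQuiv y →ₗ[k] M}

/-- The functional on the cochains `(c_a : M → ∇M)` that is dual to a symmetric resolution: the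
cochain becomes trivial on `⨁ P_{y i}`, and its trivialization is evaluated on the relations. -/
noncomputable def resFunctional (o : QAct k S.toQuiv M)
    (d : ProjTot k S.toQuiv (fun i => S.σ (y i)) →ₗ[k] ProjTot k S.toQuiv y)
    (p : ProjTot k S.toQuiv y →ₗ[k] M) : (A → M →ₗ[k] Module.Dual k M) →ₗ[k] k where
  toFun c := ∑ i, (o.dual S).ext (fun a => c a ∘ₗ p) 0
    (d (pgen k S.toQuiv (fun i => S.σ (y i)) i)) (p (pgen k S.toQuiv y i))
  map_add' c c' := by
    have : (fun a => (c + c') a ∘ₗ p) = (fun a => c a ∘ₗ p) + fun a => c' a ∘ₗ p := by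
      funext a
      exact LinearMap.add_comp _ _ _
    rw [this, ext_add, ← Finset.sum_add_distrib]
    rfl
  map_smul' t c := by
    have : (fun a => (t • c) a ∘ₗ p) = t • fun a => c a ∘ₗ p := by
      funext a
      exact LinearMap.smul_comp _ _ _
    rw [this, ext_smul, RingHom.id_apply, smul_eq_mul, Finset.mul_sum]
    rfl

theorem resFunctional_coboundary {η : k} (hr : IsMinRes o d p) (hadj : IsAdj S d (η • d))
    {h : M →ₗ[k] Module.Dual k M} (hh : ∀ x m, h (o.E x m) = (o.dual S).E x (h m)) :
    resFunctional o d p (fun a => (o.dual S).arr a ∘ₗ h - h ∘ₗ o.arr a) = 0 := by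
  let L := (o.dual S).ext (fun a => ((o.dual S).arr a ∘ₗ h - h ∘ₗ o.arr a) ∘ₗ p) 0
  -- The trivialization of a coboundary differs from a morphism by `h ∘ p`, which vanishes on the
  -- relations.
  have hm : IsMor (pact k S.toQuiv y) (o.dual S) (L + h ∘ₗ p) := by
    refine ⟨fun x v => ?_, fun a v => ?_⟩
    · simp only [LinearMap.add_apply, LinearMap.comp_apply, L, ext_E, hr.mor_p.E, hh, map_add]
    · simp only [LinearMap.add_apply, LinearMap.comp_apply, L, ext_arr, hr.mor_p.arr, hr.mor_p.E,
        LinearMap.sub_apply, arr_E, hh, map_add, map_sub, E_arr]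
      rw [← hh, E_arr]
      abel
  have h1 : ∀ v, L (d v) = (L + h ∘ₗ p) (d v) := fun v => by
    rw [LinearMap.add_apply, LinearMap.comp_apply, hr.p_d, map_zero, add_zero]
  change ∑ i, L (d _) _ = 0
  simp only [h1]
  refine (hadj _ _ _ (isPairing_id o) _ _ hm hr.mor_p).trans (Finset.sum_eq_zero fun i _ => ?_)
  rw [LinearMap.smul_apply, map_smul, hr.p_d, smul_zero, map_zero]

theorem resFunctional_E (hr : IsMinRes o d p) (c : A → M →ₗ[k] Module.Dual k M) :
    resFunctional o d p (fun a => (o.dual S).E (S.tgt a) ∘ₗ c a ∘ₗ o.E (S.src a)) =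
      resFunctional o d p c := by
  have : (o.dual S).ext (fun a => ((o.dual S).E (S.tgt a) ∘ₗ c a ∘ₗ o.E (S.src a)) ∘ₗ p) 0 =
      (o.dual S).ext (fun a => c a ∘ₗ p) (0 : ι → _) := by
    refine proj_hom_ext (o.dual S) (fun i => by simp [ext_pgen]) fun a v hv => ?_
    rw [ext_arr, ext_arr, hv]
    simp only [LinearMap.comp_apply, E_same, hr.mor_p.E]
  change ∑ i, (o.dual S).ext _ 0 _ _ = ∑ i, (o.dual S).ext _ 0 _ _
  rw [this]

/-- The extension of `M` by `∇M` that is defined by a cochain. -/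
def cochainAct (o : QAct k S.toQuiv M) (c : A → M →ₗ[k] Module.Dual k M) :
    QAct k S.toQuiv (Module.Dual k M × M) where
  E x := ((o.dual S).E x).prodMap (o.E x)
  arr a := (((o.dual S).arr a).coprod ((o.dual S).E (S.tgt a) ∘ₗ c a ∘ₗ o.E (S.src a))).prod
    (o.arr a ∘ₗ LinearMap.snd k _ _)
  E_same x m := Prod.ext ((o.dual S).E_same _ _) (o.E_same _ _)
  E_ne x y m h := Prod.ext ((o.dual S).E_ne _ _ _ h) (o.E_ne _ _ _ h)
  sum_E m := by
    refine Prod.ext ?_ ?_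
    · simpa [Prod.fst_sum] using (o.dual S).sum_E m.1
    · simpa [Prod.snd_sum] using o.sum_E m.2
  E_arr a m := by
    refine Prod.ext ?_ (o.E_arr _ _)
    change (o.dual S).E _ ((o.dual S).arr a m.1 + (o.dual S).E _ _) = _
    rw [map_add, E_arr, E_same]
    rfl
  arr_E a m := by
    refine Prod.ext ?_ (o.arr_E _ _)
    change (o.dual S).arr a ((o.dual S).E _ m.1) + (o.dual S).E _ (c a (o.E _ (o.E _ _))) = _
    rw [arr_E, E_same]
    rfl

/-- The extensions defined by a cochain and by minus its transpose are dual to each other. The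
adjunction for this pairing yields the symmetry of the functional. -/
theorem resFunctional_symm {η : k} (hr : IsMinRes o d p) (hadj : IsAdj S d (η • d))
    (c : A → M →ₗ[k] Module.Dual k M) :
    resFunctional o d p c = η * resFunctional o d p (fun a => -(c (S.σ₁ a)).flip) := by
  let c' : A → M →ₗ[k] Module.Dual k M := fun a => -(c (S.σ₁ a)).flip
  let b : (Module.Dual k M × M) →ₗ[k] (Module.Dual k M × M) →ₗ[k] k :=
    LinearMap.mk₂ k (fun v w => v.1 w.2 + w.1 v.2)
      (fun _ _ _ => by simp only [Prod.fst_add, Prod.snd_add, LinearMap.add_apply, map_add]; ring)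
      (fun _ _ _ => by simp only [Prod.smul_fst, Prod.smul_snd, LinearMap.smul_apply, map_smul, smul_eq_mul]; ring)
      (fun _ _ _ => by simp only [Prod.fst_add, Prod.snd_add, LinearMap.add_apply, map_add]; ring)
      (fun _ _ _ => by simp only [Prod.smul_fst, Prod.smul_snd, LinearMap.smul_apply, map_smul, smul_eq_mul]; ring)
  have hb : IsPairing S (o.cochainAct c) (o.cochainAct c') b := by
    refine ⟨fun x v w => ?_, fun a v w => ?_⟩
    · change v.1 (o.E _ w.2) + w.1 (o.E x v.2) = v.1 (o.E _ w.2) + w.1 (o.E (S.σ (S.σ x)) v.2)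
      rw [S.σ_invol]
    · change (-(v.1 (o.arr (S.σ₁ a) w.2)) + c a (o.E (S.src a) v.2) (o.E (S.σ (S.tgt a)) w.2)) +
        w.1 (o.arr a v.2) = -(v.1 (o.arr (S.σ₁ a) w.2) + (-(w.1 (o.arr (S.σ₁ (S.σ₁ a)) v.2)) +
          -(c (S.σ₁ (S.σ₁ a)) (o.E (S.σ (S.tgt (S.σ₁ a))) v.2) (o.E (S.src (S.σ₁ a)) w.2))))
      rw [S.σ₁_invol, S.tgt_σ₁, S.src_σ₁, S.σ_invol]
      ring
  have hmor : ∀ c : A → M →ₗ[k] Module.Dual k M, IsMor (pact k S.toQuiv y) (o.cochainAct c)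
      (((o.dual S).ext (fun a => c a ∘ₗ p) 0).prod p) := by
    intro c
    refine ⟨fun x v => Prod.ext (ext_E _ _ _ _ _) (hr.mor_p.E _ _), fun a v =>
      Prod.ext ?_ (hr.mor_p.arr _ _)⟩
    change (o.dual S).ext _ 0 _ = (o.dual S).arr a _ + (o.dual S).E _ (c a (o.E _ (p v)))
    rw [ext_arr, LinearMap.comp_apply, hr.mor_p.E]
    rfl
  have h := hadj _ _ b hb _ _ (hmor c) (hmor c')
  have h1 : ∀ v w, b (((o.dual S).ext (fun a => c a ∘ₗ p) 0).prod p (d v))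
      (((o.dual S).ext (fun a => c' a ∘ₗ p) 0).prod p w) =
        (o.dual S).ext (fun a => c a ∘ₗ p) 0 (d v) (p w) := by
    intro v w
    change _ + (o.dual S).ext _ 0 w (p (d v)) = _
    rw [hr.p_d, map_zero, add_zero]
    rfl
  have h2 : ∀ v w, b (((o.dual S).ext (fun a => c a ∘ₗ p) 0).prod p w)
      (((o.dual S).ext (fun a => c' a ∘ₗ p) 0).prod p ((η • d) v)) =
        η * (o.dual S).ext (fun a => c' a ∘ₗ p) 0 (d v) (p w) := by
    intro v w
    rw [LinearMap.smul_apply, map_smul, map_smul]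
    change η * ((o.dual S).ext _ 0 w (p (d v)) + _) = _
    rw [hr.p_d, map_zero, zero_add]
    rfl
  simp only [h1, h2] at h
  rw [← Finset.mul_sum] at h
  exact h

theorem resFunctional_single_eq {α : Module.Dual k M}
    (hr : IsMinRes o d p) (hα : ∀ b, (o.dual S).arr b α = 0) (a : A) (ω : Module.Dual k M) :
    resFunctional o d p (Pi.single a (ω.smulRight α)) = ω (p (∑ i, α (p (pgen k S.toQuiv y i)) •
      arrCoord k (Q := S.toQuiv) y a (d (pgen k S.toQuiv (fun i => S.σ (y i)) i)))) := by
  have h1 : (o.dual S).ext (fun b => (Pi.single a (ω.smulRight α) : A → M →ₗ[k] Module.Dual k M) b ∘ₗ p) 0 =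
      (ω ∘ₗ p ∘ₗ arrCoord k (Q := S.toQuiv) y a).smulRight ((o.dual S).E (S.tgt a) α) := by
    refine proj_hom_ext (o.dual S) (fun i => ?_) fun b v hv => ?_
    · rw [ext_pgen, LinearMap.smulRight_apply, LinearMap.comp_apply, LinearMap.comp_apply,
        arrCoord_pgen]
      simp
    · rw [ext_arr, hv]
      simp only [LinearMap.smulRight_apply, LinearMap.comp_apply, map_smul]
      have h2 : (o.dual S).arr b ((o.dual S).E (S.tgt a) α) = 0 := by
        by_cases h : S.src b = S.tgt a
        · rw [← h, arr_E, hα]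
        · exact arr_E_ne _ h _
      rw [h2, smul_zero, zero_add, arrCoord_arr]
      by_cases h : b = a
      · subst h
        rw [Pi.single_eq_same, if_pos rfl, LinearMap.smulRight_apply, map_smul]
      · rw [Pi.single_eq_of_ne h, if_neg h, LinearMap.zero_apply, map_zero, map_zero, map_zero,
          zero_smul]
  change ∑ i, (o.dual S).ext _ 0 _ _ = _
  rw [h1, map_sum, map_sum]
  refine Finset.sum_congr rfl fun i _ => ?_
  simp only [LinearMap.smulRight_apply, LinearMap.comp_apply, map_smul, LinearMap.smul_apply,
    smul_eq_mul]
  change _ * α (o.E (S.σ (S.tgt a)) _) = _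
  by_cases h : S.σ (y i) = S.tgt a
  · rw [← h, S.σ_invol, hr.mor_p.E_pgen, mul_comm]
  · rw [← hr.mor_d.E_pgen i, arrCoord_E, if_neg h]
    simp

/-- An element of `∇M` that is killed by the arrows and by the mesh maps vanishes. -/
theorem eq_zero_of_resFunctional {α : Module.Dual k M} (hr : IsMinRes o d p)
    (hα : ∀ b, (o.dual S).arr b α = 0)
    (h : ∀ a (ω : Module.Dual k M), resFunctional o d p (Pi.single a (ω.smulRight α)) = 0) : α = 0 := by
  -- The `a`-components of the relation `∑ α (p g_i) • d g'_i` lie in the image of `d`, so that the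
  -- element `∑ α (p g_i) • g'_i` lies in the radical and its coefficients vanish.
  have h1 : ∀ a, ∃ r, d r = ∑ i, α (p (pgen k S.toQuiv y i)) •
      arrCoord k (Q := S.toQuiv) y a (d (pgen k S.toQuiv (fun i => S.σ (y i)) i)) := fun a =>
    hr.exists_of_p <| (Module.forall_dual_apply_eq_zero_iff k _).1 fun ω => by
      rw [← resFunctional_single_eq hr hα]
      exact h a ω
  choose r hr' using h1
  have h2 : ∑ i, α (p (pgen k S.toQuiv y i)) • pgen k S.toQuiv (fun i => S.σ (y i)) i =
      ∑ a, (pact k S.toQuiv _).arr a (r a) := by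
    apply hr.inj
    simp only [map_sum, map_smul, hr.mor_d.arr, hr']
    rw [Finset.sum_comm]
    refine Finset.sum_congr rfl fun i _ => ?_
    rw [← Finset.smul_sum]
    congr 1
    conv_lhs => rw [exists_arrCoord_eq y (d _), hr.top _ (hr.p_d _)]
    simp
  have h3 : ∀ i, α (p (pgen k S.toQuiv y i)) = 0 := by
    intro i
    have h4 := congrFun (congrArg (topCoord k S.toQuiv (fun i => S.σ (y i))) h2) i
    simpa [topCoord_pgen, topCoord_arr, Pi.single_apply] using h4
  refine LinearMap.ext fun m => ?_
  obtain ⟨v, rfl⟩ := hr.surj m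
  rw [exists_arrCoord_eq y v]
  have h5 : ∀ b m, α (o.arr b m) = 0 := by
    intro b m
    have h6 := LinearMap.congr_fun (hα (S.σ₁ b)) m
    change -(α (o.arr (S.σ₁ (S.σ₁ b)) m)) = 0 at h6
    rw [S.σ₁_invol] at h6
    exact neg_eq_zero.1 h6
  simp only [map_add, map_sum, map_smul, h3, hr.mor_p.arr, h5, smul_zero, Finset.sum_const_zero,
    add_zero, LinearMap.zero_apply]

theorem finrank_range_dual_E [FiniteDimensional k M] (o : QAct k S.toQuiv M) (x : I) :
    Module.finrank k (LinearMap.range ((o.dual S).E x)) =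
      Module.finrank k (LinearMap.range (o.E (S.σ x))) :=
  LinearMap.finrank_range_dualMap_eq_finrank_range _

/-- A symmetric resolution provides a mesh. The exactness in the middle follows from the one at the
ends by comparing dimensions. -/
theorem exists_isMesh [FiniteDimensional k M] (hQ : S.toQuiv.Acyclic) {η : k} (hη : η ≠ 0)
    (hr : IsMinRes o d p) (hadj : IsAdj S d (η • d)) : ∃ N, IsMesh S o 1 N := by
  obtain ⟨N, hN, hN1, hN2, hN3⟩ := exists_mesh o (o.dual S) (resFunctional o d p)
    (fun h hh => resFunctional_coboundary hr hadj hh) (resFunctional_E hr)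
  have hNF : ∀ a (ω α : Module.Dual k M),
      resFunctional o d p (Pi.single a (ω.smulRight α)) = ω (N a α) := by
    intro a ω α
    rw [hN, Finset.sum_eq_single a]
    · rw [Pi.single_eq_same, trace_comp_smulRight]
    · intro b _ hb
      rw [Pi.single_eq_of_ne hb, LinearMap.comp_zero, map_zero]
    · simp
  -- The symmetry of the functional makes `N` skew-symmetric up to `η`, so that surjectivity of the
  -- last map is dual to injectivity of the first.
  have hsymm : ∀ a (ω α : Module.Dual k M), ω (N a α) = -(η * α (N (S.σ₁ a) ω)) := by
    intro a ω α
    rw [← hNF, ← hNF, resFunctional_symm hr hadj, ← mul_neg, ← map_neg]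
    congr 2
    funext b
    rw [Pi.neg_apply]
    congr 1
    by_cases h : S.σ₁ b = a
    · subst h
      rw [S.σ₁_invol, Pi.single_eq_same, Pi.single_eq_same]
      ext v w
      simp [mul_comm]
    · have h' : b ≠ S.σ₁ a := fun h' => h (by rw [h', S.σ₁_invol])
      rw [Pi.single_eq_of_ne h, Pi.single_eq_of_ne h']
      rfl
  have hinj : ∀ α, (∀ a, (o.dual S).arr a α = 0) → (∀ a, N a α = 0) → α = 0 := fun α h1 h2 =>
    eq_zero_of_resFunctional hr h1 fun a ω => by rw [hNF, h2, map_zero]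
  let Φ : Module.Dual k M →ₗ[k] (∀ a, LinearMap.range ((o.dual S).E (S.tgt a))) ×
      (∀ a, LinearMap.range (o.E (S.src a))) :=
    (LinearMap.pi fun a => ((o.dual S).arr a).codRestrict _ fun α =>
      LinearMap.mem_range.2 ⟨_, (o.dual S).E_arr a α⟩).prod
      (LinearMap.pi fun a => (N a).codRestrict _ fun α => LinearMap.mem_range.2 ⟨_, hN1 a α⟩)
  let Ψ : (∀ a, LinearMap.range ((o.dual S).E (S.tgt a))) × (∀ a, LinearMap.range (o.E (S.src a)))
      →ₗ[k] M :=
    (∑ a, N a ∘ₗ Submodule.subtype _ ∘ₗ LinearMap.proj a) ∘ₗ LinearMap.fst k _ _ -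
      (∑ a, o.arr a ∘ₗ Submodule.subtype _ ∘ₗ LinearMap.proj a) ∘ₗ LinearMap.snd k _ _
  have hΨ : ∀ w, Ψ w = ∑ a, N a (w.1 a) - ∑ a, o.arr a (w.2 a) := fun w => by simp [Ψ]
  have hΦ : Function.Injective Φ := by
    rw [injective_iff_map_eq_zero]
    intro α h
    exact hinj α (fun a => congrArg Subtype.val (congrFun (congrArg Prod.fst h) a))
      fun a => congrArg Subtype.val (congrFun (congrArg Prod.snd h) a)
  have hΨs : Function.Surjective Ψ := by
    rw [← LinearMap.range_eq_top, ← Submodule.dualAnnihilator_eq_bot_iff, eq_bot_iff]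
    intro ω hω
    rw [Submodule.mem_dualAnnihilator] at hω
    have h1 : ∀ a α, ω (N a α) = 0 := by
      intro a α
      rw [← hω _ ⟨(Pi.single a ⟨(o.dual S).E (S.tgt a) α, LinearMap.mem_range_self _ _⟩, 0), rfl⟩, hΨ,
        Finset.sum_eq_single a]
      · simp [hN2]
      · intro b _ hb
        exact (congrArg (fun z => N b (Subtype.val z)) (Pi.single_eq_of_ne hb _)).trans (map_zero _)
      · simp
    have h2 : ∀ a m, ω (o.arr a m) = 0 := by
      intro a m
      rw [← neg_eq_zero, ← map_neg, ← hω _ ⟨(0, Pi.single a ⟨o.E (S.src a) m, LinearMap.mem_range_self _ _⟩), rfl⟩, hΨ,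
        Finset.sum_eq_single (f := fun b => o.arr b _) a]
      · simp [arr_E]
      · intro b _ hb
        exact (congrArg (fun z => o.arr b (Subtype.val z)) (Pi.single_eq_of_ne hb _)).trans
          (map_zero _)
      · simp
    refine hinj ω (fun a => LinearMap.ext fun m => ?_) fun a => ?_
    · change -(ω (o.arr (S.σ₁ a) m)) = 0
      rw [h2, neg_zero]
    · refine (Module.forall_dual_apply_eq_zero_iff k _).1 fun ξ => ?_
      rw [hsymm, h1, mul_zero, neg_zero]
  have hle : LinearMap.range Φ ≤ LinearMap.ker Ψ := by
    rintro _ ⟨α, rfl⟩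
    rw [LinearMap.mem_ker, hΨ, sub_eq_zero]
    exact hN3 α
  have hdim : Module.finrank k (LinearMap.range Φ) = Module.finrank k (LinearMap.ker Ψ) := by
    have h1 := LinearMap.finrank_range_add_finrank_ker Ψ
    rw [LinearMap.range_eq_top.2 hΨs, finrank_top, Module.finrank_prod, Module.finrank_pi_fintype,
      Module.finrank_pi_fintype, ← hr.finrank_eq hQ] at h1
    have h2 : ∑ a, Module.finrank k (LinearMap.range ((o.dual S).E (S.tgt a))) =
        Module.finrank k M := by
      rw [hr.finrank_eq hQ]
      refine Eq.trans (Finset.sum_congr rfl fun a _ => ?_)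
        (Equiv.sum_comp ⟨S.σ₁, S.σ₁, S.σ₁_invol, S.σ₁_invol⟩
          fun a => Module.finrank k (LinearMap.range (o.E (S.src a))))
      rw [finrank_range_dual_E, Equiv.coe_fn_mk, S.src_σ₁]
    rw [LinearMap.finrank_range_of_inj hΦ, Subspace.dual_finrank_eq]
    omega
  have heq := Submodule.eq_of_le_of_finrank_eq hle hdim
  refine ⟨N, hN1, hN2, fun α => by rw [one_smul, hN3], hinj, fun m => ?_, fun α v hα hv h => ?_⟩
  · obtain ⟨w, rfl⟩ := hΨs m
    refine ⟨fun a => w.1 a, fun a => -w.2 a, ?_⟩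
    rw [hΨ]
    simp [sub_eq_add_neg]
  · obtain ⟨β, hβ⟩ : ((fun a => ⟨α a, LinearMap.mem_range.2 ⟨α a, hα a⟩⟩,
          fun a => ⟨v a, LinearMap.mem_range.2 ⟨v a, hv a⟩⟩) :
        (∀ a, LinearMap.range ((o.dual S).E (S.tgt a))) × (∀ a, LinearMap.range (o.E (S.src a)))) ∈
        LinearMap.range Φ := by
      rw [heq, LinearMap.mem_ker, hΨ, sub_eq_zero]
      rw [one_smul] at h
      exact h
    exact ⟨β, fun a => ⟨congrArg Subtype.val (congrFun (congrArg Prod.fst hβ) a),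
      congrArg Subtype.val (congrFun (congrArg Prod.snd hβ) a)⟩⟩

end QAct


/-! ### Bipartite quivers and odd cycles -/

namespace Quiv

variable {I A : Type}

/-- Every arrow connects a vertex of one colour with a vertex of the other colour. -/
def Bipartite (Q : Quiv I A) : Prop := ∃ s : I → Bool, ∀ a, s (Q.tgt a) = !s (Q.src a)

theorem IsDTilde.bipartite {Q : Quiv I A} (h : Q.IsDTilde) : Q.Bipartite := by
  obtain ⟨n, hn, e, f, h⟩ := h
  -- The two short branches at either end are folded onto the path `1 - 2 - ⋯ - (n - 1)`.
  let q : ℕ → ℕ := fun i => if i = 0 then 1 else if i = n then n - 1 else i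
  have hq0 : q 0 = 1 := if_pos rfl
  have hqn : q n = n - 1 := (if_neg (by omega)).trans (if_pos rfl)
  have hq : ∀ i, i ≠ 0 → i ≠ n → q i = i := fun i h h' => (if_neg h).trans (if_neg h')
  have key : ∀ j < n, ∃ u v, dTildeEdge n j = s(u, v) ∧ q v = q u + 1 := by
    intro j hj
    unfold dTildeEdge
    split_ifs with h0 h1
    · exact ⟨0, 2, rfl, by rw [hq0, hq 2 (by omega) (by omega)]⟩
    · exact ⟨n - 2, n, rfl, by rw [hqn, hq (n - 2) (by omega) (by omega)]; omega⟩
    · exact ⟨j, j + 1, rfl, by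
        rw [hq j (by omega) (by omega), hq (j + 1) (by omega) (by omega)]⟩
  refine ⟨fun x => decide (Even (q (e x).val)), fun a => ?_⟩
  obtain ⟨u, v, huv, hq⟩ := key (f a).val (f a).isLt
  have h1 := (h a).trans huv
  rw [Sym2.eq_iff] at h1
  rcases h1 with ⟨h1, h2⟩ | ⟨h1, h2⟩
  · simp only [h1, h2, hq, Nat.even_add_one, decide_not]
  · simp only [h1, h2, hq, Nat.even_add_one, decide_not, Bool.not_not]

/-- An orientation of the cycle formed by the arrows of a quiver: the arrow `a` leads from
`start a` to the next vertex if `pos a` holds, and in the opposite direction otherwise. -/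
structure Winding (Q : Quiv I A) (n : ℕ) where
  pos : A → Prop
  start : A ≃ I
  next : I → I
  iterate : ∀ x, next^[n] x = x
  src_pos : ∀ a, pos a → Q.src a = start a
  tgt_pos : ∀ a, pos a → Q.tgt a = next (start a)
  src_neg : ∀ a, ¬ pos a → Q.src a = next (start a)
  tgt_neg : ∀ a, ¬ pos a → Q.tgt a = start a

theorem Winding.next_injective {Q : Quiv I A} {n : ℕ} (w : Q.Winding n) (hn : 0 < n) :
    Function.Injective w.next := by
  intro x y hxy
  obtain ⟨m, rfl⟩ := Nat.exists_eq_succ_of_ne_zero hn.ne'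
  rw [← w.iterate x, ← w.iterate y, Function.iterate_succ_apply, Function.iterate_succ_apply, hxy]

/-- An extended Dynkin quiver of type `A` is bipartite or an odd cycle. In the second case the
involution of a symmetric quiver is a reflection of the cycle, and therefore respects the
orientation. -/
theorem _root_.SymQuiver.bipartite_or_winding (S : SymQuiver I A) (hQ : S.toQuiv.Acyclic)
    (h : S.toQuiv.IsATilde) : S.toQuiv.Bipartite ∨
      ∃ (n : ℕ) (w : S.toQuiv.Winding n), Odd n ∧ ∀ a, w.pos (S.σ₁ a) ↔ w.pos a := by
  obtain ⟨n, hn, e, f, h⟩ := h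
  rcases Nat.even_or_odd n with he | ho
  · left
    let c := ZMod.castHom he.two_dvd (ZMod 2)
    have key : ∀ t : ZMod 2, decide (t + 1 = 0) = !decide (t = 0) := by decide
    refine ⟨fun x => decide (c (e x) = 0), fun a => ?_⟩
    have h1 := h a
    rw [Sym2.eq_iff] at h1
    rcases h1 with ⟨h1, h2⟩ | ⟨h1, h2⟩
    · simp only [h1, h2, map_add, map_one, key]
    · simp only [h1, h2, map_add, map_one, key, Bool.not_not]
  · right
    have hn3 : 3 ≤ n := by
      obtain ⟨m, rfl⟩ := ho
      omega
    have : NeZero n := ⟨by omega⟩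
    have h2 : (2 : ZMod n) ≠ 0 := by
      intro h2
      have h3 : ((2 : ℕ) : ZMod n) = 0 := by exact_mod_cast h2
      have := Nat.le_of_dvd (by norm_num) ((ZMod.natCast_eq_zero_iff 2 n).1 h3)
      omega
    have h2c : ∀ t : ZMod n, t + t = 0 → t = 0 := by
      intro t ht
      obtain ⟨m, hm⟩ := ho
      have h3 : (n : ZMod n) * t = 0 := by rw [ZMod.natCast_self, zero_mul]
      have h4 : (n : ZMod n) * t = m * (t + t) + t := by
        have h5 : (n : ZMod n) = 2 * m + 1 := by
          exact_mod_cast congrArg (Nat.cast (R := ZMod n)) hm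
        rw [h5]
        ring
      rw [h3, ht, mul_zero, zero_add] at h4
      exact h4.symm
    let pos : A → Prop := fun a => e (S.tgt a) = e (S.src a) + 1
    have hpos : ∀ a, pos a → e (S.src a) = f a ∧ e (S.tgt a) = f a + 1 := by
      intro a ha
      have h1 := h a
      rw [Sym2.eq_iff] at h1
      rcases h1 with h1 | ⟨h3, h4⟩
      · exact h1
      · exfalso
        apply h2
        have : f a = f a + 1 + 1 := by rw [← h3, ← ha, h4]
        have : f a + 2 = f a + 0 := by rw [add_zero]; nth_rewrite 2 [this]; ring
        exact add_left_cancel this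
    have hneg : ∀ a, ¬ pos a → e (S.src a) = f a + 1 ∧ e (S.tgt a) = f a := by
      intro a ha
      have h1 := h a
      rw [Sym2.eq_iff] at h1
      rcases h1 with ⟨h3, h4⟩ | h1
      · exact absurd (by change e (S.tgt a) = e (S.src a) + 1; rw [h3, h4]) ha
      · exact h1
    -- `τ` is the involution of the vertices in the coordinates of the cycle. It preserves
    -- adjacency, hence is a rotation or a reflection.
    let τ : ZMod n → ZMod n := fun i => e (S.σ (e.symm i))
    have hτ : ∀ x, e (S.σ x) = τ (e x) := fun x => by simp [τ]
    have hττ : ∀ i, τ (τ i) = i := fun i => by simp [τ, S.σ_invol]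
    have hτi : Function.Injective τ := fun i j hij => by rw [← hττ i, hij, hττ]
    have hstep : ∀ i, τ (i + 1) = τ i + 1 ∨ τ i = τ (i + 1) + 1 := by
      intro i
      obtain ⟨a, rfl⟩ := f.surjective i
      have h3 : ∀ b, pos b ∨ e (S.src b) = e (S.tgt b) + 1 := fun b => by
        by_cases hb : pos b
        · exact Or.inl hb
        · right
          rw [(hneg b hb).1, (hneg b hb).2]
      have h4 := h3 (S.σ₁ a)
      change e (S.tgt (S.σ₁ a)) = e (S.src (S.σ₁ a)) + 1 ∨ _ at h4
      rw [S.src_σ₁, S.tgt_σ₁, hτ, hτ] at h4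
      by_cases ha : pos a
      · rw [(hpos a ha).1, (hpos a ha).2] at h4
        exact h4.symm
      · rw [(hneg a ha).1, (hneg a ha).2] at h4
        exact h4
    have hconst : ∀ i, τ (i + 1) = τ i + 1 → τ (i + 1 + 1) = τ (i + 1) + 1 := by
      intro i hi
      rcases hstep (i + 1) with h3 | h3
      · exact h3
      · exfalso
        have h4 : i + 1 + 1 = i := hτi (add_right_cancel (h3.symm.trans hi))
        apply h2
        have : i + 2 = i + 0 := by rw [add_zero]; nth_rewrite 2 [← h4]; ring
        exact add_left_cancel this
    have hrefl : ∀ i, τ i = τ (i + 1) + 1 := by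
      intro i
      refine (hstep i).resolve_left fun hi => ?_
      -- Otherwise `τ` is a rotation, hence the identity, and an arrow `a` and its image `σ a`
      -- form an oriented cycle.
      have h3 : ∀ m : ℕ, τ (i + m + 1) = τ (i + m) + 1 := by
        intro m
        induction m with
        | zero => simpa using hi
        | succ m ih =>
          have := hconst _ ih
          push_cast
          rw [← add_assoc]
          exact this
      have h4 : ∀ m : ℕ, τ (i + m) = τ i + m := by
        intro m
        induction m with
        | zero => simp
        | succ m ih =>
          push_cast
          rw [← add_assoc, h3, ih, add_assoc]
      obtain ⟨u, hu⟩ : ∃ u, u = τ i - i := ⟨_, rfl⟩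
      have h5 : ∀ j, τ j = j + u := by
        intro j
        have h6 := h4 (j - i).val
        rw [ZMod.natCast_zmod_val] at h6
        rw [add_sub_cancel] at h6
        rw [h6, hu]
        ring
      have h6 : u = 0 := by
        apply h2c
        have h7 := hττ i
        rw [h5 (τ i), h5 i] at h7
        linear_combination h7
      have h7 : ∀ x, S.σ x = x := fun x => e.injective (by rw [hτ, h5, h6, add_zero])
      let a := f.symm 0
      refine hQ (S.src a) (Relation.TransGen.tail (Relation.TransGen.single ⟨a, rfl, rfl⟩)
        ⟨S.σ₁ a, ?_, ?_⟩)
      · rw [S.src_σ₁, h7]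
      · rw [S.tgt_σ₁, h7]
    refine ⟨n, ⟨pos, f.trans e.symm, fun x => e.symm (e x + 1), ?_, ?_, ?_, ?_, ?_⟩, ho, ?_⟩
    · intro x
      have : ∀ m : ℕ, (fun x => e.symm (e x + 1))^[m] x = e.symm (e x + m) := by
        intro m
        induction m with
        | zero => simp
        | succ m ih =>
          rw [Function.iterate_succ_apply', ih]
          simp [add_assoc]
      rw [this, ZMod.natCast_self, add_zero, e.symm_apply_apply]
    · intro a ha
      simp [← (hpos a ha).1]
    · intro a ha
      simp [← (hpos a ha).2]
    · intro a ha
      simp [← (hneg a ha).1]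
    · intro a ha
      simp [← (hneg a ha).2]
    · have h3 : ∀ a, pos a → pos (S.σ₁ a) := by
        intro a ha
        change e (S.tgt (S.σ₁ a)) = e (S.src (S.σ₁ a)) + 1
        rw [S.tgt_σ₁, S.src_σ₁, hτ, hτ, ha]
        exact hrefl _
      exact fun a => ⟨fun ha => by simpa only [S.σ₁_invol] using h3 _ ha, h3 a⟩

end Quiv


/-! ### Changing the sign of the arrows -/

namespace QAct

variable {k : Type u} [Field k] {I A : Type} [Fintype I] [DecidableEq I] [Fintype A]
  [DecidableEq A] {Q : Quiv I A} {M P : Type u} [AddCommGroup M] [Module k M] [AddCommGroup P]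
  [Module k P] {o : QAct k Q M} {r : QAct k Q P}

/-- `M` is isomorphic, by an involution, to the module obtained by changing the sign of all
arrows. -/
def HasTwist (o : QAct k Q M) : Prop :=
  ∃ ρ : M →ₗ[k] M, (∀ m, ρ (ρ m) = m) ∧ (∀ x m, ρ (o.E x m) = o.E x (ρ m)) ∧
    ∀ a m, ρ (o.arr a m) = -o.arr a (ρ m)

theorem hasTwist_of_bipartite (h : Q.Bipartite) : o.HasTwist := by
  obtain ⟨s, hs⟩ := h
  let c : I → k := fun x => if s x then 1 else -1
  have hc : ∀ x, c x * c x = 1 := fun x => by simp only [c]; split_ifs <;> ring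
  have hca : ∀ a, c (Q.tgt a) = -c (Q.src a) := fun a => by
    simp only [c, hs]
    cases s (Q.src a) <;> simp
  let ρ : M →ₗ[k] M := ∑ x, c x • o.E x
  have h1 : ∀ m, ρ m = ∑ x, c x • o.E x m := fun m => by simp [ρ]
  have h2 : ∀ x m, ρ (o.E x m) = c x • o.E x m := by
    intro x m
    rw [h1, Finset.sum_eq_single x]
    · rw [o.E_same]
    · intro z _ hz
      rw [o.E_ne _ _ _ hz, smul_zero]
    · simp
  have h3 : ∀ x m, o.E x (ρ m) = c x • o.E x m := by
    intro x m
    rw [h1, map_sum, Finset.sum_eq_single x]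
    · rw [map_smul, o.E_same]
    · intro z _ hz
      rw [map_smul, o.E_ne _ _ _ hz.symm, smul_zero]
    · simp
  refine ⟨ρ, fun m => ?_, fun x m => (h2 x m).trans (h3 x m).symm, fun a m => ?_⟩
  · rw [h1]
    simp only [h3, smul_smul, hc, one_smul]
    exact o.sum_E m
  · rw [← o.E_arr, h2, E_arr, ← o.arr_E a (ρ m), h3, map_smul, arr_E, hca, neg_smul]

/-- In characteristic zero the field can be divided into two parts that are exchanged by the
translation by `1`. -/
theorem exists_alternating (k : Type u) [Field k] [CharZero k] : ∃ H : Set k, ∀ μ, μ + 1 ∈ H ↔ μ ∉ H := by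
  -- `r` picks a representative modulo the integers; the parity of the difference decides.
  let G := AddSubgroup.zmultiples (1 : k)
  let r : k → k := fun μ => Quotient.out (QuotientAddGroup.mk μ : k ⧸ G)
  have hr : ∀ μ, ∃ n : ℤ, (n : k) = μ - r μ := by
    intro μ
    have h1 : (QuotientAddGroup.mk (r μ) : k ⧸ G) = QuotientAddGroup.mk μ := Quotient.out_eq _
    rw [QuotientAddGroup.eq] at h1
    obtain ⟨n, hn⟩ := h1
    refine ⟨n, ?_⟩
    simp only [zsmul_eq_mul, mul_one] at hn
    rw [hn]
    ring
  have hr1 : ∀ μ, r (μ + 1) = r μ := by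
    intro μ
    have h1 : (QuotientAddGroup.mk (μ + 1) : k ⧸ G) = QuotientAddGroup.mk μ := by
      rw [QuotientAddGroup.eq]
      exact ⟨-1, by simp⟩
    simp only [r, h1]
  refine ⟨{μ | ∃ n : ℤ, Even n ∧ (n : k) = μ - r μ}, fun μ => ⟨?_, fun h => ?_⟩⟩
  · rintro ⟨n, hn, h1⟩ ⟨m, hm, h2⟩
    rw [hr1] at h1
    have h3 : ((n : ℤ) : k) = ((m + 1 : ℤ) : k) := by
      push_cast
      linear_combination h1 - h2
    rw [Int.cast_inj] at h3
    rw [h3, Int.even_add_one] at hn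
    exact hn hm
  · obtain ⟨n, hn⟩ := hr μ
    refine ⟨n + 1, ?_, ?_⟩
    · rw [Int.even_add_one]
      exact fun he => h ⟨n, he, hn⟩
    · rw [hr1]
      push_cast
      linear_combination hn

/-- If the arrows of `M` form a coboundary then they shift the generalized eigenspaces of a
graded endomorphism by one, and alternating signs on these define a twist. -/
theorem hasTwist_of_derivation [CharZero k] [IsAlgClosed k] [FiniteDimensional k M]
    {b : M →ₗ[k] M} (hE : ∀ x m, b (o.E x m) = o.E x (b m))
    (hb : ∀ a m, b (o.arr a m) = o.arr a (b m) + o.arr a m) : o.HasTwist := by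
  obtain ⟨H, hH⟩ := exists_alternating k
  have hc := isCompl_eigenSum b H
  have h1 : ∀ a μ, ∀ v ∈ Module.End.maxGenEigenspace b μ,
      o.arr a v ∈ Module.End.maxGenEigenspace b (μ + 1) := by
    intro a μ v hv
    rw [Module.End.mem_maxGenEigenspace] at hv ⊢
    obtain ⟨n, hn⟩ := hv
    refine ⟨n, ?_⟩
    have h2 : ∀ j : ℕ, ((b - (μ + 1) • (1 : Module.End k M)) ^ j) (o.arr a v) =
        o.arr a (((b - μ • (1 : Module.End k M)) ^ j) v) := by
      intro j
      induction j with
      | zero => rfl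
      | succ j ih =>
        rw [pow_succ', pow_succ', Module.End.mul_apply, ih, Module.End.mul_apply,
          LinearMap.sub_apply, hb, LinearMap.sub_apply, map_sub]
        simp only [LinearMap.add_apply, LinearMap.smul_apply, Module.End.one_apply, map_smul, add_smul,
          one_smul]
        abel
    rw [h2, hn, map_zero]
  have h2 : ∀ a, ∀ v ∈ eigenSum b H, o.arr a v ∈ eigenSum b Hᶜ := by
    intro a
    have : eigenSum b H ≤ (eigenSum b Hᶜ).comap (o.arr a) :=
      iSup₂_le fun μ hμ v hv => le_eigenSum b (T := Hᶜ) (fun h => (hH μ).1 h hμ) (h1 a μ v hv)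
    exact fun v hv => this hv
  have h3 : ∀ a, ∀ v ∈ eigenSum b Hᶜ, o.arr a v ∈ eigenSum b H := by
    intro a
    have : eigenSum b Hᶜ ≤ (eigenSum b H).comap (o.arr a) :=
      iSup₂_le fun μ hμ v hv => le_eigenSum b ((hH μ).2 hμ) (h1 a μ v hv)
    exact fun v hv => this hv
  let ρ : M →ₗ[k] M := LinearMap.ofIsCompl hc (Submodule.subtype _) (-Submodule.subtype _)
  have hl : ∀ v ∈ eigenSum b H, ρ v = v := fun v hv => LinearMap.ofIsCompl_apply_left hc ⟨v, hv⟩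
  have hr : ∀ v ∈ eigenSum b Hᶜ, ρ v = -v := fun v hv => LinearMap.ofIsCompl_apply_right hc ⟨v, hv⟩
  have hd : ∀ m, ∃ v ∈ eigenSum b H, ∃ w ∈ eigenSum b Hᶜ, v + w = m := fun m =>
    Submodule.mem_sup.1 (hc.sup_eq_top ▸ Submodule.mem_top)
  refine ⟨ρ, fun m => ?_, fun x m => ?_, fun a m => ?_⟩
  · obtain ⟨v, hv, w, hw, rfl⟩ := hd m
    simp only [map_add, map_neg, hl v hv, hr w hw, neg_neg]
  · obtain ⟨v, hv, w, hw, rfl⟩ := hd m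
    simp only [map_add, map_neg, hl v hv, hr w hw, hl _ (mem_eigenSum_of_comm (hE x) H hv),
      hr _ (mem_eigenSum_of_comm (hE x) Hᶜ hw)]
  · obtain ⟨v, hv, w, hw, rfl⟩ := hd m
    simp only [map_add, map_neg, hl v hv, hr w hw, hr _ (h2 a v hv), hl _ (h3 a w hw)]
    abel

/-- On a cycle the mesh relation says that the maps `N_a r_a` and `o_a N_a` are the components of
a morphism, up to signs. -/
theorem exists_mor_of_winding {n : ℕ} (w : Q.Winding n) (hn : 0 < n) {N : A → P →ₗ[k] M}
    (hs : ∀ a ξ, o.E (Q.src a) (N a ξ) = N a ξ) (ht : ∀ a ξ, N a (r.E (Q.tgt a) ξ) = N a ξ)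
    (hm : ∀ ξ, ∑ a, N a (r.arr a ξ) = ∑ a, o.arr a (N a ξ)) :
    ∃ z : P →ₗ[k] M, IsMor r o z ∧ ∀ a, ∃ s : k, s * s = 1 ∧
      (∀ ξ, z (r.E (Q.src a) ξ) = s • N a (r.arr a ξ)) ∧
      ∀ ξ, z (r.E (Q.tgt a) ξ) = s • o.arr a (N a ξ) := by
  classical
  have hinj := w.next_injective hn
  have ht' : ∀ a x ξ, N a (r.E x ξ) = if x = Q.tgt a then N a ξ else 0 := by
    intro a x ξ
    split_ifs with h
    · rw [h, ht]
    · rw [← ht, r.E_ne _ _ _ (Ne.symm h), map_zero]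
  have hs' : ∀ a x ξ, o.E x (N a ξ) = if x = Q.src a then N a ξ else 0 := by
    intro a x ξ
    split_ifs with h
    · rw [h, hs]
    · rw [← hs, o.E_ne _ _ _ h]
  have har : ∀ a x ξ, r.arr a (r.E x ξ) = if x = Q.src a then r.arr a ξ else 0 := by
    intro a x ξ
    split_ifs with h
    · rw [h, arr_E]
    · exact r.arr_E_ne (Ne.symm h) _
  have hao : ∀ a x m, o.E x (o.arr a m) = if x = Q.tgt a then o.arr a m else 0 := by
    intro a x ξ
    split_ifs with h
    · rw [h, E_arr]
    · exact o.E_arr_ne h _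
  -- The contribution of `a` to the mesh relation at the first and at the second end of its edge.
  -- The relation says that the two sums agree, and each of them has one term for every vertex.
  let T₁ : A → P →ₗ[k] M := fun a => if w.pos a then N a ∘ₗ r.arr a else -(o.arr a ∘ₗ N a)
  let T₂ : A → P →ₗ[k] M := fun a => if w.pos a then o.arr a ∘ₗ N a else -(N a ∘ₗ r.arr a)
  have h1 : ∀ a x ξ, T₁ a (r.E x ξ) = if x = w.start a then T₁ a ξ else 0 := by
    intro a x ξ
    by_cases h : w.pos a
    · simp only [T₁, if_pos h, LinearMap.comp_apply, har, w.src_pos a h, apply_ite (N a), map_zero]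
    · simp only [T₁, if_neg h, LinearMap.neg_apply, LinearMap.comp_apply, ht', w.tgt_neg a h,
        apply_ite (o.arr a), map_zero]
      split_ifs <;> simp
  have h1' : ∀ a x ξ, o.E x (T₁ a ξ) = if x = w.start a then T₁ a ξ else 0 := by
    intro a x ξ
    by_cases h : w.pos a
    · simp only [T₁, if_pos h, LinearMap.comp_apply, hs', w.src_pos a h]
    · simp only [T₁, if_neg h, LinearMap.neg_apply, LinearMap.comp_apply, map_neg, hao,
        w.tgt_neg a h]
      split_ifs <;> simp
  have h2 : ∀ a x ξ, T₂ a (r.E x ξ) = if x = w.next (w.start a) then T₂ a ξ else 0 := by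
    intro a x ξ
    by_cases h : w.pos a
    · simp only [T₂, if_pos h, LinearMap.comp_apply, ht', w.tgt_pos a h, apply_ite (o.arr a),
        map_zero]
    · simp only [T₂, if_neg h, LinearMap.neg_apply, LinearMap.comp_apply, har, w.src_neg a h,
        apply_ite (N a), map_zero]
      split_ifs <;> simp
  have h12 : ∑ a, T₁ a = ∑ a, T₂ a := by
    refine LinearMap.ext fun ξ => ?_
    rw [LinearMap.sum_apply, LinearMap.sum_apply, ← sub_eq_zero, ← Finset.sum_sub_distrib]
    have h3 := sub_eq_zero.2 (hm ξ)
    rw [← Finset.sum_sub_distrib] at h3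
    refine (Finset.sum_congr rfl fun a _ => ?_).trans h3
    by_cases h : w.pos a
    · simp only [T₁, T₂, if_pos h, LinearMap.comp_apply]
    · simp only [T₁, T₂, if_neg h, LinearMap.comp_apply, LinearMap.neg_apply]
      abel
  have hz1 : ∀ a ξ, (∑ b, T₁ b) (r.E (w.start a) ξ) = T₁ a ξ := by
    intro a ξ
    rw [LinearMap.sum_apply, Finset.sum_eq_single a]
    · rw [h1, if_pos rfl]
    · intro b _ hb
      rw [h1, if_neg fun h => hb (w.start.injective h.symm)]
    · simp
  have hz2 : ∀ a ξ, (∑ b, T₁ b) (r.E (w.next (w.start a)) ξ) = T₂ a ξ := by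
    intro a ξ
    rw [h12, LinearMap.sum_apply, Finset.sum_eq_single a]
    · rw [h2, if_pos rfl]
    · intro b _ hb
      rw [h2, if_neg fun h => hb (w.start.injective (hinj h.symm))]
    · simp
  have hzE : ∀ x ξ, (∑ b, T₁ b) (r.E x ξ) = o.E x ((∑ b, T₁ b) ξ) := by
    intro x ξ
    simp only [LinearMap.sum_apply, map_sum, h1, h1']
  have key : ∀ a, ∃ s : k, s * s = 1 ∧
      (∀ ξ, (∑ b, T₁ b) (r.E (Q.src a) ξ) = s • N a (r.arr a ξ)) ∧
      ∀ ξ, (∑ b, T₁ b) (r.E (Q.tgt a) ξ) = s • o.arr a (N a ξ) := by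
    intro a
    by_cases h : w.pos a
    · refine ⟨1, one_mul 1, fun ξ => ?_, fun ξ => ?_⟩
      · rw [w.src_pos a h, hz1, one_smul]
        simp only [T₁, if_pos h, LinearMap.comp_apply]
      · rw [w.tgt_pos a h, hz2, one_smul]
        simp only [T₂, if_pos h, LinearMap.comp_apply]
    · refine ⟨-1, by ring, fun ξ => ?_, fun ξ => ?_⟩
      · rw [w.src_neg a h, hz2, neg_one_smul]
        simp only [T₂, if_neg h, LinearMap.comp_apply, LinearMap.neg_apply]
      · rw [w.tgt_neg a h, hz1, neg_one_smul]
        simp only [T₁, if_neg h, LinearMap.comp_apply, LinearMap.neg_apply]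
  refine ⟨∑ b, T₁ b, ⟨hzE, fun a ξ => ?_⟩, key⟩
  obtain ⟨s, -, hs1, hs2⟩ := key a
  rw [← r.E_arr, hs2, ← o.arr_E a ((∑ b, T₁ b) ξ), ← hzE, hs1, map_smul]

end QAct


namespace QAct

variable {k : Type u} [Field k] {I A : Type} [Fintype I] [DecidableEq I] [Fintype A]
  [DecidableEq A] {Q : Quiv I A} {M : Type u} [AddCommGroup M] [Module k M] {o : QAct k Q M}

/-- On a cycle, either the arrows form a coboundary, or all of them act bijectively: a functional
that separates the arrows from the coboundaries gives an endomorphism of `M`, which is not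
nilpotent since the trace of its components is the value at the arrows. -/
theorem exists_derivation_or_bijective [FiniteDimensional k M] (ho : o.EndLocal) {n : ℕ}
    (w : Q.Winding n) (hn : 0 < n) :
    (∃ b : M →ₗ[k] M, (∀ x m, b (o.E x m) = o.E x (b m)) ∧
      ∀ a m, b (o.arr a m) = o.arr a (b m) + o.arr a m) ∨
    ∀ a, (∀ v, o.arr a v = 0 → o.E (Q.src a) v = 0) ∧ ∀ v, ∃ u, o.arr a u = o.E (Q.tgt a) v := by
  let R : Submodule k (M →ₗ[k] M) :=
    { carrier := {h | ∀ x m, h (o.E x m) = o.E x (h m)}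
      add_mem' := fun h h' x m => by simp [h x m, h' x m]
      zero_mem' := fun x m => by simp
      smul_mem' := fun c h hh x m => by simp [hh x m] }
  let δ : R →ₗ[k] (A → M →ₗ[k] M) :=
    { toFun := fun h a => o.arr a ∘ₗ h.1 - h.1 ∘ₗ o.arr a
      map_add' := fun h h' => by
        funext a
        ext m
        simp only [Submodule.coe_add, LinearMap.sub_apply, LinearMap.comp_apply,
          LinearMap.add_apply, map_add, Pi.add_apply]
        abel
      map_smul' := fun c h => by
        funext a
        ext m
        simp [smul_sub] }
  by_cases hmem : o.arr ∈ LinearMap.range δ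
  · left
    obtain ⟨h, hh⟩ := hmem
    refine ⟨-h.1, fun x m => ?_, fun a m => ?_⟩
    · rw [LinearMap.neg_apply, LinearMap.neg_apply, h.2, map_neg]
    · have h1 := LinearMap.congr_fun (congrFun hh a) m
      change o.arr a (h.1 m) - h.1 (o.arr a m) = o.arr a m at h1
      rw [sub_eq_iff_eq_add] at h1
      rw [LinearMap.neg_apply, LinearMap.neg_apply, map_neg, h1]
      abel
  · right
    obtain ⟨F, hF, hF0⟩ := Submodule.exists_dual_map_eq_bot_of_notMem hmem inferInstance
    have hF0' : ∀ h, F (δ h) = 0 := by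
      intro h
      have : F (δ h) ∈ (LinearMap.range δ).map F := ⟨_, ⟨h, rfl⟩, rfl⟩
      rw [hF0] at this
      exact this
    let c₀ : (A → M →ₗ[k] M) →ₗ[k] (A → M →ₗ[k] M) :=
      { toFun := fun c a => o.E (Q.tgt a) ∘ₗ c a ∘ₗ o.E (Q.src a)
        map_add' := fun c c' => by funext a; ext m; simp
        map_smul' := fun t c => by funext a; ext m; simp }
    obtain ⟨N, hN, hs, ht, hm⟩ := exists_mesh o o (F ∘ₗ c₀) (by
      intro h hh
      refine (congrArg F ?_).trans (hF0' ⟨h, hh⟩)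
      funext a
      refine LinearMap.ext fun m => ?_
      change o.E _ (o.arr a (h (o.E _ m)) - h (o.arr a (o.E _ m))) = o.arr a (h m) - h (o.arr a m)
      rw [hh, arr_E, arr_E, map_sub, E_arr, ← hh, E_arr]) (by
      intro c
      refine congrArg F ?_
      funext a
      refine LinearMap.ext fun m => ?_
      change o.E _ (o.E _ (c a (o.E _ (o.E _ m)))) = o.E _ (c a (o.E _ m))
      rw [E_same, E_same])
    obtain ⟨z, hz, hzs⟩ := exists_mor_of_winding w hn hs ht hm
    -- The trace of `N_a ∘ o_a` is up to sign that of the restriction of `z` to the tail of `a`.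
    have hFa : F o.arr ≠ 0 := hF
    have htr : ∑ a, LinearMap.trace k M (N a ∘ₗ o.arr a) ≠ 0 := by
      rw [← hN]
      refine fun h0 => hFa ((congrArg F ?_).trans h0)
      funext a
      refine LinearMap.ext fun m => ?_
      change _ = o.E _ (o.arr a (o.E _ m))
      rw [arr_E, E_arr]
    have hzb : Function.Bijective z := by
      refine (ho.bijective_or_nilpotent z hz).resolve_right ?_
      rintro ⟨m, hm0⟩
      refine htr (Finset.sum_eq_zero fun a _ => ?_)
      obtain ⟨s, hss, hs1, -⟩ := hzs a
      have h1 : N a ∘ₗ o.arr a = s • (z * o.E (Q.src a)) := by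
        refine LinearMap.ext fun m => ?_
        change _ = s • z (o.E _ m)
        rw [hs1, smul_smul, hss, one_smul]
        rfl
      have hcomm : Commute z (o.E (Q.src a)) := LinearMap.ext fun m => hz.E _ m
      have h2 : IsNilpotent (z * o.E (Q.src a)) :=
        hcomm.isNilpotent_mul_right ⟨m, hm0⟩
      rw [h1, map_smul, (LinearMap.isNilpotent_trace_of_isNilpotent h2).eq_zero, smul_zero]
    intro a
    obtain ⟨s, hss, hs1, hs2⟩ := hzs a
    refine ⟨fun v hv => hzb.1 ?_, fun v => ?_⟩
    · rw [hs1, hv, map_zero, smul_zero, map_zero]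
    · obtain ⟨u, rfl⟩ := hzb.2 v
      exact ⟨s • N a u, by rw [map_smul, ← hs2, hz.E]⟩

/-- On an odd cycle on which the involution preserves the orientation, a module with a mesh cannot
have all arrows acting bijectively: the mesh gives a nonzero map `∇M → M`, hence the monodromy and
its negative would have a common eigenvalue. -/
theorem IsMesh.not_bijective [IsAlgClosed k] [CharZero k] [FiniteDimensional k M]
    {S : SymQuiver I A} {o : QAct k S.toQuiv M} (hQ : S.toQuiv.Acyclic) (ho : o.EndLocal)
    {N : A → Module.Dual k M →ₗ[k] M} (hN : IsMesh S o 1 N) {n : ℕ} (w : S.toQuiv.Winding n)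
    (hn : Odd n) (hpos : ∀ a, w.pos (S.σ₁ a) ↔ w.pos a) :
    ¬ ∀ a, (∀ v, o.arr a v = 0 → o.E (S.src a) v = 0) ∧
      ∀ v, ∃ u, o.arr a u = o.E (S.tgt a) v := by
  classical
  intro hbij
  have := ho.nontrivial
  have hinj := w.next_injective hn.pos
  have hinj' : ∀ a u v, o.E (S.src a) u = u → o.E (S.src a) v = v → o.arr a u = o.arr a v → u = v := by
    intro a u v hu hv h
    have := (hbij a).1 (u - v) (by rw [map_sub, h, sub_self])
    rw [map_sub, hu, hv] at this
    exact sub_eq_zero.1 this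
  -- The inverses of the arrows.
  have hg : ∀ a, ∃ g : M →ₗ[k] M, (∀ v, o.arr a (g v) = o.E (S.tgt a) v) ∧
      ∀ v, o.E (S.src a) (g v) = g v := by
    intro a
    choose g₀ hg₀ using (hbij a).2
    have h1 : ∀ v, o.arr a (o.E (S.src a) (g₀ v)) = o.E (S.tgt a) v := fun v => by
      rw [arr_E, hg₀]
    refine ⟨⟨⟨fun v => o.E (S.src a) (g₀ v), fun u v => ?_⟩, fun c v => ?_⟩, h1, fun v =>
      o.E_same _ _⟩
    · refine hinj' a _ _ (o.E_same _ _) ?_ ?_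
      · rw [map_add, E_same, E_same]
      · rw [map_add, h1, h1, h1, map_add]
    · refine hinj' a _ _ (o.E_same _ _) ?_ ?_
      · rw [map_smul, E_same, RingHom.id_apply]
      · rw [RingHom.id_apply, map_smul, h1, h1, map_smul]
  choose g hga hgE using hg
  have hag : ∀ a v, g a (o.arr a v) = o.E (S.src a) v := fun a v =>
    hinj' a _ _ (hgE a _) (o.E_same _ _) (by rw [hga, arr_E, E_arr])
  have hgt : ∀ a v, g a (o.E (S.tgt a) v) = g a v := fun a v =>
    hinj' a _ _ (hgE a _) (hgE a _) (by rw [hga, hga, E_same])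
  -- The step from each vertex to the next one, and its sum `t`.
  let τ : A → M →ₗ[k] M := fun a => if w.pos a then o.arr a else g a
  have hτs : ∀ a v, τ a (o.E (w.start a) v) = τ a v := by
    intro a v
    by_cases h : w.pos a
    · simp only [τ, if_pos h, ← w.src_pos a h, arr_E]
    · simp only [τ, if_neg h, ← w.tgt_neg a h, hgt]
  have hτt : ∀ a v, o.E (w.next (w.start a)) (τ a v) = τ a v := by
    intro a v
    by_cases h : w.pos a
    · simp only [τ, if_pos h, ← w.tgt_pos a h, E_arr]
    · simp only [τ, if_neg h, ← w.src_neg a h, hgE]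
  have hτ0 : ∀ a v, τ a v = 0 → o.E (w.start a) v = 0 := by
    intro a v hv
    by_cases h : w.pos a
    · simp only [τ, if_pos h] at hv
      rw [← w.src_pos a h]
      exact (hbij a).1 v hv
    · simp only [τ, if_neg h] at hv
      rw [← w.tgt_neg a h, ← hga, hv, map_zero]
  have hτs' : ∀ a x v, τ a (o.E x v) = if x = w.start a then τ a v else 0 := by
    intro a x v
    split_ifs with h
    · rw [h, hτs]
    · rw [← hτs, o.E_ne _ _ _ (Ne.symm h), map_zero]
  have hτt' : ∀ a x v, o.E (w.next x) (τ a v) = if x = w.start a then τ a v else 0 := by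
    intro a x v
    split_ifs with h
    · rw [h, hτt]
    · rw [← hτt, o.E_ne _ _ _ fun h' => h (hinj h')]
  let t : M →ₗ[k] M := ∑ a, τ a
  have ht : ∀ v, t v = ∑ a, τ a v := fun v => LinearMap.sum_apply _ _ _
  have htE : ∀ x v, t (o.E x v) = o.E (w.next x) (t v) := by
    intro x v
    rw [ht, ht, map_sum]
    simp only [hτs', hτt']
  have htτ : ∀ a v, t (o.E (w.start a) v) = τ a v := by
    intro a v
    rw [ht, Finset.sum_eq_single a]
    · exact hτs a v
    · intro b _ hb
      rw [hτs', if_neg fun h => hb (w.start.injective h.symm)]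
    · simp
  have htinj : Function.Injective t := by
    rw [injective_iff_map_eq_zero]
    intro v hv
    rw [← o.sum_E v]
    refine Finset.sum_eq_zero fun x _ => ?_
    obtain ⟨a, rfl⟩ := w.start.surjective x
    refine hτ0 a v ?_
    rw [← htτ, htE, hv, map_zero]
  -- The monodromy.
  have hTE : ∀ x v, (t ^ n) (o.E x v) = o.E x ((t ^ n) v) := by
    have : ∀ (m : ℕ) x v, (t ^ m) (o.E x v) = o.E (w.next^[m] x) ((t ^ m) v) := by
      intro m
      induction m with
      | zero => exact fun x v => rfl
      | succ m ih =>
        intro x v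
        rw [pow_succ, Module.End.mul_apply, Module.End.mul_apply, htE, ih,
          Function.iterate_succ_apply]
    intro x v
    rw [this, w.iterate]
  have hTt : ∀ v, (t ^ n) (t v) = t ((t ^ n) v) := fun v =>
    LinearMap.congr_fun ((Commute.refl t).pow_left n) v
  have hTτ : ∀ a v, (t ^ n) (τ a v) = τ a ((t ^ n) v) := by
    intro a v
    rw [← htτ, ← htτ, hTt, hTE]
  have hT : IsMor o o (t ^ n) := by
    refine ⟨hTE, fun a v => ?_⟩
    by_cases h : w.pos a
    · have := hTτ a v
      simpa only [τ, if_pos h] using this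
    · have h1 := hTτ a (o.arr a v)
      simp only [τ, if_neg h, hag] at h1
      have h2 := congrArg (o.arr a) h1
      rw [hga, hTE, arr_E, ← hTE, E_arr] at h2
      exact h2.symm
  have hTinj : Function.Injective (t ^ n) := by
    rw [Module.End.coe_pow]
    exact htinj.iterate n
  -- The morphism `z : ∇M → M` of the mesh.
  obtain ⟨z, hz, hzs⟩ := exists_mor_of_winding w hn.pos hN.E_src hN.E_tgt (fun ξ => by
    rw [hN.mesh, one_smul])
  have hγE : ∀ a (α : Module.Dual k M),
      (o.dual S).E (S.src a) (-(α ∘ₗ g (S.σ₁ a))) = -(α ∘ₗ g (S.σ₁ a)) := by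
    intro a α
    refine LinearMap.ext fun m => ?_
    change -(α (g _ (o.E _ m))) = -(α (g _ m))
    rw [← S.tgt_σ₁, hgt]
  have hγ : ∀ a (α : Module.Dual k M),
      (o.dual S).arr a (-(α ∘ₗ g (S.σ₁ a))) = (o.dual S).E (S.tgt a) α := by
    intro a α
    refine LinearMap.ext fun m => ?_
    change -(-(α (g _ (o.arr _ m)))) = α (o.E _ m)
    rw [neg_neg, hag, S.src_σ₁]
  have hzτ : ∀ a (α : Module.Dual k M), z (-(α ∘ₗ τ (S.σ₁ a))) = τ a (z α) := by
    intro a α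
    by_cases h : w.pos a
    · simp only [τ, if_pos h, if_pos ((hpos a).2 h)]
      exact hz.arr a α
    · simp only [τ, if_neg h, if_neg fun h' => h ((hpos a).1 h')]
      refine hinj' a _ _ ?_ (hgE a _) ?_
      · rw [← hz.E, hγE]
      · rw [← hz.arr, hγ, hga, hz.E]
  -- The involution preserves the orientation, so `z` turns the transpose of `t` into `-t`. As `n`
  -- is odd, the same holds for the monodromy `t ^ n`, which is a nonzero scalar `c` up to a nilpotent
  -- part; since `c ≠ -c`, the map `z` vanishes.
  have hzt : ∀ α : Module.Dual k M, z (α ∘ₗ t) = -t (z α) := by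
    intro α
    have h1 : α ∘ₗ t = -∑ a, -(α ∘ₗ τ (S.σ₁ a)) := by
      rw [Finset.sum_neg_distrib, neg_neg]
      refine LinearMap.ext fun m => ?_
      rw [LinearMap.comp_apply, ht, map_sum, LinearMap.sum_apply]
      exact (Equiv.sum_comp ⟨S.σ₁, S.σ₁, S.σ₁_invol, S.σ₁_invol⟩ fun a => α (τ a m)).symm
    rw [h1, map_neg, map_sum, ht]
    simp only [hzτ]
  have hzT : ∀ α : Module.Dual k M, z (α ∘ₗ (t ^ n)) = -(t ^ n) (z α) := by
    have : ∀ (m : ℕ) (α : Module.Dual k M), z (α ∘ₗ (t ^ m)) = (-1 : k) ^ m • (t ^ m) (z α) := by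
      intro m
      induction m with
      | zero =>
        intro α
        rw [pow_zero, pow_zero, one_smul]
        rfl
      | succ m ih =>
        intro α
        rw [pow_succ' t, Module.End.mul_eq_comp, ← LinearMap.comp_assoc, ih, hzt, map_neg, ← Module.End.mul_eq_comp,
          ← pow_succ', pow_succ t, Module.End.mul_apply, pow_succ]
        simp
    intro α
    rw [this, hn.neg_one_pow, neg_one_smul]
  obtain ⟨c, m, hc⟩ := ho.exists_scalar hT
  have hc0 : c ≠ 0 := by
    rintro rfl
    rw [zero_smul, sub_zero] at hc
    exact EndLocal.not_both o hTinj m hc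
  have hzν : ∀ (j : ℕ) (α : Module.Dual k M), z (α ∘ₗ ((t ^ n - c • LinearMap.id) ^ j : Module.End k M)) =
      (-1 : k) ^ j • ((t ^ n + c • LinearMap.id) ^ j : Module.End k M) (z α) := by
    intro j
    induction j with
    | zero =>
      intro α
      rw [pow_zero, pow_zero, pow_zero, one_smul]
      rfl
    | succ j ih =>
      intro α
      have h1 : α ∘ₗ (t ^ n - c • LinearMap.id) = α ∘ₗ (t ^ n) - c • α := by
        ext v; simp
      have h2 : -(t ^ n) (z α) - c • z α = -((t ^ n + c • LinearMap.id : Module.End k M) (z α)) := by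
        simp only [LinearMap.add_apply, LinearMap.smul_apply, LinearMap.id_apply]
        abel
      rw [pow_succ' (t ^ n - c • LinearMap.id), Module.End.mul_eq_comp, ← LinearMap.comp_assoc, ih,
        h1, map_sub, hzT, map_smul, h2, map_neg, pow_succ (t ^ n + c • LinearMap.id),
        Module.End.mul_apply, pow_succ, mul_neg_one, neg_smul, smul_neg]
  have hz0 : ∀ α, z α = 0 := by
    intro α
    have h1 := hzν m α
    rw [hc, LinearMap.comp_zero, map_zero] at h1
    have h2 := (smul_eq_zero.1 h1.symm).resolve_left (pow_ne_zero _ (neg_ne_zero.2 one_ne_zero))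
    have h3 := bijective_of_nilpotent hc (c := 2 * c) (mul_ne_zero two_ne_zero hc0)
    have h4 : (2 * c) • LinearMap.id + (t ^ n - c • LinearMap.id) = t ^ n + c • LinearMap.id := by
      rw [two_mul, add_smul]
      abel
    rw [h4] at h3
    have h5 : Function.Injective ((t ^ n + c • LinearMap.id) ^ m : Module.End k M) := by
      rw [Module.End.coe_pow]
      exact h3.1.iterate m
    exact h5 (h2.trans (map_zero _).symm)
  have hN0 : ∀ a α, N a α = 0 := by
    intro a α
    obtain ⟨s, hss, hs1, -⟩ := hzs a
    rw [← hN.E_tgt, ← hγ]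
    have h1 := hs1 (-(α ∘ₗ g (S.σ₁ a)))
    rw [hz0] at h1
    exact (smul_eq_zero.1 h1.symm).resolve_left fun h => by simp [h] at hss
  have htop : (⊥ : Submodule k M) = ⊤ := by
    refine nakayama hQ o (fun x m hm => ?_) (fun a m hm => ?_) fun m => ?_
    · rw [(Submodule.mem_bot k).1 hm, map_zero]
      exact Submodule.zero_mem _
    · rw [(Submodule.mem_bot k).1 hm, map_zero]
      exact Submodule.zero_mem _
    · obtain ⟨α, v, rfl⟩ := hN.surj m
      exact ⟨0, Submodule.zero_mem _, v, by simp [hN0]⟩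
  exact bot_ne_top htop

/-- Over a tame symmetric quiver, the signs of the arrows of a module with a mesh can be changed. -/
theorem IsMesh.hasTwist [IsAlgClosed k] [CharZero k] [FiniteDimensional k M]
    {S : SymQuiver I A} {o : QAct k S.toQuiv M} (hS : S.IsTame) (ho : o.EndLocal)
    {N : A → Module.Dual k M →ₗ[k] M} (hN : IsMesh S o 1 N) : o.HasTwist := by
  obtain ⟨hQ, hA | hD⟩ := hS
  · rcases S.bipartite_or_winding hQ hA with hb | ⟨n, w, hn, hpos⟩
    · exact hasTwist_of_bipartite hb
    · rcases exists_derivation_or_bijective ho w hn.pos with ⟨b, hE, hb⟩ | hb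
      · exact hasTwist_of_derivation hE hb
      · exact absurd hb (hN.not_bijective hQ ho w hn hpos)
  · exact hasTwist_of_bipartite hD.bipartite

/-- A twist moves the sign in the mesh relation. -/
theorem IsMesh.exists_neg [IsAlgClosed k] [CharZero k] [FiniteDimensional k M]
    {S : SymQuiver I A} {o : QAct k S.toQuiv M} (hS : S.IsTame) (ho : o.EndLocal)
    {N : A → Module.Dual k M →ₗ[k] M} (hN : IsMesh S o 1 N) : ∃ N', IsMesh S o (-1) N' := by
  obtain ⟨ρ, hρ, hE, ha⟩ := hN.hasTwist hS ho
  have hρ0 : ∀ v, ρ v = 0 → v = 0 := fun v hv => by rw [← hρ v, hv, map_zero]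
  refine ⟨fun a => ρ ∘ₗ N a, fun a α => ?_, fun a α => ?_, fun α => ?_, fun α h1 h2 => ?_, fun m => ?_,
    fun α v hα hv h => ?_⟩
  · rw [LinearMap.comp_apply, ← hE, hN.E_src]
  · rw [LinearMap.comp_apply, LinearMap.comp_apply, hN.E_tgt]
  · have := congrArg ρ (hN.mesh α)
    rw [one_smul, map_sum, map_sum] at this
    simp only [LinearMap.comp_apply]
    rw [this, neg_one_smul, ← Finset.sum_neg_distrib]
    exact Finset.sum_congr rfl fun a _ => ha a _
  · exact hN.inj α h1 fun a => hρ0 _ (h2 a)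
  · obtain ⟨α, v, hm⟩ := hN.surj (ρ m)
    refine ⟨α, fun a => -ρ (v a), ?_⟩
    rw [← hρ m, hm, map_add, map_sum, map_sum]
    simp only [LinearMap.comp_apply, ha, map_neg]
  · obtain ⟨β, hβ⟩ := hN.exact α (fun a => ρ (v a)) hα (fun a => by rw [← hE, hv]) (by
      have := congrArg ρ h
      rw [map_sum, neg_one_smul, map_neg, map_sum, ← Finset.sum_neg_distrib] at this
      simp only [LinearMap.comp_apply, hρ, ha, neg_neg] at this
      rw [this, one_smul])
    exact ⟨β, fun a => ⟨(hβ a).1, by rw [LinearMap.comp_apply, (hβ a).2, hρ]⟩⟩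

end QAct


/-! ### The mesh and the reflection functors -/

theorem Quiv.Acyclic.src_ne_tgt {I A : Type} {Q : Quiv I A} (hQ : Q.Acyclic) (a : A) :
    Q.src a ≠ Q.tgt a := fun h => hQ (Q.src a) (Relation.TransGen.single ⟨a, rfl, h.symm⟩)

namespace QAct

variable {k : Type u} [Field k] {I A : Type} [Fintype I] [DecidableEq I] [Fintype A]
  [DecidableEq A] {S : SymQuiver I A} {M : Type u} [AddCommGroup M] [Module k M]

/-- The arrow `a` on `∇M ⊕ M` as it appears in the course of the reflections: it acts by the arrow
`a` of `∇M`, by the arrow `a` of `M`, or by the mesh map `N_a : ∇M → M` for the reversed arrow. -/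
def meshArr (o : QAct k S.toQuiv M) (N : A → Module.Dual k M →ₗ[k] M) (a : A) :
    Module.Dual k M × M →ₗ[k] Module.Dual k M × M :=
  ((o.dual S).arr a ∘ₗ LinearMap.fst k _ _).prod
    (o.arr a ∘ₗ LinearMap.snd k _ _ + N a ∘ₗ LinearMap.fst k _ _)

theorem meshArr_apply (o : QAct k S.toQuiv M) (N : A → Module.Dual k M →ₗ[k] M) (a : A)
    (w : Module.Dual k M × M) :
    o.meshArr N a w = ((o.dual S).arr a w.1, o.arr a w.2 + N a w.1) := rfl

/-- The space at the vertex `y` after the reflections at the vertices in `J`: the component of `M`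
if `y` belongs to `J`, and the component of `∇M` otherwise. -/
noncomputable def stageComp (o : QAct k S.toQuiv M) (J : Finset I) (y : I) :
    Submodule k (Module.Dual k M × M) :=
  if y ∈ J then Submodule.prod ⊥ (LinearMap.range (o.E y))
  else Submodule.prod (LinearMap.range ((o.dual S).E y)) ⊥

theorem mem_range_E {Q : Quiv I A} {P : Type u} [AddCommGroup P] [Module k P] (o : QAct k Q P)
    (y : I) (m : P) : m ∈ LinearMap.range (o.E y) ↔ o.E y m = m :=
  ⟨by rintro ⟨v, rfl⟩; exact o.E_same y v, fun h => ⟨m, h⟩⟩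

theorem mem_stageComp_of_mem {o : QAct k S.toQuiv M} {J : Finset I} {y : I} (h : y ∈ J)
    {w : Module.Dual k M × M} : w ∈ o.stageComp J y ↔ w.1 = 0 ∧ o.E y w.2 = w.2 := by
  rw [stageComp, if_pos h, Submodule.mem_prod, Submodule.mem_bot, mem_range_E]

theorem mem_stageComp_of_notMem {o : QAct k S.toQuiv M} {J : Finset I} {y : I} (h : y ∉ J)
    {w : Module.Dual k M × M} : w ∈ o.stageComp J y ↔ (o.dual S).E y w.1 = w.1 ∧ w.2 = 0 := by
  rw [stageComp, if_neg h, Submodule.mem_prod, Submodule.mem_bot, mem_range_E]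

/-- The quiver `R` is obtained from `Q` by reversing the arrows that leave the set `J`, which is
closed under predecessors. -/
structure IsReversed (S : SymQuiver I A) (J : Finset I) (R : Quiv I A) : Prop where
  closed : ∀ a, S.tgt a ∈ J → S.src a ∈ J
  src_eq : ∀ a, R.src a = if S.src a ∈ J ∧ S.tgt a ∉ J then S.tgt a else S.src a
  tgt_eq : ∀ a, R.tgt a = if S.src a ∈ J ∧ S.tgt a ∉ J then S.src a else S.tgt a

/-- `U` is (isomorphic, through `i`, to) the representation reached after the reflections at the
vertices in `J`. -/
structure IsStage (o : QAct k S.toQuiv M) (N : A → Module.Dual k M →ₗ[k] M) (J : Finset I)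
    {R : Quiv I A} (U : QRep k R) (i : ∀ y, U.obj y →ₗ[k] Module.Dual k M × M) : Prop where
  rev : IsReversed S J R
  inj : ∀ y, Function.Injective (i y)
  range : ∀ y, LinearMap.range (i y) = o.stageComp J y
  map : ∀ a u, i _ (U.map a u) = o.meshArr N a (i _ u)

section

variable {o : QAct k S.toQuiv M} {N : A → Module.Dual k M →ₗ[k] M} {J : Finset I} {R : Quiv I A}

theorem IsStage.mem {U : QRep k R} {i : ∀ y, U.obj y →ₗ[k] Module.Dual k M × M}
    (h : IsStage o N J U i) (y : I) (u : U.obj y) : i y u ∈ o.stageComp J y :=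
  h.range y ▸ LinearMap.mem_range_self _ _

theorem IsStage.hom {U : QRep k R} {i : ∀ y, U.obj y →ₗ[k] Module.Dual k M × M}
    (h : IsStage o N J U i) (a : A) {y z : I} (hy : R.src a = y) (hz : R.tgt a = z) (u : U.obj y) :
    i z (U.hom a hy hz u) = o.meshArr N a (i y u) := by
  subst hy hz
  exact h.map a u

theorem IsMesh.map_E_ne {c : k} (hN : IsMesh S o c N) {a : A} {x : I} (h : S.tgt a ≠ x)
    (α : Module.Dual k M) : N a ((o.dual S).E x α) = 0 := by
  rw [← hN.E_tgt, (o.dual S).E_ne _ _ _ h, map_zero]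

/-- The representation reached after the reflections at the vertices in `J` exists. -/
theorem IsMesh.exists_isStage (hQ : S.toQuiv.Acyclic) {c : k} (hN : IsMesh S o c N)
    (hR : IsReversed S J R) : ∃ (U : QRep k R) (i : ∀ y, U.obj y →ₗ[k] Module.Dual k M × M),
      IsStage o N J U i := by
  have key : ∀ a, ∀ w ∈ o.stageComp J (R.src a), o.meshArr N a w ∈ o.stageComp J (R.tgt a) := by
    intro a w hw
    rw [meshArr_apply]
    rw [hR.src_eq] at hw
    rw [hR.tgt_eq]
    by_cases h1 : S.src a ∈ J
    · by_cases h2 : S.tgt a ∈ J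
      · rw [if_neg (by simp [h2]), mem_stageComp_of_mem h1] at hw
        rw [if_neg (by simp [h2]), mem_stageComp_of_mem h2, hw.1, map_zero, map_zero, add_zero, E_arr]
        exact ⟨rfl, rfl⟩
      · rw [if_pos ⟨h1, h2⟩, mem_stageComp_of_notMem h2] at hw
        rw [if_pos ⟨h1, h2⟩, mem_stageComp_of_mem h1, hw.2, map_zero, zero_add, hN.E_src, ← hw.1,
          arr_E_ne _ (hQ.src_ne_tgt a)]
        exact ⟨rfl, rfl⟩
    · have h2 : S.tgt a ∉ J := fun h => h1 (hR.closed a h)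
      rw [if_neg (by simp [h1]), mem_stageComp_of_notMem h1] at hw
      rw [if_neg (by simp [h1]), mem_stageComp_of_notMem h2, hw.2, map_zero, zero_add, E_arr, ← hw.1,
        hN.map_E_ne (hQ.src_ne_tgt a).symm]
      exact ⟨rfl, rfl⟩
  exact ⟨{ obj := fun y => o.stageComp J y, map := fun a => (o.meshArr N a).restrict (key a) },
    fun y => Submodule.subtype _, hR, fun y => Subtype.val_injective, fun y => Submodule.range_subtype _,
    fun a u => rfl⟩

variable {x : I}

theorem IsReversed.of_src (hR : IsReversed S J R) (hx : x ∉ J) {a : A} (h : S.src a = x) :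
    R.src a = x ∧ R.tgt a = S.tgt a ∧ S.tgt a ∉ J := by
  have h1 : ¬ (S.src a ∈ J ∧ S.tgt a ∉ J) := fun h' => hx (h ▸ h'.1)
  exact ⟨by rw [hR.src_eq, if_neg h1, h], by rw [hR.tgt_eq, if_neg h1],
    fun h' => hx (h ▸ hR.closed a h')⟩

theorem IsReversed.of_tgt (hR : IsReversed S J R) (hx : x ∉ J) (hp : ∀ a, S.tgt a = x → S.src a ∈ J)
    {a : A} (h : S.tgt a = x) : R.src a = x ∧ R.tgt a = S.src a ∧ S.src a ∈ J := by
  have h1 : S.src a ∈ J ∧ S.tgt a ∉ J := ⟨hp a h, fun h' => hx (h ▸ h')⟩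
  exact ⟨by rw [hR.src_eq, if_pos h1, h], by rw [hR.tgt_eq, if_pos h1], h1.1⟩

theorem IsReversed.src_eq_iff (hR : IsReversed S J R) (hx : x ∉ J)
    (hp : ∀ a, S.tgt a = x → S.src a ∈ J) (a : A) : R.src a = x ↔ S.src a = x ∨ S.tgt a = x := by
  refine ⟨fun h => ?_, ?_⟩
  · rw [hR.src_eq] at h
    split_ifs at h
    · exact Or.inr h
    · exact Or.inl h
  · rintro (h | h)
    · exact (hR.of_src hx h).1
    · exact (hR.of_tgt hx hp h).1

theorem IsReversed.isSource (hQ : S.toQuiv.Acyclic) (hR : IsReversed S J R) (hx : x ∉ J)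
    (hp : ∀ a, S.tgt a = x → S.src a ∈ J) : R.IsSource x := by
  intro a h
  rw [hR.tgt_eq] at h
  split_ifs at h with h1
  · exact hx (h ▸ h1.1)
  · exact h1 ⟨hp a h, fun h' => hx (h ▸ h')⟩

theorem IsReversed.reflect (hQ : S.toQuiv.Acyclic) (hR : IsReversed S J R) (hx : x ∉ J)
    (hp : ∀ a, S.tgt a = x → S.src a ∈ J) : IsReversed S (insert x J) (R.reflect x) := by
  have hsrc : ∀ a, S.src a = x → S.tgt a ≠ x := fun a h h' => hQ.src_ne_tgt a (h.trans h'.symm)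
  have htouch : ∀ a, (R.src a = x ∨ R.tgt a = x) ↔ (S.src a = x ∨ S.tgt a = x) := fun a => by
    rw [← hR.src_eq_iff hx hp]
    exact or_iff_left (hR.isSource hQ hx hp a)
  have key : ∀ a, (R.reflect x).src a =
        (if S.src a ∈ insert x J ∧ S.tgt a ∉ insert x J then S.tgt a else S.src a) ∧
      (R.reflect x).tgt a =
        if S.src a ∈ insert x J ∧ S.tgt a ∉ insert x J then S.src a else S.tgt a := by
    intro a
    simp only [Quiv.reflect, htouch]
    by_cases h1 : S.src a = x
    · obtain ⟨h2, h3, h4⟩ := hR.of_src hx h1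
      have h5 : S.src a ∈ insert x J ∧ S.tgt a ∉ insert x J :=
        ⟨by simp [h1], by simp [h4, hsrc a h1]⟩
      rw [if_pos (Or.inl h1), if_pos (Or.inl h1), if_pos h5, if_pos h5, h2, h3, h1]
      exact ⟨rfl, rfl⟩
    · by_cases h1' : S.tgt a = x
      · obtain ⟨h2, h3, h4⟩ := hR.of_tgt hx hp h1'
        have h5 : ¬ (S.src a ∈ insert x J ∧ S.tgt a ∉ insert x J) := by simp [h1']
        rw [if_pos (Or.inr h1'), if_pos (Or.inr h1'), if_neg h5, if_neg h5, h2, h3, h1']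
        exact ⟨rfl, rfl⟩
      · have h5 : ¬ (S.src a = x ∨ S.tgt a = x) := by tauto
        have h6 : (S.src a ∈ insert x J ∧ S.tgt a ∉ insert x J) ↔ (S.src a ∈ J ∧ S.tgt a ∉ J) := by
          simp [h1, h1']
        simp only [if_neg h5, h6]
        exact ⟨hR.src_eq a, hR.tgt_eq a⟩
  refine ⟨fun a h => ?_, fun a => (key a).1, fun a => (key a).2⟩
  rcases Finset.mem_insert.1 h with h | h
  · exact Finset.mem_insert_of_mem (hp a h)
  · exact Finset.mem_insert_of_mem (hR.closed a h)

/-- The exactness of the mesh says that the next stage is obtained by a reflection functor. -/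
theorem IsStage.isReflMinus (hQ : S.toQuiv.Acyclic) (hN : IsMesh S o (-1) N) {U : QRep k R}
    {i : ∀ y, U.obj y →ₗ[k] Module.Dual k M × M} (hU : IsStage o N J U i) (hx : x ∉ J)
    (hp : ∀ a, S.tgt a = x → S.src a ∈ J) {W : QRep k (R.reflect x)}
    {j : ∀ y, W.obj y →ₗ[k] Module.Dual k M × M} (hW : IsStage o N (insert x J) W j) :
    QRep.IsReflMinus x U W := by
  have hR := hU.rev
  have hne := hQ.src_ne_tgt
  have hxJ : x ∈ insert x J := Finset.mem_insert_self _ _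
  have hcomp : ∀ y, y ≠ x → o.stageComp (insert x J) y = o.stageComp J y := by
    intro y hy
    simp only [stageComp, Finset.mem_insert, hy, false_or]
  have he : ∀ y, y ≠ x → ∃ e : U.obj y ≃ₗ[k] W.obj y, ∀ u, j y (e u) = i y u := by
    intro y hy
    have hr : LinearMap.range (i y) = LinearMap.range (j y) := by
      rw [hU.range, hW.range, hcomp y hy]
    refine ⟨(LinearEquiv.ofInjective _ (hU.inj y)).trans ((LinearEquiv.ofEq _ _ hr).trans
      (LinearEquiv.ofInjective _ (hW.inj y)).symm), fun u => ?_⟩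
    exact congrArg Subtype.val ((LinearEquiv.ofInjective _ (hW.inj y)).apply_symm_apply _)
  choose e he using he
  -- The values of the arrows at `x` and of the mesh maps on the elements of a stage.
  have hsrc : ∀ a, S.src a = x → ∀ u : U.obj (R.tgt a), (o.dual S).E (S.tgt a) (i _ u).1 = (i _ u).1 ∧
      (i _ u).2 = 0 ∧ o.meshArr N a (i _ u) = (0, N a (i _ u).1) := by
    intro a ha u
    obtain ⟨-, h2, h3⟩ := hR.of_src hx ha
    obtain ⟨h4, h5⟩ := (mem_stageComp_of_notMem (by rw [h2]; exact h3)).1 (hU.mem _ u)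
    have h6 : (o.dual S).E (S.tgt a) (i _ u).1 = (i _ u).1 := by
      rw [← h2]
      exact h4
    have h7 : (o.dual S).arr a (i _ u).1 = 0 := by
      rw [← h6, arr_E_ne _ (hne a)]
    refine ⟨h6, h5, ?_⟩
    rw [meshArr_apply, h5, h7, map_zero, zero_add]
  have htgt : ∀ a, S.tgt a = x → ∀ u : U.obj (R.tgt a), o.E (S.src a) (i _ u).2 = (i _ u).2 ∧
      (i _ u).1 = 0 ∧ o.meshArr N a (i _ u) = (0, o.arr a (i _ u).2) := by
    intro a ha u
    obtain ⟨-, h2, h3⟩ := hR.of_tgt hx hp ha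
    obtain ⟨h4, h5⟩ := (mem_stageComp_of_mem (by rw [h2]; exact h3)).1 (hU.mem _ u)
    have h6 : o.E (S.src a) (i _ u).2 = (i _ u).2 := by
      rw [← h2]
      exact h5
    refine ⟨h6, h4, ?_⟩
    rw [meshArr_apply, h4, map_zero, map_zero, add_zero]
  have hEN : ∀ a α, S.src a = x → o.E x (N a α) = N a α := fun a α ha => by rw [← ha, hN.E_src]
  have hEN' : ∀ a α, S.src a ≠ x → o.E x (N a α) = 0 := fun a α ha => by
    rw [← hN.E_src, o.E_ne _ _ _ (Ne.symm ha)]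
  have hEa : ∀ a m, S.tgt a = x → o.E x (o.arr a m) = o.arr a m := fun a m ha => by rw [← ha, E_arr]
  have hNE : ∀ a β, S.tgt a = x → N a ((o.dual S).E x β) = N a β := fun a β ha => by
    rw [← ha, hN.E_tgt]
  have haE : ∀ a β, S.src a = x → (o.dual S).arr a ((o.dual S).E x β) = (o.dual S).arr a β :=
    fun a β ha => by rw [← ha, arr_E]
  have hx0 : ∀ a : {a // R.src a = x}, S.src a.1 = x ∨ S.tgt a.1 = x := fun a =>
    (hR.src_eq_iff hx hp a.1).1 a.2
  let F₀ : (∀ a : {a // R.src a = x}, U.obj (R.tgt a)) →ₗ[k] Module.Dual k M × M :=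
    ∑ a : {a // R.src a = x}, o.meshArr N a.1 ∘ₗ i (R.tgt a) ∘ₗ LinearMap.proj a
  have hF₀ : ∀ w, F₀ w = ∑ a : {a // R.src a = x}, o.meshArr N a.1 (i _ (w a)) := fun w => by
    simp [F₀]
  have hF₁ : ∀ w, F₀ w ∈ LinearMap.range (j x) := by
    intro w
    rw [hW.range, hF₀]
    refine Submodule.sum_mem _ fun a _ => ?_
    rw [mem_stageComp_of_mem hxJ]
    rcases hx0 a with ha | ha
    · rw [(hsrc a ha _).2.2]
      exact ⟨rfl, hEN _ _ ha⟩
    · rw [(htgt a ha _).2.2]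
      exact ⟨rfl, hEa _ _ ha⟩
  let π : (∀ a : {a // R.src a = x}, U.obj (R.tgt a)) →ₗ[k] W.obj x :=
    (LinearEquiv.ofInjective _ (hW.inj x)).symm.toLinearMap ∘ₗ F₀.codRestrict _ hF₁
  have hπ : ∀ w, j x (π w) = ∑ a : {a // R.src a = x}, o.meshArr N a.1 (i _ (w a)) := fun w =>
    (congrArg Subtype.val ((LinearEquiv.ofInjective _ (hW.inj x)).apply_symm_apply _)).trans (hF₀ w)
  -- Elements of a stage with given components.
  have hmk : ∀ (α : A → Module.Dual k M) (v : A → M) (a : {a // R.src a = x}),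
      ∃ u : U.obj (R.tgt a), (S.src a.1 = x → i _ u = ((o.dual S).E (S.tgt a.1) (α a), 0)) ∧
        (S.tgt a.1 = x → i _ u = (0, o.E (S.src a.1) (v a))) := by
    intro α v a
    rcases hx0 a with ha | ha
    · obtain ⟨-, h2, h3⟩ := hR.of_src hx ha
      have : ((o.dual S).E (S.tgt a.1) (α a), (0 : M)) ∈ LinearMap.range (i (R.tgt a)) := by
        rw [hU.range, h2, mem_stageComp_of_notMem h3]
        exact ⟨E_same _ _ _, rfl⟩
      obtain ⟨u, hu⟩ := this
      exact ⟨u, fun _ => hu, fun h => absurd (ha.trans h.symm) (hne a)⟩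
    · obtain ⟨-, h2, h3⟩ := hR.of_tgt hx hp ha
      have : ((0 : Module.Dual k M), o.E (S.src a.1) (v a)) ∈ LinearMap.range (i (R.tgt a)) := by
        rw [hU.range, h2, mem_stageComp_of_mem h3]
        exact ⟨rfl, E_same _ _ _⟩
      obtain ⟨u, hu⟩ := this
      exact ⟨u, fun h => absurd (h.trans ha.symm) (hne a), fun _ => hu⟩
  have hsum : ∀ (w : ∀ a : {a // R.src a = x}, U.obj (R.tgt a)) (f : A → M),
      (∀ a, S.src a ≠ x → S.tgt a ≠ x → f a = 0) →
      (∀ a : {a // R.src a = x}, o.meshArr N a.1 (i _ (w a)) = (0, f a.1)) →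
      j x (π w) = (0, ∑ a, f a) := by
    intro w f hf hw
    have h1 : ∑ a : {a // R.src a = x}, f a.1 = ∑ a, f a := by
      rw [← Finset.sum_subtype (Finset.univ.filter fun a => R.src a = x) (by simp) f]
      refine Finset.sum_filter_of_ne fun a _ ha => ?_
      rw [hR.src_eq_iff hx hp]
      by_contra hcon
      push Not at hcon
      exact ha (hf a hcon.1 hcon.2)
    rw [hπ, Finset.sum_congr rfl fun a _ => hw a, ← h1]
    refine Prod.ext ?_ ?_
    · rw [Prod.fst_sum, Finset.sum_const_zero]
    · rw [Prod.snd_sum]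
  refine ⟨e, π, fun m => ?_, le_antisymm (fun w hw => ?_) ?_, fun a hs ht hs' ht' v => ?_,
    fun a hs ht hs' ht' v => ?_⟩
  · -- Surjectivity.
    obtain ⟨hm1, hm2⟩ := (mem_stageComp_of_mem hxJ).1 (hW.mem x m)
    obtain ⟨α, v, hαv⟩ := hN.surj (j x m).2
    choose u hu1 hu2 using hmk α v
    refine ⟨u, hW.inj x ((hsum u (fun a => o.E x (N a (α a) + o.arr a (v a))) ?_ ?_).trans ?_)⟩
    · intro a h1 h2
      rw [map_add, hEN' a _ h1, o.E_arr_ne (Ne.symm h2), add_zero]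
    · intro a
      rcases hx0 a with ha | ha
      · rw [(hsrc a ha _).2.2, hu1 a ha, hN.E_tgt, map_add,
          o.E_arr_ne fun h => hne a (ha.trans h), add_zero, hEN _ _ ha]
      · rw [(htgt a ha _).2.2, hu2 a ha, arr_E, map_add, hEa _ _ ha,
          hEN' a _ fun h => hne a (h.trans ha.symm), zero_add]
    · refine Prod.ext hm1.symm ?_
      change ∑ a, o.E x (N a (α a) + o.arr a (v a)) = _
      rw [← map_sum, Finset.sum_add_distrib, ← hαv, hm2]
  · -- The kernel is contained in the image, by exactness in the middle.
    let α : A → Module.Dual k M := fun a => if h : R.src a = x then (i _ (w ⟨a, h⟩)).1 else 0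
    let v : A → M := fun a => if h : R.src a = x then (i _ (w ⟨a, h⟩)).2 else 0
    have hα : ∀ a : {a // R.src a = x}, α a.1 = (i _ (w a)).1 := fun a => dif_pos a.2
    have hv : ∀ a : {a // R.src a = x}, v a.1 = (i _ (w a)).2 := fun a => dif_pos a.2
    have hα0 : ∀ a, R.src a ≠ x → α a = 0 := fun a ha => dif_neg ha
    have hv0 : ∀ a, R.src a ≠ x → v a = 0 := fun a ha => dif_neg ha
    have h1 := hsum w (fun a => N a (α a) + o.arr a (v a)) (by
      intro a h1 h2
      have h3 : R.src a ≠ x := fun h => by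
        rcases (hR.src_eq_iff hx hp a).1 h with h | h
        · exact h1 h
        · exact h2 h
      rw [hα0 a h3, hv0 a h3, map_zero, map_zero, add_zero]) (by
      intro a
      rw [hα, hv]
      rcases hx0 a with ha | ha
      · rw [(hsrc a ha _).2.2, (hsrc a ha _).2.1, map_zero, add_zero]
      · rw [(htgt a ha _).2.2, (htgt a ha _).2.1, map_zero, zero_add])
    rw [LinearMap.mem_ker.1 hw, map_zero, Finset.sum_add_distrib] at h1
    obtain ⟨β, hβ⟩ := hN.exact α v (by
      intro a
      by_cases h : R.src a = x
      · rw [hα ⟨a, h⟩]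
        rcases hx0 ⟨a, h⟩ with ha | ha
        · exact (hsrc a ha _).1
        · rw [(htgt a ha _).2.1, map_zero]
      · rw [hα0 a h, map_zero]) (by
      intro a
      by_cases h : R.src a = x
      · rw [hv ⟨a, h⟩]
        rcases hx0 ⟨a, h⟩ with ha | ha
        · rw [(hsrc a ha _).2.1, map_zero]
        · exact (htgt a ha _).1
      · rw [hv0 a h, map_zero]) (by
      rw [neg_one_smul]
      exact eq_neg_of_add_eq_zero_left (congrArg Prod.snd h1).symm)
    obtain ⟨u, hu⟩ : ((o.dual S).E x β, (0 : M)) ∈ LinearMap.range (i x) := by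
      rw [hU.range, mem_stageComp_of_notMem hx]
      exact ⟨E_same _ _ _, rfl⟩
    refine ⟨u, funext fun a => hU.inj _ ?_⟩
    rw [LinearMap.pi_apply, hU.hom, hu, meshArr_apply]
    simp only [map_zero, zero_add]
    rcases hx0 a with ha | ha
    · rw [hN.map_E_ne fun h => hne a (ha.trans h.symm), haE _ _ ha, (hβ a).1, hα]
      exact Prod.ext rfl (hsrc a ha _).2.1.symm
    · rw [arr_E_ne _ fun h => hne a (h.trans ha.symm), hNE _ _ ha, (hβ a).2, hv]
      exact Prod.ext (htgt a ha _).2.1.symm rfl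
  · -- The composition vanishes, by the mesh relation.
    rintro _ ⟨u, rfl⟩
    obtain ⟨hu1, hu2⟩ := (mem_stageComp_of_notMem hx).1 (hU.mem x u)
    have h3 : ∀ a, S.src a ≠ x → (o.dual S).arr a (i x u).1 = 0 := fun a ha => by
      rw [← hu1, arr_E_ne _ ha]
    have h4 : ∀ a, S.tgt a ≠ x → N a (i x u).1 = 0 := fun a ha => by
      rw [← hu1, hN.map_E_ne ha]
    rw [LinearMap.mem_ker]
    apply hW.inj x
    rw [map_zero]
    refine (hsum _ (fun a => N a ((o.dual S).arr a (i x u).1) + o.arr a (N a (i x u).1)) ?_ ?_).trans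
      (Prod.ext rfl ?_)
    · intro a h1 h2
      rw [h3 a h1, h4 a h2, map_zero, map_zero, add_zero]
    · intro a
      rcases hx0 a with ha | ha
      · rw [(hsrc a ha _).2.2, LinearMap.pi_apply, hU.hom, meshArr_apply,
          h4 a fun h => hne a (ha.trans h.symm), map_zero, add_zero, add_zero]
      · rw [(htgt a ha _).2.2, LinearMap.pi_apply, hU.hom, meshArr_apply, hu2,
          h3 a fun h => hne a (h.trans ha.symm), map_zero, map_zero, zero_add, zero_add]
    · change ∑ a, (N a ((o.dual S).arr a (i x u).1) + o.arr a (N a (i x u).1)) = 0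
      rw [Finset.sum_add_distrib, hN.mesh, neg_one_smul, neg_add_cancel]
  · apply hW.inj
    rw [hW.hom, he, he, hU.map]
  · apply hW.inj
    rw [hW.hom, he, hπ, Finset.sum_eq_single ⟨a, hs⟩]
    · rw [Pi.single_eq_same]
    · intro b _ hb
      rw [Pi.single_eq_of_ne hb, map_zero, map_zero]
    · simp

/-- Reflecting successively at the remaining vertices leads from any stage to `V`. -/
theorem IsMesh.exists_isReflSeq (hQ : S.toQuiv.Acyclic) {V : QRep k S.toQuiv}
    {N : A → Module.Dual k (∀ x, V.obj x) →ₗ[k] (∀ x, V.obj x)} (hN : IsMesh S V.act (-1) N)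
    (m : ℕ) : ∀ (J : Finset I) (R : Quiv I A) (U : QRep k R)
      (i : ∀ y, U.obj y →ₗ[k] Module.Dual k (∀ x, V.obj x) × (∀ x, V.obj x)),
      IsStage V.act N J U i → Jᶜ.card = m →
      ∃ l : List I, l.Nodup ∧ (∀ x, x ∈ l ↔ x ∉ J) ∧ QRep.IsReflSeq R S.toQuiv l U V := by
  induction m with
  | zero =>
    intro J R U i hU hJ
    have hJ' : ∀ y, y ∈ J := by
      intro y
      by_contra h
      rw [Finset.card_eq_zero] at hJ
      have : y ∈ Jᶜ := Finset.mem_compl.2 h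
      rw [hJ] at this
      exact absurd this (Finset.notMem_empty y)
    obtain rfl : R = S.toQuiv := by
      refine Quiv.ext (funext fun a => ?_) (funext fun a => ?_)
      · rw [hU.rev.src_eq, if_neg fun h => h.2 (hJ' _)]
      · rw [hU.rev.tgt_eq, if_neg fun h => h.2 (hJ' _)]
    refine ⟨[], List.nodup_nil, fun x => by simp [hJ' x], QRep.IsReflSeq.nil
      ⟨⟨fun y => LinearMap.proj y ∘ₗ LinearMap.snd k _ _ ∘ₗ i y, fun a => ?_⟩, fun y => ?_, fun y v => ?_⟩⟩
    · refine LinearMap.ext fun u => ?_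
      have h1 := ((mem_stageComp_of_mem (hJ' _)).1 (hU.mem _ u)).1
      change (i _ (U.map a u)).2 _ = V.map a ((i _ u).2 _)
      rw [hU.map, meshArr_apply, h1]
      simp only [map_zero, add_zero, QRep.act_arr, Pi.single_eq_same]
    · rw [injective_iff_map_eq_zero]
      intro u hu
      obtain ⟨h1, h2⟩ := (mem_stageComp_of_mem (hJ' _)).1 (hU.mem _ u)
      apply hU.inj
      rw [map_zero]
      refine Prod.ext h1 ?_
      rw [← h2, QRep.act_E, show (i y u).2 y = 0 from hu, Pi.single_zero]
      rfl
    · obtain ⟨u, hu⟩ : ((0 : Module.Dual k (∀ x, V.obj x)), Pi.single y v) ∈ LinearMap.range (i y) := by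
        rw [hU.range, mem_stageComp_of_mem (hJ' y)]
        exact ⟨rfl, QRep.act_E_single _ _ _⟩
      refine ⟨u, ?_⟩
      change (i y u).2 y = v
      rw [hu]
      exact Pi.single_eq_same y v
  | succ m ih =>
    intro J R U i hU hJ
    -- A vertex outside `J` all of whose predecessors belong to `J`.
    obtain ⟨x, hx, hmin⟩ := hQ.wf.has_min {x | x ∉ J} (by
      have : Jᶜ.Nonempty := by
        rw [← Finset.card_pos, hJ]
        omega
      obtain ⟨x, hx⟩ := this
      exact ⟨x, Finset.mem_compl.1 hx⟩)
    have hp : ∀ a, S.tgt a = x → S.src a ∈ J := by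
      intro a ha
      by_contra h
      exact hmin (S.src a) h (Relation.TransGen.single ⟨a, rfl, ha⟩)
    obtain ⟨W, j, hW⟩ := hN.exists_isStage hQ (hU.rev.reflect hQ hx hp)
    obtain ⟨l, hl, hlm, hseq⟩ := ih (insert x J) _ W j hW (by
      have h1 := Finset.card_compl (insert x J)
      have h2 := Finset.card_compl J
      rw [Finset.card_insert_of_notMem hx] at h1
      omega)
    refine ⟨x :: l, ?_, fun y => ?_, QRep.IsReflSeq.cons (hU.rev.isSource hQ hx hp)
      (hU.isReflMinus hQ hN hx hp hW) hseq⟩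
    · rw [List.nodup_cons, hlm]
      exact ⟨fun h => h (Finset.mem_insert_self _ _), hl⟩
    · rw [List.mem_cons, hlm, Finset.mem_insert]
      by_cases h : y = x
      · simp only [h, true_or, true_iff]
        exact hx
      · simp [h]

/-- A representation with a mesh is the image of its dual under the Coxeter functor. -/
theorem IsMesh.isCoxeterMinus (hQ : S.toQuiv.Acyclic) {V : QRep k S.toQuiv}
    {N : A → Module.Dual k (∀ x, V.obj x) →ₗ[k] (∀ x, V.obj x)} (hN : IsMesh S V.act (-1) N) :
    QRep.IsCoxeterMinus (S.dual V) V := by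
  let i : ∀ y, (S.dual V).obj y →ₗ[k] Module.Dual k (∀ x, V.obj x) × (∀ x, V.obj x) := fun y =>
    LinearMap.inl k _ _ ∘ₗ (S.dualEquiv V).toLinearMap ∘ₗ LinearMap.single k _ y
  have hE : ∀ y (u : (S.dual V).obj y), (V.act.dual S).E y (S.dualEquiv V (Pi.single y u)) =
      S.dualEquiv V (Pi.single y u) := by
    intro y u
    have := (S.isMor_dualEquiv V).E y (Pi.single y u)
    rw [QRep.act_E_single] at this
    exact this.symm
  have hi : IsStage V.act N ∅ (S.dual V) i := by
    refine ⟨⟨fun a h => absurd h (Finset.notMem_empty _), fun a => by simp, fun a => by simp⟩,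
      fun y u v h => ?_, fun y => ?_, fun a u => ?_⟩
    · exact Pi.single_injective y ((S.dualEquiv V).injective (congrArg Prod.fst h))
    · ext w
      rw [mem_stageComp_of_notMem (Finset.notMem_empty y)]
      constructor
      · rintro ⟨u, rfl⟩
        exact ⟨hE y u, rfl⟩
      · rintro ⟨h1, h2⟩
        obtain ⟨α, hα⟩ := (S.dualEquiv V).surjective w.1
        refine ⟨α y, Prod.ext ?_ h2.symm⟩
        change S.dualEquiv V (Pi.single y (α y)) = w.1
        rw [← h1, ← hα]
        exact (S.isMor_dualEquiv V).E y α
    · rw [meshArr_apply]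
      refine Prod.ext ?_ ?_
      · have := (S.isMor_dualEquiv V).arr a (Pi.single _ u)
        rw [QRep.act_arr_single] at this
        exact this
      · change 0 = V.act.arr a 0 + N a (S.dualEquiv V (Pi.single _ u))
        rw [← hE, hN.map_E_ne (hQ.src_ne_tgt a).symm, map_zero, add_zero]
  obtain ⟨l, hl, hlm, hseq⟩ := hN.exists_isReflSeq hQ _ ∅ _ _ i hi rfl
  exact ⟨l, hl, fun x => (hlm x).2 (Finset.notMem_empty x), hseq⟩

end

end QAct


/-! ### The two implications -/

/-- If the differential of the minimal resolution is skew-symmetric on the representations of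
dimension `β` with an `ε`-symmetric form, then `V` is the image of its dual under the Coxeter
functor and the middle term of its almost split sequence carries a `(-ε)`-symmetric form. -/
theorem SymQuiver.isCoxeterMinus_and_exists_isForm {k : Type u} [Field k] [IsAlgClosed k]
    [CharZero k] {I A : Type} [Fintype I] [DecidableEq I] [Fintype A] [DecidableEq A]
    {S : SymQuiver I A} (hS : S.IsTame) {V : QRep k S.toQuiv} (hfin : V.IsFinDim)
    (hV : V.Indecomposable) {β : I → ℕ} (hβ : ∀ x, 2 ≤ β x) {ε : k} (hε : ε * ε = 1)
    (hex : ∃ (W : QRep k S.toQuiv) (B : LinearMap.BilinForm k (∀ x, W.obj x)),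
      W.IsFinDim ∧ W.dim = β ∧ S.IsForm ε W B) (h : S.IsSkewOn ε V β) :
    QRep.IsCoxeterMinus (S.dual V) V ∧
      ∃ (Z : QRep k S.toQuiv) (f : QRep.Hom (S.dual V) Z) (g : QRep.Hom Z V),
        QRep.Hom.IsAlmostSplit f g ∧ ∃ B, S.IsForm (-ε) Z B := by
  have hfd := QRep.isFinDim_iff.1 hfin
  have ho := QRep.Indecomposable.endLocal hV hfin
  obtain ⟨n, y, d, p, hres, hskew⟩ := h
  have hr := SymQuiver.isMinRes_of_isMinimalResolution hres
  have hadj := SymQuiver.isAdj_of_skew hS.1 hβ hε hex hskew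
  have hη : -ε * -ε = 1 := by rw [neg_mul_neg, hε]
  have hη0 : -ε ≠ 0 := by
    intro h0
    rw [h0, zero_mul] at hη
    exact zero_ne_one hη
  constructor
  · obtain ⟨N, hN⟩ := QAct.exists_isMesh hS.1 hη0 hr hadj
    obtain ⟨N', hN'⟩ := hN.exists_neg hS ho
    exact hN'.isCoxeterMinus hS.1
  · obtain ⟨L, _, _, _, z, f, g, hAS, ψ, hψ, hψn, hψs⟩ := QAct.exists_isAS hS.1 ho hη hr hadj
    obtain ⟨f', g', hfg⟩ := SymQuiver.exists_isAlmostSplit_of_isAS hAS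
    refine ⟨_, f', g', hfg, (ψ ∘ₗ z.toRepEquiv.toLinearMap).compl₂ z.toRepEquiv.toLinearMap,
      S.isForm_iff.2 ⟨(hψ.comp z.isMor_toRepEquiv).comp₂ z.isMor_toRepEquiv, ⟨fun v hv => ?_,
        fun v hv => ?_⟩, fun v w => hψs _ _⟩⟩
    · refine z.toRepEquiv.injective (Eq.trans (hψn.1 _ fun w => ?_) (map_zero _).symm)
      obtain ⟨w, rfl⟩ := z.toRepEquiv.surjective w
      exact hv w
    · refine z.toRepEquiv.injective (Eq.trans (hψn.2 _ fun w => ?_) (map_zero _).symm)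
      obtain ⟨w, rfl⟩ := z.toRepEquiv.surjective w
      exact hv w

theorem mainTheorem7 {k : Type u} [Field k] [IsAlgClosed k] [CharZero k]
    {I A : Type} [Fintype I] [DecidableEq I] [Fintype A] [DecidableEq A]
    (S : SymQuiver I A) (hS : S.IsTame)
    (V : QRep k S.toQuiv) (hfin : V.IsFinDim) (hV : V.Indecomposable)
    (β : I → ℕ) (hβ : S.IsSymmDim β) (hVβ : S.toQuiv.euler V.dim β = 0) :
    ((S.PropOp V → S.IsSkewOnSpRep V β) ∧
      (S.IsSymplecticDim k β → (∀ x, 2 ≤ β x) → S.IsSkewOnSpRep V β → S.PropOp V)) ∧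
    ((S.PropSpp V → S.IsSkewOnORep V β) ∧
      ((∀ x, 2 ≤ β x) → S.IsSkewOnORep V β → S.PropSpp V)) := by
  refine ⟨⟨?_, fun hex h2 h => ?_⟩, ?_, fun h2 h => ?_⟩
  · rintro ⟨-, Z, f, g, hfg, B, hB⟩
    exact SymQuiver.isSkewOn_of_isAlmostSplit hS.1 (one_mul 1) hfin hV hfg hB β
  · have := SymQuiver.isCoxeterMinus_and_exists_isForm hS hfin hV h2 (by ring) hex h
    rw [neg_neg] at this
    exact this
  · rintro ⟨-, Z, f, g, hfg, B, hB⟩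
    have := SymQuiver.isSkewOn_of_isAlmostSplit hS.1 (by ring) hfin hV hfg hB β
    rw [neg_neg] at this
    exact this
  · exact SymQuiver.isCoxeterMinus_and_exists_isForm hS hfin hV h2 (one_mul 1)
      (SymQuiver.exists_orthogonal hβ) h
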